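/- Let $\Phi$ be a finite root system of rank $d$ with set $I$ of simple roots and Cartan matrix of type $\mathbb{B}_d$ or $\mathbb{D}_d$ (with $\mathbb{D}_2=\mathbb{A}_1\times\mathbb{A}_1$, $\mathbb{D}_3=\mathbb{A}_3$), and let $c$ be a Coxeter element. The cluster complex of $(\Phi,c)$ is the simplicial complex whose vertices are the almost positive roots (positive roots and negative simple roots) and whose faces are the sets of pairwise $c$-compatible roots. Here $c$-compatibility is the family of symmetric relations (one for each Coxeter element $c$) such that $-\alpha_i$ is $c$-compatible with $\beta$ if and only if $\alpha_i$ has coefficient $0$ in $\beta$, and, for every initial letter $s$ of $c$, the roots $\beta,\beta'$ are $c$-compatible if and only if $\tau_s\beta,\tau_s\beta'$ are $scs$-compatible, where $\tau_s$ fixes $-\alpha_i$ for $\alpha_i\ne\alpha_s$ and acts as the reflection $s$ on the other almost positive roots. Let $F_{i,j}$ be the number of its faces made of $i$ positive roots and $j$ negative simple roots, and put $$H(x,y)=\sum_{i,j}F_{i,j}\,x^{i+j}y^j(1-x)^{d-i-j}.$$ The $\Gamma$-triangle of $\Phi$ is the polynomial $\Gamma(x,y)=\sum\gamma_{i,j}x^iy^j$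 with integer coefficients, over $i\ge 0$, $0\le j\le d-2i$, determined by $$H(x,y)=\sum_{i,j}\gamma_{i,j}\,x^i(1+xy)^j(1+x)^{d-2i-j}.$$ For $J\subseteq I$ let $C_+(J)$ be the complex of the faces consisting of positive roots with support contained in $J$, and let $h_{C_+(J)}(x)=\sum_k f_{k-1}x^k(1-x)^{|J|-k}$ be its $h$-polynomial, where $f_{k-1}$ is the number of faces with $k$ vertices. The local $\gamma$-vector of $\Phi$ is the sequence of coefficients of the polynomial $\gamma^\ell(x)=\sum_{0\le i\le d/2}\gamma^\ell_ix^i$ with integer coefficients determined by $$\sum_{J\subseteq I}(-1)^{|I\setminus J|}h_{C_+(J)}(x)=\sum_{0\le i\le d/2}\gamma_i^\ell\,x^i(1+x)^{d-2i}.$$ **Proposition (Type D vs Type B).** The $\Gamma$-triangles $\Gamma_{\mathbb{B}_n}$ ($n\ge 0$) and $\Gamma_{\mathbb{D}_n}$ ($n\ge2$) and the local $\gamma$-polynomials $\gamma^\ell_{\mathbb{D}_n}$ ($n\ge 2$) exist, are unique and do not depend on the Coxeter element. For every $n\ge3$, the $\Gamma$-triangle of type $\mathbb{D}_n$ is obtained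 from the $\Gamma$-triangle of type $\mathbb{B}_{n-1}$ by adding a bottom line (the coefficients of $y^0$), which is the local $\gamma$-vector of type $\mathbb{D}_n$: $$\Gamma_{\mathbb{D}_n}(x,y)=y\,\Gamma_{\mathbb{B}_{n-1}}(x,y)+\gamma^\ell_{\mathbb{D}_n}(x).$$ Equivalently, the generating series $G_{\mathbb{B}}=\sum_{n\ge0}\Gamma_{\mathbb{B}_n}(x,y)\,t^n$, $G_{\mathbb{D}}=\sum_{n\ge2}\Gamma_{\mathbb{D}_n}(x,y)\,t^n$ and $g_{\mathbb{D}}=\sum_{n\ge2}\gamma^\ell_{\mathbb{D}_n}(x)\,t^n$ satisfy $$G_{\mathbb{D}}=y\,t\,(G_{\mathbb{B}}-1)+g_{\mathbb{D}}.$$ -/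

import Mathlib

open Polynomial
open scoped Polynomial.Bivariate

namespace GammaTriangle

/-! ## Face numbers of simplicial complexes

A finite simplicial complex is given by the set `K` of its faces (finite sets of vertices, the
empty face included). Two-variable polynomials live in `ℤ[X][Y]`: the inner variable is `x`, the
outer variable is `y`. -/

section Complexes

variable {V ι : Type*}

/-- `faceCount K k` is the number `f_{k-1}` of faces with `k` vertices. -/
noncomputable def faceCount (K : Set (Finset V)) (k : ℕ) : ℕ :=
  {F | F ∈ K ∧ F.card = k}.ncard

/-- The `h`-polynomial `∑ f_{k-1} x ^ k (1 - x) ^ (d - k)` of a complex of dimension `d - 1`. -/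
noncomputable def hPoly (K : Set (Finset V)) (d : ℕ) : ℤ[X] :=
  ∑ k ∈ Finset.range (d + 1), (faceCount K k : ℤ[X]) * X ^ k * (1 - X) ^ (d - k)

/-- The restriction `K(J)` to a subset `J` of `ι` of a simplicial subdivision `(K, σ)` of the
simplex `2 ^ ι`. -/
def restrict (K : Set (Finset V)) (σ : Finset V → Finset ι) (J : Finset ι) : Set (Finset V) :=
  {F | F ∈ K ∧ σ F ⊆ J}

/-- The local `h`-polynomial `∑_J (-1) ^ |ι - J| h_{K(J)}` of a simplicial subdivision `(K, σ)`
of the simplex `2 ^ ι`; here `K(J)` has dimension `|J| - 1`. -/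
noncomputable def localHPoly [Fintype ι] (K : Set (Finset V)) (σ : Finset V → Finset ι) : ℤ[X] :=
  ∑ J : Finset ι, (-1) ^ (Fintype.card ι - J.card) * hPoly (restrict K σ J) J.card

/-- `γ = ∑ γ_i x ^ i`, with `0 ≤ i ≤ d / 2`, is the `γ`-polynomial of `h`:
`h = ∑ γ_i x ^ i (1 + x) ^ (d - 2 i)`. -/
def IsGammaPoly (d : ℕ) (h γ : ℤ[X]) : Prop :=
  (∀ i, d < 2 * i → γ.coeff i = 0) ∧
  h = ∑ i ∈ Finset.range (d / 2 + 1), C (γ.coeff i) * X ^ i * (1 + X) ^ (d - 2 * i)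

/-- `F_{i,j}`: the number of faces made of `i` vertices not in `T` and `j` vertices in `T`. -/
noncomputable def fTriangle (K : Set (Finset V)) (T : Set V) (i j : ℕ) : ℕ :=
  {F | F ∈ K ∧ ((F : Set V) \ T).ncard = i ∧ ((F : Set V) ∩ T).ncard = j}.ncard

/-- The `H`-triangle `(1 - x) ^ d F(x / (1 - x), x y / (1 - x))` of a complex of dimension
`d - 1`, that is, `∑ F_{i,j} x ^ (i + j) y ^ j (1 - x) ^ (d - i - j)` over `i + j = k ≤ d`. -/
noncomputable def hTriangle (K : Set (Finset V)) (T : Set V) (d : ℕ) : ℤ[X][Y] :=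
  ∑ k ∈ Finset.range (d + 1), ∑ j ∈ Finset.range (k + 1),
    (fTriangle K T (k - j) j : ℤ[X][Y]) * C X ^ k * Y ^ j * (1 - C X) ^ (d - k)

/-- `Γ = ∑ γ_{i,j} x ^ i y ^ j`, with `0 ≤ i`, `0 ≤ j ≤ d - 2 i`, is the `Γ`-triangle attached to
the `H`-triangle `H`: `H = ∑ γ_{i,j} x ^ i (1 + x y) ^ j (1 + x) ^ (d - 2 i - j)`. -/
def IsGammaTriangle (d : ℕ) (H Γ : ℤ[X][Y]) : Prop :=
  (∀ i j, d < 2 * i + j → (Γ.coeff j).coeff i = 0) ∧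
  H = ∑ i ∈ Finset.range (d / 2 + 1), ∑ j ∈ Finset.range (d - 2 * i + 1),
    C (C ((Γ.coeff j).coeff i)) * C X ^ i * (1 + C X * Y) ^ j * (1 + C X) ^ (d - 2 * i - j)

end Complexes

/-! ## Cluster complexes

`A` is a Cartan matrix of finite type with `A i j = ⟨α_i, α_j^∨⟩`. Vectors `v : ι → ℤ` are the
elements `∑ v_i α_i` of the root lattice. -/

section Cluster

variable {ι : Type*} [Fintype ι] [DecidableEq ι]

/-- The simple root `α_i`. -/
def simpleRoot (i : ι) : ι → ℤ := Pi.single i 1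

/-- The simple reflection `s_i v = v - ⟨v, α_i^∨⟩ α_i`. -/
def reflection (A : Matrix ι ι ℤ) (i : ι) (v : ι → ℤ) : ι → ℤ :=
  v - (∑ j, v j * A j i) • simpleRoot i

/-- The roots: the images of the simple roots under the Weyl group. -/
inductive IsRoot (A : Matrix ι ι ℤ) : (ι → ℤ) → Prop
  | simple (i : ι) : IsRoot A (simpleRoot i)
  | reflect (i : ι) (v : ι → ℤ) : IsRoot A v → IsRoot A (reflection A i v)

/-- The positive roots: the roots with nonnegative coordinates. -/
def positiveRoots (A : Matrix ι ι ℤ) : Set (ι → ℤ) := {v | IsRoot A v ∧ 0 ≤ v}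

/-- The negative simple roots `-α_i`. -/
def negSimpleRoots (ι : Type*) [DecidableEq ι] : Set (ι → ℤ) := {v | ∃ i : ι, v = -simpleRoot i}

/-- The almost positive roots. -/
def almostPositiveRoots (A : Matrix ι ι ℤ) : Set (ι → ℤ) := positiveRoots A ∪ negSimpleRoots ι

open Classical in
/-- The piecewise linear modification `τ_s` of the simple reflection `s`, an involution of the
almost positive roots: it fixes `-α_i` for `i ≠ s` and is the reflection `s` otherwise. -/
noncomputable def tau (A : Matrix ι ι ℤ) (s : ι) (v : ι → ℤ) : ι → ℤ :=
  if ∃ i, i ≠ s ∧ v = -simpleRoot i then v else reflection A s v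

/-- A word `c = s_1 ⋯ s_n` containing each simple reflection exactly once; it represents a Coxeter
element, and all Coxeter elements are obtained in this way. -/
def IsCoxeterWord (c : List ι) : Prop := c.Nodup ∧ ∀ i, i ∈ c

/-- The `c`-compatibility relation on almost positive roots. It is symmetric, `-α_i` is compatible
with `β` exactly when `α_i` does not occur in `β`, and `β`, `γ` are `c`-compatible exactly when
`τ_s β`, `τ_s γ` are `s c s`-compatible, for `s` the initial letter of `c`. These properties
determine it, because rotating the word finitely many times turns any almost positive root into
the negative of a simple root. -/
inductive Compatible (A : Matrix ι ι ℤ) : List ι → (ι → ℤ) → (ι → ℤ) → Prop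
  | neg_left (c : List ι) (i : ι) (β : ι → ℤ) : β i = 0 → Compatible A c (-simpleRoot i) β
  | neg_right (c : List ι) (i : ι) (β : ι → ℤ) : β i = 0 → Compatible A c β (-simpleRoot i)
  | rotate (s : ι) (c : List ι) (β γ : ι → ℤ) :
      Compatible A (c ++ [s]) (tau A s β) (tau A s γ) → Compatible A (s :: c) β γ

/-- The cluster complex (the simplicial complex of the cluster fan) for the Coxeter element `c`:
the sets of pairwise `c`-compatible almost positive roots. -/
def clusterComplex (A : Matrix ι ι ℤ) (c : List ι) : Set (Finset (ι → ℤ)) :=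
  {F | (F : Set (ι → ℤ)) ⊆ almostPositiveRoots A ∧
    (F : Set (ι → ℤ)).Pairwise (Compatible A c)}

/-- The positive part `C_+` of the cluster complex: the faces made of positive roots. -/
def positivePart (A : Matrix ι ι ℤ) (c : List ι) : Set (Finset (ι → ℤ)) :=
  {F | F ∈ clusterComplex A c ∧ (F : Set (ι → ℤ)) ⊆ positiveRoots A}

/-- The support of a set of roots; this is the structure map `σ` of the subdivision `C_+`. -/
def support (F : Finset (ι → ℤ)) : Finset ι := {i | ∃ v ∈ F, v i ≠ 0}

/-- `Γ` is the `Γ`-triangle of the cluster complex of `A` and `c`, with respect to the facet of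
all negative simple roots. -/
def IsClusterGammaTriangle (A : Matrix ι ι ℤ) (c : List ι) (Γ : ℤ[X][Y]) : Prop :=
  IsGammaTriangle (Fintype.card ι)
    (hTriangle (clusterComplex A c) (negSimpleRoots ι) (Fintype.card ι)) Γ

/-- `g = ∑ γ^ℓ_i x ^ i` is given by the local `γ`-vector of the subdivision of the simplex `2 ^ ι`
formed by the positive part of the cluster complex of `A` and `c`. -/
def IsClusterLocalGamma (A : Matrix ι ι ℤ) (c : List ι) (g : ℤ[X]) : Prop :=
  IsGammaPoly (Fintype.card ι) (localHPoly (positivePart A c) support) g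

end Cluster

end GammaTriangle

/-! The cluster complex is a flag complex, so its face polynomial F(x,u), with weight x on positive
roots and u on negative simple roots, is a clique polynomial. Substituting x → x/(1-x), u → xy/(1-x)
and multiplying by (1-x)^rank gives the H-triangle. Put q = x(1+x), s = 1+x+u, m = 1+2x. Multiplied
by (1-x)², 1-x, 1-x, these become x, 1+xy, 1+x. Hence a Γ-triangle in rank n exists once F is an
integer combination of the q^i s^j m^k with 2i+j+k = n (`gradedPiece`), and a combination without s
gives a γ-polynomial.

The theorem thus reduces to `graded_comparison`: F_{B_n} is graded in this sense, and F_{D_{n+1}} -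
s F_{B_n} is graded without s. The factor s accounts for the multiplication of Γ by y
(`IsGammaTriangle.add_bottom`) and the difference is the bottom line. Setting y = -1/x kills 1+xy
and turns H into the local h-polynomial (`localHPoly_eq`), so the bottom line is the local γ-vector.

For the linear Coxeter word, compatibility is explicit (`Vtx.Rel`). Vertices are deleted one at a
time, in an order for which each link is a join of smaller complexes of the same kinds. The
resulting recursions give `serB_spec` and `serD_spec`: closed forms in x, u and the type A series p,
where z = tp and p(1-xz) = 1+z. Now divide by E = 1+(1+x)z. The series A = p/E satisfies a quadratic
equation with coefficients in m and q alone, hence is graded without s. With w = tA = z/E one has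
1-uz = (1-sw)E, and F_B(1-sw) is rational in w, m, q. Finally A·t(F_D - s(F_B-1)) = F_B(1-sw) + 1 -
2A, whose right side does not involve s.

The link with roots is the Euler form of a Coxeter word: two positive roots are compatible exactly
when the form is nonnegative on them in both orders (`IsFiniteType.compatible_iff`). This criterion
is invariant under rotation of the word, and rotating repeatedly makes any positive root negative,
because a Coxeter element fixes no nonzero vector.

For a forest all Coxeter words are related by rotations and commutations, and these preserve F(x,x).
Sorting faces by their negative simple roots and inducting on the parabolic subset shows that the
positive parts, and then F(x,u), do not depend on the word (`IsFiniteType.posPoly_eq`). -/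

namespace GammaTriangle

/-! ## Clique polynomials -/

section CliquePoly

variable {V W R : Type*} [CommRing R]

open Classical in
/-- The finite sets of pairwise `r`-related elements of `S`. -/
noncomputable def cliques (r : V → V → Prop) (S : Finset V) : Finset (Finset V) :=
  S.powerset.filter fun F => (F : Set V).Pairwise r

theorem mem_cliques {r : V → V → Prop} {S F : Finset V} :
    F ∈ cliques r S ↔ F ⊆ S ∧ (F : Set V).Pairwise r := by
  simp [cliques]

/-- The weighted clique polynomial of the relation `r` on the finite set `S`. -/
noncomputable def cliquePoly (r : V → V → Prop) (w : V → R) (S : Finset V) : R :=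
  ∑ F ∈ cliques r S, ∏ v ∈ F, w v

@[simp] theorem cliquePoly_empty (r : V → V → Prop) (w : V → R) : cliquePoly r w ∅ = 1 := by
  simp [cliquePoly, cliques, Finset.filter_singleton]

theorem cliquePoly_congr {r r' : V → V → Prop} {w w' : V → R} {S : Finset V}
    (hr : ∀ a ∈ S, ∀ b ∈ S, a ≠ b → (r a b ↔ r' a b)) (hw : ∀ a ∈ S, w a = w' a) :
    cliquePoly r w S = cliquePoly r' w' S := by
  have hc : cliques r S = cliques r' S := by
    ext F
    simp only [mem_cliques]
    refine and_congr_right fun hF => ⟨fun h a ha b hb hab => ?_, fun h a ha b hb hab => ?_⟩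
    · exact (hr a (hF ha) b (hF hb) hab).1 (h ha hb hab)
    · exact (hr a (hF ha) b (hF hb) hab).2 (h ha hb hab)
  unfold cliquePoly
  rw [hc]
  refine Finset.sum_congr rfl fun F hF => Finset.prod_congr rfl fun v hv => hw v ?_
  exact (mem_cliques.1 hF).1 hv

-- Deletion and link: a clique either avoids v or consists of v and a clique among the neighbours of
-- v. All counts below iterate this identity.
open Classical in
theorem cliquePoly_insert {r : V → V → Prop} (hr : ∀ a b, r a b → r b a) (w : V → R)
    {S : Finset V} {v : V} (hv : v ∉ S) :
    cliquePoly r w (insert v S) =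
      cliquePoly r w S + w v * cliquePoly r w (S.filter (r v)) := by
  have h1 : cliques r (insert v S) =
      cliques r S ∪ (cliques r (S.filter (r v))).image (insert v) := by
    ext F
    simp only [mem_cliques, Finset.mem_union, Finset.mem_image]
    constructor
    · rintro ⟨hF, hp⟩
      by_cases hvF : v ∈ F
      · right
        refine ⟨F.erase v, ⟨fun u hu => ?_, hp.mono (by simp)⟩, Finset.insert_erase hvF⟩
        obtain ⟨huv, huF⟩ := Finset.mem_erase.1 hu
        exact Finset.mem_filter.2
          ⟨(Finset.mem_insert.1 (hF huF)).resolve_left huv, hp hvF huF (Ne.symm huv)⟩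
      · left
        refine ⟨fun u hu => (Finset.mem_insert.1 (hF hu)).resolve_left ?_, hp⟩
        rintro rfl
        exact hvF hu
    · rintro (⟨hF, hp⟩ | ⟨F', ⟨hF, hp⟩, rfl⟩)
      · exact ⟨hF.trans (Finset.subset_insert _ _), hp⟩
      · refine ⟨Finset.insert_subset_insert _ (hF.trans (Finset.filter_subset _ _)), ?_⟩
        rw [Finset.coe_insert]
        refine hp.insert fun b hb _ => ?_
        have := (Finset.mem_filter.1 (hF hb)).2
        exact ⟨this, hr _ _ this⟩
  have hnot : ∀ F ∈ cliques r (S.filter (r v)), v ∉ F := fun F hF hvF =>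
    hv (Finset.mem_filter.1 ((mem_cliques.1 hF).1 hvF)).1
  unfold cliquePoly
  rw [h1, Finset.sum_union, Finset.sum_image, Finset.mul_sum]
  · congr 1
    exact Finset.sum_congr rfl fun F hF => Finset.prod_insert (hnot F hF)
  · intro F hF F' hF' h
    rw [← Finset.erase_insert (hnot F hF), ← Finset.erase_insert (hnot F' hF')]
    exact congrArg (fun T => T.erase v) h
  · rw [Finset.disjoint_left]
    intro F hF hF'
    obtain ⟨F'', -, rfl⟩ := Finset.mem_image.1 hF'
    exact hv ((mem_cliques.1 hF).1 (Finset.mem_insert_self _ _))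

-- The complex is a join. Strong induction on T is needed because the link of a vertex of T meets T
-- in an arbitrary smaller subset.
open Classical in
theorem cliquePoly_union {r : V → V → Prop} (hr : ∀ a b, r a b → r b a) (w : V → R)
    {S : Finset V} (T : Finset V) (h : ∀ a ∈ S, ∀ b ∈ T, a ≠ b ∧ r a b) :
    cliquePoly r w (S ∪ T) = cliquePoly r w S * cliquePoly r w T := by
  induction T using Finset.strongInduction with
  | H T ih =>
    rcases T.eq_empty_or_nonempty with rfl | ⟨v, hv⟩
    · simp
    · have hT : T = insert v (T.erase v) := (Finset.insert_erase hv).symm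
      have hvS : v ∉ S ∪ T.erase v := by
        simp only [Finset.mem_union, Finset.mem_erase, not_or]
        exact ⟨fun hvS => (h v hvS v hv).1 rfl, fun hh => hh.1 rfl⟩
      have hf : (S ∪ T.erase v).filter (r v) = S ∪ (T.erase v).filter (r v) := by
        rw [Finset.filter_union]
        congr 1
        exact Finset.filter_true_of_mem fun a ha => hr _ _ (h a ha v hv).2
      have hlt : T.erase v ⊂ T := Finset.erase_ssubset hv
      have hlt' : (T.erase v).filter (r v) ⊂ T :=
        lt_of_le_of_lt (Finset.filter_subset _ _) hlt
      rw [hT, Finset.union_insert, cliquePoly_insert hr w hvS,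
        cliquePoly_insert hr w (Finset.notMem_erase v T), hf,
        ih _ hlt fun a ha b hb => h a ha b (hlt.1 hb),
        ih _ hlt' fun a ha b hb => h a ha b (hlt'.1 hb)]
      ring

open Classical in
theorem cliquePoly_image {r : V → V → Prop} {r' : W → W → Prop} {w : V → R} {w' : W → R}
    {S : Finset V} {f : V → W} (hf : Set.InjOn f S)
    (hr : ∀ a ∈ S, ∀ b ∈ S, a ≠ b → (r a b ↔ r' (f a) (f b))) (hw : ∀ a ∈ S, w a = w' (f a)) :
    cliquePoly r w S = cliquePoly r' w' (S.image f) := by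
  have hc : cliques r' (S.image f) = (cliques r S).image (Finset.image f) := by
    ext F
    simp only [mem_cliques, Finset.mem_image]
    constructor
    · rintro ⟨hF, hp⟩
      obtain ⟨G, hG, rfl⟩ := Finset.subset_image_iff.1 hF
      refine ⟨G, ⟨by exact_mod_cast hG, fun a ha b hb hab => ?_⟩, rfl⟩
      have haS := hG ha
      have hbS := hG hb
      exact (hr a haS b hbS hab).2 (hp (by simpa using ⟨a, ha, rfl⟩) (by simpa using ⟨b, hb, rfl⟩)
        fun e => hab (hf haS hbS e))
    · rintro ⟨G, ⟨hG, hp⟩, rfl⟩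
      refine ⟨Finset.image_subset_image hG, ?_⟩
      rintro _ ha _ hb hab
      simp only [Finset.coe_image] at ha hb
      obtain ⟨a, ha, rfl⟩ := ha
      obtain ⟨b, hb, rfl⟩ := hb
      have hab' : a ≠ b := fun e => hab (congrArg f e)
      exact (hr a (hG ha) b (hG hb) hab').1 (hp ha hb hab')
  unfold cliquePoly
  rw [hc, Finset.sum_image]
  · refine Finset.sum_congr rfl fun F hF => ?_
    have hFS := (mem_cliques.1 hF).1
    rw [Finset.prod_image fun a ha b hb e => hf (hFS ha) (hFS hb) e]
    exact Finset.prod_congr rfl fun a ha => hw a (hFS ha)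
  · intro F hF G hG e
    have hF' := (mem_cliques.1 hF).1
    have hG' := (mem_cliques.1 hG).1
    have key : ∀ F G : Finset V, F ⊆ S → G ⊆ S → F.image f = G.image f → F ⊆ G := by
      intro F G hF hG e a ha
      have : f a ∈ G.image f := e ▸ Finset.mem_image_of_mem f ha
      obtain ⟨b, hb, hba⟩ := Finset.mem_image.1 this
      rwa [← hf (hG hb) (hF ha) hba]
    exact Finset.Subset.antisymm (key F G hF' hG' e) (key G F hG' hF' e.symm)

open Classical in
/-- Splitting off a clique `N`. -/
theorem cliquePoly_union_clique {r : V → V → Prop} (hr : ∀ a b, r a b → r b a) (w : V → R)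
    (P N : Finset V) (hN : (N : Set V).Pairwise r) (hd : Disjoint P N) :
    cliquePoly r w (P ∪ N) =
      ∑ T ∈ N.powerset, (∏ t ∈ T, w t) * cliquePoly r w (P.filter fun v => ∀ t ∈ T, r t v) := by
  induction N using Finset.induction_on generalizing P with
  | empty => simp
  | insert v N hv ih =>
    have hN' : (N : Set V).Pairwise r := hN.mono (by simp)
    have hvP : v ∉ P := fun h => Finset.disjoint_left.1 hd h (Finset.mem_insert_self _ _)
    have hd' : Disjoint P N := hd.mono_right (Finset.subset_insert _ _)
    have hf : (P ∪ N).filter (r v) = P.filter (r v) ∪ N := by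
      rw [Finset.filter_union]
      congr 1
      refine Finset.filter_true_of_mem fun a ha => hN (by simp) (by simp [ha]) ?_
      rintro rfl
      exact hv ha
    rw [Finset.union_insert, cliquePoly_insert hr w (by simp [hv, hvP]), hf, ih P hN' hd',
      ih (P.filter (r v)) hN' (hd'.mono_left (Finset.filter_subset _ _)),
      Finset.sum_powerset_insert hv, Finset.mul_sum]
    congr 1
    refine Finset.sum_congr rfl fun T hT => ?_
    have hvT : v ∉ T := fun h => hv (Finset.mem_powerset.1 hT h)
    rw [Finset.prod_insert hvT, Finset.filter_filter, mul_assoc]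
    simp

end CliquePoly

end GammaTriangle

namespace GammaTriangle

/-! ## A combinatorial model of the almost positive roots

In terms of an orthonormal basis `e_i`, `minus a b` is `e_a - e_b`, `plus k l` is `e_k + e_l` and
`single i ε` is `e_i` in type `B`, and `e_i ± e_n` in type `D`. The negative simple roots are
`neg i` and, for the two short legs of the diagram of type `D`, `leg ε`. -/

inductive Vtx
  | neg (i : ℕ)
  | leg (e : Bool)
  | minus (a b : ℕ)
  | plus (k l : ℕ)
  | single (i : ℕ) (e : Bool)

namespace Vtx

/-- One half of the incompatibility relation; `t` is true in type `B`, false in type `D`. -/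
def Bad (t : Bool) : Vtx → Vtx → Prop
  | minus a b, minus c d => a < c ∧ c ≤ b ∧ b < d
  | minus a b, plus k l => (a < k ∧ k ≤ b) ∨ (a < l ∧ l ≤ b)
  | minus a b, single i _ => a < i ∧ i ≤ b
  | plus k l, plus k' l' => ¬((k ≤ k' ∧ l' ≤ l) ∨ (k' ≤ k ∧ l ≤ l'))
  | plus k l, single i _ => ¬(k ≤ i ∧ i ≤ l)
  -- In type B the sign is a dummy, set to `true` by the regions, and two short roots exclude each
  -- other. In type D equal signs are compatible, and so are equal positions.
  | single i e, single j e' => t = true ∨ (i ≠ j ∧ e ≠ e')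
  | neg i, minus a b => a ≤ i ∧ i < b
  | neg i, plus k _ => k ≤ i
  | neg i, single j _ => j ≤ i
  | leg _, plus _ _ => True
  | leg e, single _ e' => e = e'
  | _, _ => False

/-- The compatibility relation of the model. -/
def Rel (t : Bool) (v w : Vtx) : Prop := ¬Bad t v w ∧ ¬Bad t w v

theorem Rel.symm {t : Bool} (v w : Vtx) (h : Rel t v w) : Rel t w v := ⟨h.2, h.1⟩

/-- Vertices all of whose parameters are less than `N`. -/
def Bdd (N : ℕ) : Vtx → Prop
  | neg i => i < N
  | leg _ => True
  | minus a b => a < N ∧ b < N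
  | plus k l => k < N ∧ l < N
  | single i _ => i < N

/-- Sets of vertices, given by a predicate for each of the five kinds. -/
def Region (ng : ℕ → Prop) (lg : Bool → Prop) (mi pl : ℕ → ℕ → Prop) (sg : ℕ → Bool → Prop) :
    Vtx → Prop
  | neg i => ng i
  | leg e => lg e
  | minus a b => mi a b
  | plus k l => pl k l
  | single i e => sg i e

theorem finite_bdd (N : ℕ) : {v | Bdd N v}.Finite := by
  have hN : (Set.Iio N).Finite := Set.finite_Iio N
  have : {v | Bdd N v} ⊆ neg '' Set.Iio N ∪ Set.range leg ∪
      (fun p : ℕ × ℕ => minus p.1 p.2) '' (Set.Iio N ×ˢ Set.Iio N) ∪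
      (fun p : ℕ × ℕ => plus p.1 p.2) '' (Set.Iio N ×ˢ Set.Iio N) ∪
      (fun p : ℕ × Bool => single p.1 p.2) '' (Set.Iio N ×ˢ Set.univ) := by
    rintro (i | e | ⟨a, b⟩ | ⟨a, b⟩ | ⟨i, e⟩) h <;> simp_all [Bdd]
  refine Set.Finite.subset ?_ this
  exact ((((hN.image _).union (Set.finite_range _)).union ((hN.prod hN).image _)).union
    ((hN.prod hN).image _)).union ((hN.prod Set.finite_univ).image _)

variable {R : Type*} [CommRing R]

/-- The weight `u` for negative simple roots and `x` for positive roots. -/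
def weight (x u : R) : Vtx → R
  | neg _ => u
  | leg _ => u
  | _ => x

open Classical in
/-- The finite set of the vertices below `N` that satisfy `P`. -/
noncomputable def vertices (N : ℕ) (P : Vtx → Prop) : Finset Vtx :=
  (finite_bdd N).toFinset.filter P

theorem mem_vertices {N : ℕ} {P : Vtx → Prop} {v : Vtx} : v ∈ vertices N P ↔ Bdd N v ∧ P v := by
  simp [vertices]

/-- The clique polynomial of the vertices below `N` that satisfy `P`. -/
noncomputable def cl (t : Bool) (x u : R) (N : ℕ) (P : Vtx → Prop) : R :=
  cliquePoly (Rel t) (weight x u) (vertices N P)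

variable {t : Bool} {x u : R} {N : ℕ}

theorem cl_congr {P Q : Vtx → Prop} (h : ∀ v, Bdd N v → (P v ↔ Q v)) :
    cl t x u N P = cl t x u N Q := by
  have : vertices N P = vertices N Q := by
    ext v
    simp only [mem_vertices]
    exact and_congr_right (h v)
  rw [cl, this, cl]

theorem cl_eq_one {P : Vtx → Prop} (h : ∀ v, ¬P v) : cl t x u N P = 1 := by
  have : vertices N P = ∅ := by
    ext v
    simp [mem_vertices, h v]
  rw [cl, this, cliquePoly_empty]

/-- The working form of deletion and link: P₁ is the deletion and P₂ the link. As both are given by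
inequalities on the parameters, the hypotheses reduce to linear arithmetic. -/
theorem cl_delete {P P₁ P₂ : Vtx → Prop} (v : Vtx) (hb : Bdd N v) (hv : P v)
    (h₁ : ∀ w, Bdd N w → (P₁ w ↔ P w ∧ w ≠ v))
    (h₂ : ∀ w, Bdd N w → (P₂ w ↔ P w ∧ w ≠ v ∧ Rel t v w)) :
    cl t x u N P = cl t x u N P₁ + weight x u v * cl t x u N P₂ := by
  classical
  have e : vertices N P = insert v (vertices N P₁) := by
    ext w
    simp only [mem_vertices, Finset.mem_insert]
    by_cases hw : w = v
    · subst hw; simp [hb, hv]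
    · simp only [hw, false_or]
      exact and_congr_right fun h => by simp [h₁ w h, hw]
  have e' : (vertices N P₁).filter (Rel t v) = vertices N P₂ := by
    ext w
    simp only [Finset.mem_filter, mem_vertices, and_assoc]
    exact and_congr_right fun h => by simp only [h₁ w h, h₂ w h, and_assoc]
  have hn : v ∉ vertices N P₁ := by simp [mem_vertices, hb, h₁ v hb]
  simp only [cl]
  rw [e, cliquePoly_insert Rel.symm _ hn, e']

theorem cl_mul {P P₁ P₂ : Vtx → Prop} (h : ∀ w, Bdd N w → (P w ↔ P₁ w ∨ P₂ w))
    (hr : ∀ v w, P₁ v → P₂ w → v ≠ w ∧ Rel t v w) :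
    cl t x u N P = cl t x u N P₁ * cl t x u N P₂ := by
  classical
  have e : vertices N P = vertices N P₁ ∪ vertices N P₂ := by
    ext w
    simp only [mem_vertices, Finset.mem_union, ← and_or_left]
    exact and_congr_right (h w)
  simp only [cl]
  rw [e, cliquePoly_union Rel.symm]
  exact fun a ha b hb => hr a b (mem_vertices.1 ha).2 (mem_vertices.1 hb).2

/-! ### Type `A` -/

/-- The positive roots of type `A` on the positions `lo, …, hi - 1`. -/
def chain (lo hi : ℕ) : Vtx → Prop :=
  Region (fun _ => False) (fun _ => False) (fun a b => lo ≤ a ∧ a < b ∧ b < hi)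
    (fun _ _ => False) (fun _ _ => False)

/-- The part of `chain lo hi` with `b < m` whenever `a = lo`. -/
def chainCut (lo hi m : ℕ) : Vtx → Prop :=
  Region (fun _ => False) (fun _ => False)
    (fun a b => lo ≤ a ∧ a < b ∧ b < hi ∧ (a = lo → b < m))
    (fun _ _ => False) (fun _ _ => False)

/-- Deletion of e_lo - e_m. The remaining roots compatible with it live either on lo, …, m or
entirely to the right of m, so the link is a join. -/
theorem cl_chainCut_succ {lo hi m : ℕ} (h₁ : lo < m) (h₂ : m < hi) (h₃ : hi ≤ N) :
    cl t x u N (chainCut lo hi (m + 1)) = cl t x u N (chainCut lo hi m) +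
      x * (cl t x u N (chainCut lo (m + 1) m) * cl t x u N (chain (m + 1) hi)) := by
  rw [← cl_mul (P := Region (fun _ => False) (fun _ => False)
    (fun a b => (lo ≤ a ∧ a < b ∧ b < m + 1 ∧ (a = lo → b < m)) ∨ (m + 1 ≤ a ∧ a < b ∧ b < hi))
    (fun _ _ => False) (fun _ _ => False)),
    cl_delete (v := minus lo m) (P₁ := chainCut lo hi m)]
  · rfl
  · simp only [Bdd]; omega
  · simp only [chainCut, Region]; omega
  · rintro (i | e | ⟨a, b⟩ | ⟨a, b⟩ | ⟨i, e⟩) hb <;>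
      simp [chainCut, Region, Bdd] at hb ⊢ <;> omega
  · rintro (i | e | ⟨a, b⟩ | ⟨a, b⟩ | ⟨i, e⟩) hb <;>
      simp [chainCut, Region, Bdd, Rel, Bad] at hb ⊢ <;> omega
  · rintro (i | e | ⟨a, b⟩ | ⟨a, b⟩ | ⟨i, e⟩) hb <;>
      simp [chainCut, chain, Region, Bdd] at hb ⊢
  · rintro (i | e | ⟨a, b⟩ | ⟨a, b⟩ | ⟨i, e⟩) (i | e | ⟨c, d⟩ | ⟨c, d⟩ | ⟨j, e'⟩) <;>
      simp [chainCut, chain, Region, Rel, Bad] <;> omega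

end Vtx
end GammaTriangle

namespace GammaTriangle
namespace Vtx

variable {R : Type*} [CommRing R] {t : Bool} {x u : R} {N : ℕ}

theorem cl_chain_of_le {lo hi : ℕ} (h : hi ≤ lo + 1) : cl t x u N (chain lo hi) = 1 := by
  refine cl_eq_one ?_
  rintro (i | e | ⟨a, b⟩ | ⟨a, b⟩ | ⟨i, e⟩) <;> simp [chain, Region] <;> omega

theorem cl_chainCut_self {lo hi : ℕ} :
    cl t x u N (chainCut lo hi (lo + 1)) = cl t x u N (chain (lo + 1) hi) := by
  refine cl_congr ?_
  rintro (i | e | ⟨a, b⟩ | ⟨a, b⟩ | ⟨i, e⟩) _ <;> simp [chain, chainCut, Region] <;> omega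

theorem cl_chainCut_top {lo hi : ℕ} :
    cl t x u N (chainCut lo hi hi) = cl t x u N (chain lo hi) := by
  refine cl_congr ?_
  rintro (i | e | ⟨a, b⟩ | ⟨a, b⟩ | ⟨i, e⟩) _ <;> simp [chain, chainCut, Region]
  omega

theorem cl_chainCut_eq_sum {lo hi m : ℕ} (h₁ : lo < m) (h₂ : m ≤ hi) (h₃ : hi ≤ N) :
    cl t x u N (chainCut lo hi m) = cl t x u N (chain (lo + 1) hi) +
      x * ∑ k ∈ Finset.Ico (lo + 1) m,
        cl t x u N (chainCut lo (k + 1) k) * cl t x u N (chain (k + 1) hi) := by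
  induction m, h₁ using Nat.le_induction with
  | base => simp [cl_chainCut_self]
  | succ m hm ih =>
    rw [cl_chainCut_succ hm (by omega) h₃, ih (by omega), Finset.sum_Ico_succ_top hm]
    ring

/-- The highest root is compatible with every positive root of the linear word, so the complex is a
cone. -/
theorem cl_chain_succ {lo m : ℕ} (h₁ : lo < m) (h₃ : m + 1 ≤ N) :
    cl t x u N (chain lo (m + 1)) = (1 + x) * cl t x u N (chainCut lo (m + 1) m) := by
  rw [← cl_chainCut_top, cl_chainCut_succ h₁ (by omega) h₃, cl_chain_of_le (by omega)]
  ring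

/-- The clique polynomial of the positive roots of type `A` on `n` positions. -/
noncomputable def chainSeq (x : R) (n : ℕ) : R := cl true x 0 n (chain 0 n)

/-- The clique polynomial of the positive roots of type `A` on `n + 1` positions, the highest root
left out. -/
noncomputable def cutSeq (x : R) (n : ℕ) : R := cl true x 0 (n + 1) (chainCut 0 (n + 1) n)

/-- The cone identity and the deletion sum refer only to lengths of intervals. A simultaneous
induction therefore gives translation invariance and independence of t, u and N. -/
theorem cl_chain_aux (x : R) (j : ℕ) : ∀ (t : Bool) (u : R) (lo N : ℕ),
    (lo + j ≤ N → cl t x u N (chain lo (lo + j)) = chainSeq x j) ∧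
    (1 ≤ j → lo + j + 1 ≤ N →
      cl t x u N (chainCut lo (lo + j + 1) (lo + j)) = cutSeq x j) := by
  induction j using Nat.strong_induction_on with
  | _ j ih =>
    have hA : ∀ (t : Bool) (u : R) (lo N : ℕ), lo + j ≤ N →
        cl t x u N (chain lo (lo + j)) = if j ≤ 1 then 1 else (1 + x) * cutSeq x (j - 1) := by
      intro t u lo N h
      split_ifs with hj
      · exact cl_chain_of_le (by omega)
      · obtain ⟨i, rfl⟩ : ∃ i, j = i + 1 := ⟨j - 1, by omega⟩
        rw [← add_assoc, cl_chain_succ (by omega) (by omega),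
          (ih i (by omega) t u lo N).2 (by omega) (by omega)]
        simp
    have hA' : ∀ (t : Bool) (u : R) (lo N : ℕ), lo + j ≤ N →
        cl t x u N (chain lo (lo + j)) = chainSeq x j := by
      intro t u lo N h
      have := hA true 0 0 j (by omega)
      rw [zero_add] at this
      rw [hA t u lo N h, chainSeq, this]
    have hU : ∀ (t : Bool) (u : R) (lo N : ℕ), 1 ≤ j → lo + j + 1 ≤ N →
        cl t x u N (chainCut lo (lo + j + 1) (lo + j)) =
          chainSeq x j + x * ∑ k ∈ Finset.Ico 1 j, cutSeq x k * chainSeq x (j - k) := by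
      intro t u lo N h₁ h₂
      rw [cl_chainCut_eq_sum (by omega) (by omega) (by omega)]
      congr 1
      · rw [← hA' t u (lo + 1) N (by omega)]
        congr 2
        omega
      · congr 1
        rw [Finset.sum_Ico_eq_sum_range, Finset.sum_Ico_eq_sum_range]
        refine Finset.sum_congr (by congr 1; omega) fun k hk => ?_
        have hk' := Finset.mem_range.1 hk
        rw [← (ih (1 + k) (by omega) t u lo N).2 (by omega) (by omega),
          ← (ih (j - (1 + k)) (by omega) t u (lo + 1 + k + 1) N).1 (by omega)]
        congr 3 <;> omega
    intro t u lo N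
    refine ⟨hA' t u lo N, fun h₁ h₂ => ?_⟩
    have := hU true 0 0 (j + 1) h₁ (by omega)
    rw [zero_add] at this
    rw [hU t u lo N h₁ h₂, cutSeq, this]

theorem cl_chain {lo hi : ℕ} (h : hi ≤ N) :
    cl t x u N (chain lo hi) = chainSeq x (hi - lo) := by
  rcases le_total lo hi with h' | h'
  · rw [← (cl_chain_aux x (hi - lo) t u lo N).1 (by omega)]
    congr 2
    omega
  · rw [cl_chain_of_le (by omega), chainSeq, cl_chain_of_le (by omega)]

theorem cl_chainCut {lo m : ℕ} (h₁ : lo < m) (h : m + 1 ≤ N) :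
    cl t x u N (chainCut lo (m + 1) m) = cutSeq x (m - lo) := by
  rw [← (cl_chain_aux x (m - lo) t u lo N).2 (by omega) (by omega)]
  congr 2 <;> omega

@[simp] theorem chainSeq_zero (x : R) : chainSeq x 0 = 1 := cl_chain_of_le (by omega)

@[simp] theorem chainSeq_one (x : R) : chainSeq x 1 = 1 := cl_chain_of_le (by omega)

theorem chainSeq_succ (x : R) {n : ℕ} (hn : 1 ≤ n) :
    chainSeq x (n + 1) = (1 + x) * cutSeq x n := by
  rw [chainSeq, cl_chain_succ (by omega) le_rfl, cl_chainCut (by omega) le_rfl, Nat.sub_zero]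

theorem cutSeq_eq (x : R) {n : ℕ} (hn : 1 ≤ n) :
    cutSeq x n = chainSeq x n + x * ∑ k ∈ Finset.Ico 1 n, cutSeq x k * chainSeq x (n - k) := by
  have := cl_chainCut_eq_sum (t := true) (x := x) (u := 0) (lo := 0) (hi := n + 1) (m := n)
    (by omega) (by omega) (le_refl (n + 1))
  rw [cutSeq, this, cl_chain le_rfl]
  congr 1
  congr 1
  refine Finset.sum_congr rfl fun k hk => ?_
  obtain ⟨h₁, h₂⟩ := Finset.mem_Ico.1 hk
  rw [cl_chainCut (by omega) (by omega), cl_chain le_rfl]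
  congr 2
  omega

/-! ### Sets without `plus` vertices -/

/-- Type `A` on the positions `lo, …, M - 1`, with the vertices `single i e` for `lo ≤ i < P`. -/
def comb (lo M P : ℕ) (e : Bool) : Vtx → Prop :=
  Region (fun _ => False) (fun _ => False) (fun a b => lo ≤ a ∧ a < b ∧ b < M)
    (fun _ _ => False) (fun i e' => lo ≤ i ∧ i < P ∧ e' = e)

theorem cl_comb_self {lo M : ℕ} {e : Bool} :
    cl t x u N (comb lo M lo e) = cl t x u N (chain lo M) := by
  refine cl_congr ?_
  rintro (i | e | ⟨a, b⟩ | ⟨a, b⟩ | ⟨i, e⟩) _ <;> simp [chain, comb, Region]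
  omega

/-- Singles of one sign are mutually compatible in type D, so the link keeps the singles to the left
of i. -/
theorem cl_comb_succ_D {lo M i : ℕ} {e : Bool} (h₁ : lo ≤ i) (h₂ : i ≤ M) (h₃ : i < N) :
    cl false x u N (comb lo M (i + 1) e) = cl false x u N (comb lo M i e) +
      x * (cl false x u N (comb lo i i e) * cl false x u N (chain i M)) := by
  rw [← cl_mul (P := Region (fun _ => False) (fun _ => False)
    (fun a b => (lo ≤ a ∧ a < b ∧ b < i) ∨ (i ≤ a ∧ a < b ∧ b < M))
    (fun _ _ => False) (fun j e' => lo ≤ j ∧ j < i ∧ e' = e)),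
    cl_delete (v := single i e) (P₁ := comb lo M i e)]
  · rfl
  · simpa only [Bdd]
  · simpa [comb, Region]
  · rintro (_ | _ | ⟨a, b⟩ | ⟨a, b⟩ | ⟨j, e'⟩) _ <;> simp [comb, Region]; grind
  · rintro (_ | _ | ⟨a, b⟩ | ⟨a, b⟩ | ⟨j, e'⟩) _ <;> simp [comb, Region, Rel, Bad] <;> grind
  · rintro (_ | _ | ⟨a, b⟩ | ⟨a, b⟩ | ⟨j, e'⟩) _ <;> simp [comb, chain, Region]
  · rintro (_ | _ | ⟨a, b⟩ | ⟨a, b⟩ | ⟨j, e'⟩) (_ | _ | ⟨c, d⟩ | ⟨c, d⟩ | ⟨j', e''⟩) <;>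
      simp [comb, chain, Region, Rel, Bad] <;> omega

/-- In type B no second single survives in the link, which is a join of two type A pieces. -/
theorem cl_comb_succ_B {lo M i : ℕ} {e : Bool} (h₁ : lo ≤ i) (h₂ : i ≤ M) (h₃ : i < N) :
    cl true x u N (comb lo M (i + 1) e) = cl true x u N (comb lo M i e) +
      x * (cl true x u N (chain lo i) * cl true x u N (chain i M)) := by
  rw [← cl_mul (P := Region (fun _ => False) (fun _ => False)
    (fun a b => (lo ≤ a ∧ a < b ∧ b < i) ∨ (i ≤ a ∧ a < b ∧ b < M))
    (fun _ _ => False) (fun _ _ => False)),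
    cl_delete (v := single i e) (P₁ := comb lo M i e)]
  · rfl
  · simpa only [Bdd]
  · simpa [comb, Region]
  · rintro (_ | _ | ⟨a, b⟩ | ⟨a, b⟩ | ⟨j, e'⟩) _ <;> simp [comb, Region]; grind
  · rintro (_ | _ | ⟨a, b⟩ | ⟨a, b⟩ | ⟨j, e'⟩) _ <;> simp [comb, Region, Rel, Bad] <;> grind
  · rintro (_ | _ | ⟨a, b⟩ | ⟨a, b⟩ | ⟨j, e'⟩) _ <;> simp [chain, Region]
  · rintro (_ | _ | ⟨a, b⟩ | ⟨a, b⟩ | ⟨j, e'⟩) (_ | _ | ⟨c, d⟩ | ⟨c, d⟩ | ⟨j', e''⟩) <;>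
      simp [chain, Region, Rel, Bad] <;> omega

theorem cl_comb_B {lo M P : ℕ} {e : Bool} (h₁ : lo ≤ P) (h₂ : P ≤ M + 1) (h₃ : P ≤ N)
    (h₄ : M ≤ N) :
    cl true x u N (comb lo M P e) = chainSeq x (M - lo) +
      x * ∑ i ∈ Finset.Ico lo P, chainSeq x (i - lo) * chainSeq x (M - i) := by
  induction P, h₁ using Nat.le_induction with
  | base => simp [cl_comb_self, cl_chain h₄]
  | succ i hi ih =>
    rw [cl_comb_succ_B hi (by omega) (by omega), ih (by omega) (by omega),
      Finset.sum_Ico_succ_top hi, cl_chain h₄, cl_chain (by omega)]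
    ring

/-- The positive roots of type `D` without the `plus` vertices; the vertices `single i true` are
restricted to `i < P`, the vertices `single i false` to `i < P'`. -/
def doubleComb (lo M P P' : ℕ) : Vtx → Prop :=
  Region (fun _ => False) (fun _ => False) (fun a b => lo ≤ a ∧ a < b ∧ b < M)
    (fun _ _ => False) (fun i e => lo ≤ i ∧ (e = true → i < P) ∧ (e = false → i < P'))

theorem cl_doubleComb_self {lo M P : ℕ} :
    cl t x u N (doubleComb lo M P lo) = cl t x u N (comb lo M P true) := by
  refine cl_congr ?_
  rintro (i | e | ⟨a, b⟩ | ⟨a, b⟩ | ⟨i, e⟩) _ <;> simp [doubleComb, comb, Region]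
  grind

/-- The link of `single i false` contains a single vertex of the other sign, `single i true`, which
is present because i < P. -/
theorem cl_doubleComb_succ {lo M P i : ℕ} (h₁ : lo ≤ i) (h₂ : i ≤ M) (h₃ : i < N) (h₄ : i < P) :
    cl false x u N (doubleComb lo M P (i + 1)) = cl false x u N (doubleComb lo M P i) +
      x * (cl false x u N (comb lo i i false) * cl false x u N (chain i M) +
        x * (cl false x u N (chain lo i) * cl false x u N (chain i M))) := by
  rw [← cl_mul (P := Region (fun _ => False) (fun _ => False)
    (fun a b => (lo ≤ a ∧ a < b ∧ b < i) ∨ (i ≤ a ∧ a < b ∧ b < M))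
    (fun _ _ => False) (fun j e' => lo ≤ j ∧ j < i ∧ e' = false)),
    ← cl_mul (P := Region (fun _ => False) (fun _ => False)
    (fun a b => (lo ≤ a ∧ a < b ∧ b < i) ∨ (i ≤ a ∧ a < b ∧ b < M))
    (fun _ _ => False) (fun _ _ => False)),
    cl_delete (v := single i false) (P₁ := doubleComb lo M P i)
      (P₂ := Region (fun _ => False) (fun _ => False)
      (fun a b => (lo ≤ a ∧ a < b ∧ b < i) ∨ (i ≤ a ∧ a < b ∧ b < M))
      (fun _ _ => False) (fun j e' => lo ≤ j ∧ ((j < i ∧ e' = false) ∨ (j = i ∧ e' = true))))]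
  -- Second deletion, of `single i true` inside the link: every other remaining single has the
  -- opposite sign and another position, so none survives.
  · congr 2
    refine cl_delete (v := single i true) ?_ ?_ ?_ ?_
    · simpa only [Bdd]
    · simpa [Region]
    · rintro (_ | _ | ⟨a, b⟩ | ⟨a, b⟩ | ⟨j, e'⟩) _ <;> simp [Region]; grind
    · rintro (_ | _ | ⟨a, b⟩ | ⟨a, b⟩ | ⟨j, e'⟩) _ <;> simp [Region, Rel, Bad] <;> grind
  · simpa only [Bdd]
  · simpa [doubleComb, Region]
  · rintro (_ | _ | ⟨a, b⟩ | ⟨a, b⟩ | ⟨j, e'⟩) _ <;> simp [doubleComb, Region]; grind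
  · rintro (_ | _ | ⟨a, b⟩ | ⟨a, b⟩ | ⟨j, e'⟩) _ <;> simp [doubleComb, Region, Rel, Bad] <;> grind
  · rintro (_ | _ | ⟨a, b⟩ | ⟨a, b⟩ | ⟨j, e'⟩) _ <;> simp [chain, Region]
  · rintro (_ | _ | ⟨a, b⟩ | ⟨a, b⟩ | ⟨j, e'⟩) (_ | _ | ⟨c, d⟩ | ⟨c, d⟩ | ⟨j', e''⟩) <;>
      simp [chain, Region, Rel, Bad] <;> omega
  · rintro (_ | _ | ⟨a, b⟩ | ⟨a, b⟩ | ⟨j, e'⟩) _ <;> simp [comb, chain, Region]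
  · rintro (_ | _ | ⟨a, b⟩ | ⟨a, b⟩ | ⟨j, e'⟩) (_ | _ | ⟨c, d⟩ | ⟨c, d⟩ | ⟨j', e''⟩) <;>
      simp [comb, chain, Region, Rel, Bad] <;> omega

end Vtx
end GammaTriangle

namespace GammaTriangle
namespace Vtx

variable {R : Type*} [CommRing R] {t : Bool} {x u : R} {N : ℕ}

/-! ### Sets with `plus` vertices -/

/-- The positive roots on the positions `lo, …, P - 1`, where only those `minus a b` with `b < M`
and those `plus k' l'` with `(k', -l')` lexicographically after `(k, -l)` are kept. -/
def cut (t : Bool) (lo M P k l : ℕ) : Vtx → Prop :=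
  Region (fun _ => False) (fun _ => False) (fun a b => lo ≤ a ∧ a < b ∧ b < M)
    (fun k' l' => k' < l' ∧ l' < P ∧ (k < k' ∨ k' = k ∧ l' < l))
    (fun i e => lo ≤ i ∧ i < P ∧ (t = true → e = true))

/-- The positive roots on the positions `k, …, l` that are compatible with `plus k l`. -/
def core (t : Bool) (k l : ℕ) : Vtx → Prop := cut t k l (l + 1) k l

/-- Compatible `plus` vertices are nested intervals, and those containing [k, l] are already
deleted. The link of `plus k l` thus has its `plus` and `single` vertices inside [k, l], while its
`minus` vertices split at k and at l. -/
theorem cl_cut_succ {lo M P k l : ℕ} (h₁ : lo ≤ k) (h₂ : k < l) (h₃ : l < P) (h₄ : l ≤ M)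
    (h₅ : P ≤ N) :
    cl t x u N (cut t lo M P k (l + 1)) = cl t x u N (cut t lo M P k l) +
      x * (cl t x u N (chain lo k) * (cl t x u N (core t k l) * cl t x u N (chain l M))) := by
  rw [← cl_mul (P := Region (fun _ => False) (fun _ => False)
    (fun a b => (k ≤ a ∧ a < b ∧ b < l) ∨ (l ≤ a ∧ a < b ∧ b < M))
    (fun k' l' => k' < l' ∧ l' < l + 1 ∧ (k < k' ∨ k' = k ∧ l' < l))
    (fun i e => k ≤ i ∧ i < l + 1 ∧ (t = true → e = true))),
    ← cl_mul (P := Region (fun _ => False) (fun _ => False)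
    (fun a b => (lo ≤ a ∧ a < b ∧ b < k) ∨ (k ≤ a ∧ a < b ∧ b < l) ∨ (l ≤ a ∧ a < b ∧ b < M))
    (fun k' l' => k' < l' ∧ l' < l + 1 ∧ (k < k' ∨ k' = k ∧ l' < l))
    (fun i e => k ≤ i ∧ i < l + 1 ∧ (t = true → e = true))),
    cl_delete (v := plus k l) (P₁ := cut t lo M P k l)]
  · rfl
  · simp only [Bdd]; omega
  · exact ⟨h₂, h₃, Or.inr ⟨rfl, Nat.lt_succ_self l⟩⟩
  · rintro (_ | _ | ⟨a, b⟩ | ⟨a, b⟩ | ⟨j, e'⟩) hb <;> simp [cut, Region]; omega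
  · rintro (_ | _ | ⟨a, b⟩ | ⟨a, b⟩ | ⟨j, e'⟩) hb <;> simp [cut, Region, Rel, Bad] <;> grind
  · rintro (_ | _ | ⟨a, b⟩ | ⟨a, b⟩ | ⟨j, e'⟩) hb <;> simp [chain, Region]
  · rintro (_ | _ | ⟨a, b⟩ | ⟨a, b⟩ | ⟨j, e'⟩) (_ | _ | ⟨c, d⟩ | ⟨c, d⟩ | ⟨j', e''⟩) <;>
      simp [chain, Region, Rel, Bad] <;> omega
  · rintro (_ | _ | ⟨a, b⟩ | ⟨a, b⟩ | ⟨j, e'⟩) hb <;> simp [core, cut, chain, Region]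
  · rintro (_ | _ | ⟨a, b⟩ | ⟨a, b⟩ | ⟨j, e'⟩) (_ | _ | ⟨c, d⟩ | ⟨c, d⟩ | ⟨j', e''⟩) <;>
      simp [core, cut, chain, Region, Rel, Bad] <;> omega

theorem cl_cut_top {lo M P k : ℕ} :
    cl t x u N (cut t lo M P k (k + 1)) = cl t x u N (cut t lo M P (k + 1) P) := by
  refine cl_congr ?_
  rintro (_ | _ | ⟨a, b⟩ | ⟨a, b⟩ | ⟨j, e'⟩) _ <;> simp [cut, Region]
  omega

theorem cl_cut_row {lo M P k : ℕ} (h₁ : lo ≤ k) (h₂ : k < P) (h₃ : P ≤ M + 1) (h₄ : M ≤ N)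
    (h₅ : P ≤ N) :
    cl t x u N (cut t lo M P k P) = cl t x u N (cut t lo M P (k + 1) P) +
      x * ∑ l ∈ Finset.Ico (k + 1) P,
        chainSeq x (k - lo) * (cl t x u N (core t k l) * chainSeq x (M - l)) := by
  have : ∀ l, k + 1 ≤ l → l ≤ P →
      cl t x u N (cut t lo M P k l) = cl t x u N (cut t lo M P (k + 1) P) +
      x * ∑ l ∈ Finset.Ico (k + 1) l,
        chainSeq x (k - lo) * (cl t x u N (core t k l) * chainSeq x (M - l)) := by
    intro l hl
    induction l, hl using Nat.le_induction with
    | base => simp [cl_cut_top]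
    | succ l hl ih =>
      intro hP
      rw [cl_cut_succ h₁ hl (by omega) (by omega) h₅, ih (by omega), Finset.sum_Ico_succ_top hl,
        cl_chain (by omega), cl_chain h₄]
      ring
  exact this P h₂ le_rfl

/-- Cliques are sorted by their outermost `plus` vertex; the first term collects those without any.
-/
theorem cl_cut_eq_sum {lo M P : ℕ} (h₁ : lo ≤ P) (h₃ : P ≤ M + 1) (h₄ : M ≤ N) (h₅ : P ≤ N) :
    cl t x u N (cut t lo M P lo P) = cl t x u N (cut t lo M P P P) +
      x * ∑ k ∈ Finset.Ico lo P, ∑ l ∈ Finset.Ico (k + 1) P,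
        chainSeq x (k - lo) * (cl t x u N (core t k l) * chainSeq x (M - l)) := by
  have : ∀ k, lo ≤ k → k ≤ P →
      cl t x u N (cut t lo M P lo P) = cl t x u N (cut t lo M P k P) +
      x * ∑ k ∈ Finset.Ico lo k, ∑ l ∈ Finset.Ico (k + 1) P,
        chainSeq x (k - lo) * (cl t x u N (core t k l) * chainSeq x (M - l)) := by
    intro k hk
    induction k, hk using Nat.le_induction with
    | base => simp
    | succ k hk ih =>
      intro hP
      rw [ih (by omega), cl_cut_row hk (by omega) h₃ h₄ h₅, Finset.sum_Ico_succ_top hk]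
      ring
  exact this P h₁ le_rfl

/-- Here [k, l] is the whole range, so `plus k l` is a cone point. Expanding the left side by
`cl_cut_eq_sum` gives an equation that determines `core`. -/
theorem cl_cut_cone {k l : ℕ} (h : k < l) (hN : l < N) :
    cl t x u N (cut t k l (l + 1) k (l + 1)) = (1 + x) * cl t x u N (core t k l) := by
  rw [cl_cut_succ le_rfl h (by omega) le_rfl hN, cl_chain_of_le (by omega),
    cl_chain_of_le (by omega), core]
  ring

theorem cl_cut_B {lo M P : ℕ} :
    cl true x u N (cut true lo M P P P) = cl true x u N (comb lo M P true) := by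
  refine cl_congr ?_
  rintro (_ | _ | ⟨a, b⟩ | ⟨a, b⟩ | ⟨j, e'⟩) _ <;> simp [cut, comb, Region]
  omega

theorem cl_cut_D {lo M P : ℕ} :
    cl false x u N (cut false lo M P P P) = cl false x u N (doubleComb lo M P P) := by
  refine cl_congr ?_
  rintro (_ | _ | ⟨a, b⟩ | ⟨a, b⟩ | ⟨j, e'⟩) _ <;> simp [cut, doubleComb, Region]
  · omega
  · grind

/-! ### Negative simple roots -/

/-- The almost positive roots of type `B` on the positions `lo, …, N - 1`, where only the negative
simple roots `neg i` with `m ≤ i` are kept. -/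
def fullB (lo m N : ℕ) : Vtx → Prop :=
  Region (fun i => m ≤ i ∧ i < N) (fun _ => False) (fun a b => lo ≤ a ∧ a < b ∧ b < N)
    (fun k l => lo ≤ k ∧ k < l ∧ l < N) (fun i e => lo ≤ i ∧ i < N ∧ e = true)

/-- Being compatible with -α_m means not having α_m in the support. Removing node m from the diagram
leaves type A on the left and type B on the right. -/
theorem cl_fullB_succ {lo m : ℕ} (h₁ : lo ≤ m) (h₂ : m < N) :
    cl true x u N (fullB lo m N) = cl true x u N (fullB lo (m + 1) N) +
      u * (cl true x u N (chain lo (m + 1)) * cl true x u N (fullB (m + 1) (m + 1) N)) := by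
  rw [← cl_mul (P := Region (fun i => m + 1 ≤ i ∧ i < N) (fun _ => False)
    (fun a b => (lo ≤ a ∧ a < b ∧ b < m + 1) ∨ (m + 1 ≤ a ∧ a < b ∧ b < N))
    (fun k l => m + 1 ≤ k ∧ k < l ∧ l < N) (fun i e => m + 1 ≤ i ∧ i < N ∧ e = true)),
    cl_delete (v := neg m) (P₁ := fullB lo (m + 1) N)]
  · rfl
  · simpa only [Bdd]
  · simp only [fullB, Region]; omega
  · rintro (_ | _ | ⟨a, b⟩ | ⟨a, b⟩ | ⟨j, e'⟩) hb <;> simp [fullB, Region]; omega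
  · rintro (_ | _ | ⟨a, b⟩ | ⟨a, b⟩ | ⟨j, e'⟩) hb <;> simp [fullB, Region, Rel, Bad] <;> grind
  · rintro (_ | _ | ⟨a, b⟩ | ⟨a, b⟩ | ⟨j, e'⟩) hb <;> simp [fullB, chain, Region]
  · rintro (_ | _ | ⟨a, b⟩ | ⟨a, b⟩ | ⟨j, e'⟩) (_ | _ | ⟨c, d⟩ | ⟨c, d⟩ | ⟨j', e''⟩) <;>
      simp [fullB, chain, Region, Rel, Bad] <;> omega

theorem cl_fullB_top {lo : ℕ} :
    cl true x u N (fullB lo N N) = cl true x u N (cut true lo N N lo N) := by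
  refine cl_congr ?_
  rintro (_ | _ | ⟨a, b⟩ | ⟨a, b⟩ | ⟨j, e'⟩) _ <;> simp [fullB, cut, Region] <;> omega

theorem cl_fullB_eq_sum {lo : ℕ} (h : lo ≤ N) :
    cl true x u N (fullB lo lo N) = cl true x u N (cut true lo N N lo N) +
      u * ∑ m ∈ Finset.Ico lo N,
        chainSeq x (m + 1 - lo) * cl true x u N (fullB (m + 1) (m + 1) N) := by
  have : ∀ m, lo ≤ m → m ≤ N →
      cl true x u N (fullB lo lo N) = cl true x u N (fullB lo m N) +
      u * ∑ m ∈ Finset.Ico lo m,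
        chainSeq x (m + 1 - lo) * cl true x u N (fullB (m + 1) (m + 1) N) := by
    intro m hm
    induction m, hm using Nat.le_induction with
    | base => simp
    | succ m hm ih =>
      intro hN
      rw [ih (by omega), cl_fullB_succ hm (by omega), Finset.sum_Ico_succ_top hm,
        cl_chain (by omega)]
      ring
  rw [this N h le_rfl, cl_fullB_top]

/-- The almost positive roots of type `D` on the positions `lo, …, N - 1`, where only the negative
simple roots `neg i` with `m ≤ i` are kept. -/
def fullD (lo m N : ℕ) : Vtx → Prop :=
  Region (fun i => m ≤ i ∧ i + 1 < N) (fun _ => True) (fun a b => lo ≤ a ∧ a < b ∧ b < N)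
    (fun k l => lo ≤ k ∧ k < l ∧ l < N) (fun i _ => lo ≤ i ∧ i < N)

theorem cl_fullD_succ {lo m : ℕ} (h₁ : lo ≤ m) (h₂ : m + 1 < N) :
    cl false x u N (fullD lo m N) = cl false x u N (fullD lo (m + 1) N) +
      u * (cl false x u N (chain lo (m + 1)) * cl false x u N (fullD (m + 1) (m + 1) N)) := by
  rw [← cl_mul (P := Region (fun i => m + 1 ≤ i ∧ i + 1 < N) (fun _ => True)
    (fun a b => (lo ≤ a ∧ a < b ∧ b < m + 1) ∨ (m + 1 ≤ a ∧ a < b ∧ b < N))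
    (fun k l => m + 1 ≤ k ∧ k < l ∧ l < N) (fun i e => m + 1 ≤ i ∧ i < N)),
    cl_delete (v := neg m) (P₁ := fullD lo (m + 1) N)]
  · rfl
  · simp only [Bdd]; omega
  · simp only [fullD, Region]; omega
  · rintro (_ | _ | ⟨a, b⟩ | ⟨a, b⟩ | ⟨j, e'⟩) hb <;> simp [fullD, Region]; omega
  · rintro (_ | _ | ⟨a, b⟩ | ⟨a, b⟩ | ⟨j, e'⟩) hb <;> simp [fullD, Region, Rel, Bad] <;> omega
  · rintro (_ | _ | ⟨a, b⟩ | ⟨a, b⟩ | ⟨j, e'⟩) hb <;> simp [fullD, chain, Region]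
  · rintro (_ | _ | ⟨a, b⟩ | ⟨a, b⟩ | ⟨j, e'⟩) (_ | _ | ⟨c, d⟩ | ⟨c, d⟩ | ⟨j', e''⟩) <;>
      simp [fullD, chain, Region, Rel, Bad] <;> omega

/-- The four terms correspond to the subsets of the two legs. A leg excludes all `plus` vertices and
the singles of its sign; both legs leave only type A. -/
theorem cl_fullD_top {lo : ℕ} :
    cl false x u N (fullD lo (N - 1) N) = cl false x u N (cut false lo N N lo N) +
      u * (cl false x u N (comb lo N N true) + cl false x u N (comb lo N N false)) +
      u ^ 2 * cl false x u N (chain lo N) := by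
  have h₁ : cl false x u N (fullD lo (N - 1) N) = cl false x u N
      (Region (fun _ => False) (fun e => e = false) (fun a b => lo ≤ a ∧ a < b ∧ b < N)
        (fun k l => lo ≤ k ∧ k < l ∧ l < N) (fun i _ => lo ≤ i ∧ i < N)) + u * cl false x u N
      (Region (fun _ => False) (fun e => e = false) (fun a b => lo ≤ a ∧ a < b ∧ b < N)
        (fun _ _ => False) (fun i e => lo ≤ i ∧ i < N ∧ e = false)) := by
    refine cl_delete (leg true) trivial (by simp [fullD, Region]) ?_ ?_
    · rintro (_ | _ | ⟨a, b⟩ | ⟨a, b⟩ | ⟨j, e'⟩) hb <;> simp [fullD, Region]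
    · rintro (_ | _ | ⟨a, b⟩ | ⟨a, b⟩ | ⟨j, e'⟩) hb <;> simp [fullD, Region, Rel, Bad]; grind
  have h₂ : cl false x u N
      (Region (fun _ => False) (fun e => e = false) (fun a b => lo ≤ a ∧ a < b ∧ b < N)
        (fun k l => lo ≤ k ∧ k < l ∧ l < N) (fun i _ => lo ≤ i ∧ i < N)) =
      cl false x u N (cut false lo N N lo N) + u * cl false x u N (comb lo N N true) := by
    refine cl_delete (leg false) trivial (by simp [Region]) ?_ ?_
    · rintro (_ | _ | ⟨a, b⟩ | ⟨a, b⟩ | ⟨j, e'⟩) hb <;> simp [cut, Region]; omega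
    · rintro (_ | _ | ⟨a, b⟩ | ⟨a, b⟩ | ⟨j, e'⟩) hb <;> simp [comb, Region, Rel, Bad]; grind
  have h₃ : cl false x u N
      (Region (fun _ => False) (fun e => e = false) (fun a b => lo ≤ a ∧ a < b ∧ b < N)
        (fun _ _ => False) (fun i e => lo ≤ i ∧ i < N ∧ e = false)) =
      cl false x u N (comb lo N N false) + u * cl false x u N (chain lo N) := by
    refine cl_delete (leg false) trivial (by simp [Region]) ?_ ?_
    · rintro (_ | _ | ⟨a, b⟩ | ⟨a, b⟩ | ⟨j, e'⟩) hb <;> simp [comb, Region]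
    · rintro (_ | _ | ⟨a, b⟩ | ⟨a, b⟩ | ⟨j, e'⟩) hb <;> simp [chain, Region, Rel, Bad]
  rw [h₁, h₂, h₃]
  ring

theorem cl_fullD_eq_sum {lo : ℕ} (h : lo < N) :
    cl false x u N (fullD lo lo N) = cl false x u N (cut false lo N N lo N) +
      u * (cl false x u N (comb lo N N true) + cl false x u N (comb lo N N false)) +
      u ^ 2 * chainSeq x (N - lo) +
      u * ∑ m ∈ Finset.Ico lo (N - 1),
        chainSeq x (m + 1 - lo) * cl false x u N (fullD (m + 1) (m + 1) N) := by
  have : ∀ m, lo ≤ m → m ≤ N - 1 →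
      cl false x u N (fullD lo lo N) = cl false x u N (fullD lo m N) +
      u * ∑ m ∈ Finset.Ico lo m,
        chainSeq x (m + 1 - lo) * cl false x u N (fullD (m + 1) (m + 1) N) := by
    intro m hm
    induction m, hm using Nat.le_induction with
    | base => simp
    | succ m hm ih =>
      intro hN
      rw [ih (by omega), cl_fullD_succ hm (by omega), Finset.sum_Ico_succ_top hm,
        cl_chain (by omega)]
      ring
  rw [this (N - 1) (by omega) le_rfl, cl_fullD_top, cl_chain le_rfl]

end Vtx
end GammaTriangle

namespace GammaTriangle
namespace Vtx

variable {R : Type*} [CommRing R] {t : Bool} {x u : R} {N : ℕ}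

/-! ### Generating series of type `A` -/

/-- The generating series of `chainSeq`, by the number of positions. -/
noncomputable def chainSer (x : R) : PowerSeries R := PowerSeries.mk (chainSeq x)

/-- The generating series of `chainSeq`, by the rank. -/
noncomputable def rankSer (x : R) : PowerSeries R := PowerSeries.mk fun n => chainSeq x (n + 1)

theorem chainSer_eq (x : R) : chainSer x = 1 + PowerSeries.X * rankSer x := by
  ext n
  rcases n with _ | n
  · simp [chainSer]
  · simp [chainSer, rankSer, PowerSeries.coeff_succ_X_mul, PowerSeries.coeff_one]

theorem coeff_X_mul_rankSer (x : R) (n : ℕ) :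
    PowerSeries.coeff n (PowerSeries.X * rankSer x) = if n = 0 then 0 else chainSeq x n := by
  rcases n with _ | n <;> simp [rankSer, PowerSeries.coeff_succ_X_mul]

theorem coeff_mul_X_mul_rankSer (f : PowerSeries R) (n : ℕ) :
    PowerSeries.coeff n (f * (PowerSeries.X * rankSer x)) =
      ∑ i ∈ Finset.range n, PowerSeries.coeff i f * chainSeq x (n - i) := by
  rw [PowerSeries.coeff_mul, Finset.Nat.sum_antidiagonal_eq_sum_range_succ_mk,
    Finset.sum_range_succ]
  simp only [coeff_X_mul_rankSer, Nat.sub_self, if_true, mul_zero, add_zero]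
  refine Finset.sum_congr rfl fun i hi => ?_
  have := Finset.mem_range.1 hi
  rw [if_neg (by omega)]

/-- Elimination of the series U of `cutSeq` from the cone relation p = 1 + (1+x)U and the deletion
relation U = z + xUz, with z = tp. -/
theorem rankSer_mul (x : R) :
    rankSer x * (1 - PowerSeries.C x * (PowerSeries.X * rankSer x)) =
      1 + PowerSeries.X * rankSer x := by
  -- The term of degree 0 is suppressed: `cutSeq x 0` comes from an empty region and would
  -- contribute a spurious 1.
  set U : PowerSeries R := PowerSeries.mk fun n => if n = 0 then 0 else cutSeq x n with hU
  have h₁ : rankSer x = 1 + (1 + PowerSeries.C x) * U := by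
    ext n
    rw [add_mul, one_mul, map_add, map_add, PowerSeries.coeff_C_mul]
    rcases n with _ | n
    · simp [rankSer, hU]
    · simp [rankSer, hU, chainSeq_succ, PowerSeries.coeff_one]
      ring
  have h₂ : U = PowerSeries.X * rankSer x +
      PowerSeries.C x * (U * (PowerSeries.X * rankSer x)) := by
    ext n
    rw [map_add, PowerSeries.coeff_C_mul, coeff_X_mul_rankSer, coeff_mul_X_mul_rankSer]
    rcases n with _ | n
    · simp [hU]
    · rw [Finset.range_eq_Ico, Finset.sum_eq_sum_Ico_succ_bot (by omega)]
      simp only [hU, PowerSeries.coeff_mk]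
      rw [if_neg (by omega), cutSeq_eq x (by omega)]
      simp only [if_true, zero_mul, zero_add, if_neg (Nat.succ_ne_zero n)]
      congr 2
      refine Finset.sum_congr rfl fun i hi => ?_
      have := Finset.mem_Ico.1 hi
      rw [if_neg (by omega)]
  linear_combination (1 - PowerSeries.C x * (PowerSeries.X * rankSer x)) * h₁ +
    (1 + PowerSeries.C x) * h₂

/-- The functional equation of p in the form p = (1+z) + xpz, the shape in which the recursion of
the type D combs appears. -/
theorem chainSeq_succ_eq_sum (x : R) (n : ℕ) :
    chainSeq x (n + 1) = chainSeq x n +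
      x * ∑ i ∈ Finset.range n, chainSeq x (i + 1) * chainSeq x (n - i) := by
  have h := congrArg (PowerSeries.coeff n) (show rankSer x = chainSer x +
    PowerSeries.C x * (rankSer x * (PowerSeries.X * rankSer x)) by
      rw [chainSer_eq]; linear_combination rankSer_mul x)
  rw [map_add, PowerSeries.coeff_C_mul, coeff_mul_X_mul_rankSer] at h
  simpa [rankSer, chainSer] using h

/-- Singles of one sign behave like roots ending at one additional position, so a full comb counts
like type A with one position more. The proof compares the recursions instead of exhibiting the
bijection. -/
theorem cl_comb_D {lo M P : ℕ} {e : Bool} (h₁ : lo ≤ P) (h₂ : P ≤ M + 1) (h₃ : P ≤ N)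
    (h₄ : M ≤ N) :
    cl false x u N (comb lo M P e) = chainSeq x (M - lo) +
      x * ∑ i ∈ Finset.Ico lo P, chainSeq x (i - lo + 1) * chainSeq x (M - i) := by
  have aux : ∀ M P, lo ≤ P → P ≤ M + 1 → P ≤ N → M ≤ N →
      cl false x u N (comb lo M P e) = chainSeq x (M - lo) +
      x * ∑ i ∈ Finset.Ico lo P, cl false x u N (comb lo i i e) * chainSeq x (M - i) := by
    intro M P h₁ h₂ h₃ h₄
    induction P, h₁ using Nat.le_induction with
    | base => simp [cl_comb_self, cl_chain h₄]
    | succ i hi ih =>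
      rw [cl_comb_succ_D hi (by omega) (by omega), ih (by omega) (by omega),
        Finset.sum_Ico_succ_top hi, cl_chain h₄]
      ring
  have diag : ∀ n, lo + n ≤ N →
      cl false x u N (comb lo (lo + n) (lo + n) e) = chainSeq x (n + 1) := by
    intro n
    induction n using Nat.strong_induction_on with
    | _ n ih =>
      intro hn
      rw [aux _ _ (by omega) (by omega) hn hn, chainSeq_succ_eq_sum, Finset.sum_Ico_eq_sum_range]
      simp only [Nat.add_sub_cancel_left]
      congr 2
      refine Finset.sum_congr rfl fun i hi => ?_
      have := Finset.mem_range.1 hi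
      rw [ih i this (by omega)]
      congr 2
      omega
  rw [aux M P h₁ h₂ h₃ h₄]
  congr 2
  refine Finset.sum_congr rfl fun i hi => ?_
  have := Finset.mem_Ico.1 hi
  obtain ⟨j, rfl⟩ : ∃ j, i = lo + j := ⟨i - lo, by omega⟩
  rw [diag j (by omega), Nat.add_sub_cancel_left]

theorem cl_doubleComb {lo M P : ℕ} (h₁ : lo ≤ P) (h₂ : P ≤ M + 1) (h₃ : P ≤ N) (h₄ : M ≤ N) :
    cl false x u N (doubleComb lo M P P) = chainSeq x (M - lo) +
      2 * x * ∑ i ∈ Finset.Ico lo P, chainSeq x (i - lo + 1) * chainSeq x (M - i) +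
      x ^ 2 * ∑ i ∈ Finset.Ico lo P, chainSeq x (i - lo) * chainSeq x (M - i) := by
  have : ∀ i, lo ≤ i → i ≤ P →
      cl false x u N (doubleComb lo M P i) = cl false x u N (comb lo M P true) +
      x * ∑ i ∈ Finset.Ico lo i, chainSeq x (i - lo + 1) * chainSeq x (M - i) +
      x ^ 2 * ∑ i ∈ Finset.Ico lo i, chainSeq x (i - lo) * chainSeq x (M - i) := by
    intro i hi
    induction i, hi using Nat.le_induction with
    | base => simp [cl_doubleComb_self]
    | succ i hi ih =>
      intro hP
      have hc : cl false x u N (comb lo i i false) = chainSeq x (i - lo + 1) := by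
        rw [cl_comb_D hi (by omega) (by omega) (by omega), chainSeq_succ_eq_sum,
          Finset.sum_Ico_eq_sum_range]
        congr 2
        refine Finset.sum_congr rfl fun j hj => ?_
        congr 2 <;> omega
      rw [cl_doubleComb_succ hi (by omega) (by omega) (by omega), ih (by omega),
        Finset.sum_Ico_succ_top hi, Finset.sum_Ico_succ_top hi, cl_chain h₄, cl_chain (by omega),
        hc]
      ring
  rw [this P h₁ le_rfl, cl_comb_D h₁ h₂ h₃ h₄]
  ring

/-! ### Generating series of the sets with `plus` vertices -/

/-- A triple product read as a sum over intervals [k, l]: k positions before, l-k+1 inside, n-1-l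
after. The vanishing coefficients of q exclude intervals with fewer than two positions. -/
theorem coeff_mul_mul {a q b : PowerSeries R} (h₀ : PowerSeries.coeff 0 q = 0)
    (h₁ : PowerSeries.coeff 1 q = 0) (n : ℕ) :
    PowerSeries.coeff n (a * (q * b)) = ∑ k ∈ Finset.range n, ∑ l ∈ Finset.Ico (k + 1) n,
      PowerSeries.coeff k a *
        (PowerSeries.coeff (l - k + 1) q * PowerSeries.coeff (n - 1 - l) b) := by
  rw [PowerSeries.coeff_mul, Finset.Nat.sum_antidiagonal_eq_sum_range_succ_mk,
    Finset.sum_range_succ]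
  have : PowerSeries.coeff (n - n) (q * b) = 0 := by
    rw [PowerSeries.coeff_zero_eq_constantCoeff_apply] at h₀
    rw [Nat.sub_self, PowerSeries.coeff_zero_eq_constantCoeff_apply, map_mul, h₀, zero_mul]
  simp only [this, mul_zero, add_zero]
  refine Finset.sum_congr rfl fun k hk => ?_
  have hk' := Finset.mem_range.1 hk
  rw [← Finset.mul_sum, PowerSeries.coeff_mul, Finset.Nat.sum_antidiagonal_eq_sum_range_succ_mk,
    show (n - k).succ = n - (k + 1) + 1 + 1 by omega, Finset.sum_range_succ',
    Finset.sum_range_succ', Finset.sum_Ico_eq_sum_range]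
  simp only [h₀, h₁, zero_mul, add_zero, zero_add]
  congr 1
  refine Finset.sum_congr rfl fun j hj => ?_
  have := Finset.mem_range.1 hj
  congr 2
  · congr 1
    omega
  · congr 1
    omega

theorem exists_mul_eq_of_constantCoeff_eq_one {f : PowerSeries R}
    (h : PowerSeries.constantCoeff f = 1) : ∃ g, f * g = 1 :=
  ⟨PowerSeries.invOfUnit f 1, PowerSeries.mul_invOfUnit f 1 (by simpa using h)⟩

/-- The generating series of `core`, in terms of that of the sets without `plus` vertices. -/
theorem exists_core_series {I : ℕ → R}
    (hI : ∀ lo n, lo + n + 1 ≤ N → cl t x u N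
      (cut t lo (lo + n) (lo + n + 1) (lo + n + 1) (lo + n + 1)) = I n) :
    ∃ Q : PowerSeries R, PowerSeries.coeff 0 Q = 0 ∧ PowerSeries.coeff 1 Q = 0 ∧
      Q * (1 + PowerSeries.C x - PowerSeries.C x * chainSer x ^ 2) =
        PowerSeries.X * (PowerSeries.mk I - PowerSeries.C (I 0)) ∧
      ∀ k l, k < l → l < N → cl t x u N (core t k l) = PowerSeries.coeff (l - k + 1) Q := by
  obtain ⟨g, hg⟩ := exists_mul_eq_of_constantCoeff_eq_one
    (f := 1 + PowerSeries.C x - PowerSeries.C x * chainSer x ^ 2) (by simp [chainSer_eq])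
  refine ⟨PowerSeries.X * (PowerSeries.mk I - PowerSeries.C (I 0)) * g, ?_, ?_, ?_, ?_⟩
  · simp
  · rw [mul_assoc, show (1 : ℕ) = 0 + 1 from rfl, PowerSeries.coeff_succ_X_mul]
    simp
  · linear_combination PowerSeries.X * (PowerSeries.mk I - PowerSeries.C (I 0)) * hg
  set Q := PowerSeries.X * (PowerSeries.mk I - PowerSeries.C (I 0)) * g with hQ
  have h₀ : PowerSeries.coeff 0 Q = 0 := by simp [hQ]
  have h₁ : PowerSeries.coeff 1 Q = 0 := by
    rw [hQ, mul_assoc, show (1 : ℕ) = 0 + 1 from rfl, PowerSeries.coeff_succ_X_mul]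
    simp
  -- The cone identity for `core` at the level of series.
  have hrec : Q + PowerSeries.C x * Q = PowerSeries.X * (PowerSeries.mk I - PowerSeries.C (I 0)) +
      PowerSeries.C x * (chainSer x * (Q * chainSer x)) := by
    linear_combination PowerSeries.X * (PowerSeries.mk I - PowerSeries.C (I 0)) * hg
  suffices H : ∀ n k, k + (n + 1) < N →
      cl t x u N (core t k (k + (n + 1))) = PowerSeries.coeff (n + 2) Q by
    intro k l hkl hl
    obtain ⟨n, rfl⟩ : ∃ n, l = k + (n + 1) := ⟨l - k - 1, by omega⟩
    rw [H n k hl]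
    congr 2
    omega
  intro n
  induction n using Nat.strong_induction_on with
  | _ n ih =>
    intro k hk
    have e₁ := cl_cut_cone (t := t) (x := x) (u := u) (N := N) (k := k) (l := k + (n + 1))
      (by omega) hk
    rw [cl_cut_eq_sum (by omega) (by omega) (by omega) (by omega),
      hI k (n + 1) (by omega)] at e₁
    have e₂ := congrArg (PowerSeries.coeff (n + 2)) hrec
    rw [map_add, map_add, PowerSeries.coeff_C_mul, PowerSeries.coeff_C_mul,
      coeff_mul_mul h₀ h₁, show n + 2 - 1 = n + 1 from rfl, PowerSeries.coeff_succ_X_mul, map_sub, PowerSeries.coeff_mk,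
      PowerSeries.coeff_succ_C, sub_zero] at e₂
    -- By induction the two double sums agree except at the full interval, whose term is the unknown
    -- itself.
    have e₃ : ∑ k' ∈ Finset.Ico k (k + (n + 1) + 1), ∑ l ∈ Finset.Ico (k' + 1) (k + (n + 1) + 1),
        chainSeq x (k' - k) * (cl t x u N (core t k' l) * chainSeq x (k + (n + 1) - l)) -
        ∑ k' ∈ Finset.range (n + 2), ∑ l ∈ Finset.Ico (k' + 1) (n + 2),
          PowerSeries.coeff k' (chainSer x) * (PowerSeries.coeff (l - k' + 1) Q *
            PowerSeries.coeff (n + 1 - l) (chainSer x)) =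
        cl t x u N (core t k (k + (n + 1))) - PowerSeries.coeff (n + 2) Q := by
      rw [Finset.sum_Ico_eq_sum_range, show k + (n + 1) + 1 - k = n + 2 by omega,
        ← Finset.sum_sub_distrib]
      rw [Finset.sum_eq_single_of_mem 0 (by simp)]
      · rw [Finset.sum_Ico_eq_sum_range, Finset.sum_Ico_eq_sum_range,
          show k + (n + 1) + 1 - (k + 0 + 1) = n + 1 by omega,
          show n + 2 - (0 + 1) = n + 1 by omega, ← Finset.sum_sub_distrib,
          Finset.sum_eq_single_of_mem n (by simp)]
        · simp only [chainSer, PowerSeries.coeff_mk]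
          rw [show k + 0 + 1 + n = k + (n + 1) by omega,
            show 0 + 1 + n - 0 + 1 = n + 2 by omega,
            show k + (n + 1) - (k + (n + 1)) = 0 by omega,
            show n + 1 - (0 + 1 + n) = 0 by omega, show k + 0 - k = 0 by omega]
          simp
        · intro l hl hln
          have := Finset.mem_range.1 hl
          rw [show k + 0 + 1 + l = k + 0 + (l + 1) by omega, ih l (by omega) (k + 0) (by omega)]
          simp only [chainSer, PowerSeries.coeff_mk]
          rw [show k + 0 - k = 0 by omega, show 0 + 1 + l - 0 + 1 = l + 2 by omega,
            show k + (n + 1) - (k + 0 + (l + 1)) = n + 1 - (0 + 1 + l) by omega, sub_self]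
      · intro j hj hj0
        have := Finset.mem_range.1 hj
        rw [Finset.sum_Ico_eq_sum_range, Finset.sum_Ico_eq_sum_range,
          show k + (n + 1) + 1 - (k + j + 1) = n + 2 - (j + 1) by omega,
          ← Finset.sum_sub_distrib]
        refine Finset.sum_eq_zero fun l hl => ?_
        have := Finset.mem_range.1 hl
        rw [show k + j + 1 + l = k + j + (l + 1) by omega, ih l (by omega) (k + j) (by omega)]
        simp only [chainSer, PowerSeries.coeff_mk]
        rw [show k + j - k = j by omega, show j + 1 + l - j + 1 = l + 2 by omega,
          show k + (n + 1) - (k + j + (l + 1)) = n + 1 - (j + 1 + l) by omega, sub_self]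
    -- The difference δ of the two sides satisfies (1+x)δ = xδ, so δ = 0 without inverting 1+x.
    linear_combination x * e₃ - e₁ - e₂

/-- Here the `minus` vertices reach the last position, so the piece to the right of l has at least
one position. This is why the right factor is `rankSer`, not `chainSer`. -/
theorem cl_cut_eq_coeff {O : ℕ → R} {Q : PowerSeries R} {lo n : ℕ} (hn : lo + n ≤ N)
    (hO : cl t x u N (cut t lo (lo + n) (lo + n) (lo + n) (lo + n)) = O n)
    (h₀ : PowerSeries.coeff 0 Q = 0) (h₁ : PowerSeries.coeff 1 Q = 0)
    (hQ : ∀ k l, k < l → l < N → cl t x u N (core t k l) = PowerSeries.coeff (l - k + 1) Q) :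
    cl t x u N (cut t lo (lo + n) (lo + n) lo (lo + n)) = PowerSeries.coeff n
      (PowerSeries.mk O + PowerSeries.C x * (chainSer x * (Q * rankSer x))) := by
  rw [cl_cut_eq_sum (by omega) (by omega) hn hn, hO, map_add, PowerSeries.coeff_mk,
    PowerSeries.coeff_C_mul, coeff_mul_mul h₀ h₁, Finset.sum_Ico_eq_sum_range,
    Nat.add_sub_cancel_left]
  congr 2
  refine Finset.sum_congr rfl fun k hk => ?_
  have := Finset.mem_range.1 hk
  rw [Finset.sum_Ico_eq_sum_range, Finset.sum_Ico_eq_sum_range,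
    show lo + n - (lo + k + 1) = n - (k + 1) by omega]
  refine Finset.sum_congr rfl fun l hl => ?_
  have := Finset.mem_range.1 hl
  rw [hQ _ _ (by omega) (by omega)]
  simp only [chainSer, rankSer, PowerSeries.coeff_mk]
  rw [show lo + k - lo = k by omega, show lo + k + 1 + l - (lo + k) + 1 = k + 1 + l - k + 1 by omega,
    show lo + n - (lo + k + 1 + l) = n - 1 - (k + 1 + l) + 1 by omega]

end Vtx
end GammaTriangle

namespace GammaTriangle
namespace Vtx

variable {R : Type*} [CommRing R] {t : Bool} {x u : R} {N : ℕ}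

theorem coeff_mul_chainSer (f : PowerSeries R) (n : ℕ) :
    PowerSeries.coeff n (f * chainSer x) =
      ∑ i ∈ Finset.range (n + 1), PowerSeries.coeff i f * chainSeq x (n - i) := by
  rw [PowerSeries.coeff_mul, Finset.Nat.sum_antidiagonal_eq_sum_range_succ_mk]
  simp [chainSer]

/-- The sets without `plus` vertices occur with two boundaries: P = M for the whole complex (outer)
and P = M + 1 for the recursion of `core` (inner). -/
theorem cl_cut_outer_B {lo n : ℕ} (h : lo + n ≤ N) :
    cl true x u N (cut true lo (lo + n) (lo + n) (lo + n) (lo + n)) = PowerSeries.coeff n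
      (chainSer x + PowerSeries.C x * (chainSer x * (PowerSeries.X * rankSer x))) := by
  rw [cl_cut_B, cl_comb_B (by omega) (by omega) h h, map_add, PowerSeries.coeff_C_mul,
    coeff_mul_X_mul_rankSer, Finset.sum_Ico_eq_sum_range]
  simp [chainSer, Nat.add_sub_add_left]

theorem cl_cut_inner_B {lo n : ℕ} (h : lo + n + 1 ≤ N) :
    cl true x u N (cut true lo (lo + n) (lo + n + 1) (lo + n + 1) (lo + n + 1)) =
      PowerSeries.coeff n (chainSer x + PowerSeries.C x * (chainSer x * chainSer x)) := by
  rw [cl_cut_B, cl_comb_B (by omega) (by omega) h (by omega), map_add, PowerSeries.coeff_C_mul,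
    coeff_mul_chainSer, Finset.sum_Ico_eq_sum_range, show lo + n + 1 - lo = n + 1 by omega]
  simp [chainSer, Nat.add_sub_add_left]

theorem cl_cut_outer_D {lo n : ℕ} (h : lo + n ≤ N) :
    cl false x u N (cut false lo (lo + n) (lo + n) (lo + n) (lo + n)) = PowerSeries.coeff n
      (chainSer x + 2 * PowerSeries.C x * (rankSer x * (PowerSeries.X * rankSer x)) +
        PowerSeries.C x ^ 2 * (chainSer x * (PowerSeries.X * rankSer x))) := by
  rw [cl_cut_D, cl_doubleComb (by omega) (by omega) h h, Finset.sum_Ico_eq_sum_range,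
    Finset.sum_Ico_eq_sum_range, map_add, map_add,
    show (2 : PowerSeries R) * PowerSeries.C x = PowerSeries.C (2 * x) by
      rw [map_mul, map_ofNat],
    ← map_pow, PowerSeries.coeff_C_mul, PowerSeries.coeff_C_mul,
    coeff_mul_X_mul_rankSer, coeff_mul_X_mul_rankSer]
  simp [chainSer, rankSer, Nat.add_sub_add_left]

theorem cl_cut_inner_D {lo n : ℕ} (h : lo + n + 1 ≤ N) :
    cl false x u N (cut false lo (lo + n) (lo + n + 1) (lo + n + 1) (lo + n + 1)) =
      PowerSeries.coeff n (chainSer x + 2 * PowerSeries.C x * (rankSer x * chainSer x) +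
        PowerSeries.C x ^ 2 * (chainSer x * chainSer x)) := by
  rw [cl_cut_D, cl_doubleComb (by omega) (by omega) h (by omega), Finset.sum_Ico_eq_sum_range,
    Finset.sum_Ico_eq_sum_range, map_add, map_add,
    show (2 : PowerSeries R) * PowerSeries.C x = PowerSeries.C (2 * x) by
      rw [map_mul, map_ofNat],
    ← map_pow, PowerSeries.coeff_C_mul, PowerSeries.coeff_C_mul,
    coeff_mul_chainSer, coeff_mul_chainSer, show lo + n + 1 - lo = n + 1 by omega]
  simp [chainSer, rankSer, Nat.add_sub_add_left]

/-- The generating series of the clique polynomials of the almost positive roots of type `B`. -/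
noncomputable def serB (x u : R) : PowerSeries R :=
  PowerSeries.mk fun n => cl true x u n (fullB 0 0 n)

/-- The generating series of the clique polynomials of the almost positive roots of type `D`,
by the number of positions, that is, the rank diminished by one. -/
noncomputable def serD (x u : R) : PowerSeries R :=
  PowerSeries.mk fun n => if n = 0 then 0 else cl false x u n (fullD 0 0 n)

/-- The common denominator of the generating series of the positive roots of types `B`, `D`. -/
noncomputable def den (x : R) : PowerSeries R :=
  1 - 2 * PowerSeries.C x * (PowerSeries.X * rankSer x) -
    PowerSeries.C x * (PowerSeries.X * rankSer x) ^ 2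

/-- The positive part has series G = (1+z)(1-xz)/`den`. A face containing negative simple roots is
split at the smallest one into a type A piece and a smaller complex of type B, which yields the
factor 1/(1-uz). -/
theorem serB_spec (x u : R) :
    serB x u * (1 - PowerSeries.C u * (PowerSeries.X * rankSer x)) * den x =
      (1 + PowerSeries.X * rankSer x) *
        (1 - PowerSeries.C x * (PowerSeries.X * rankSer x)) := by
  have core : ∀ N, ∃ Q : PowerSeries R, PowerSeries.coeff 0 Q = 0 ∧ PowerSeries.coeff 1 Q = 0 ∧
      Q * den x = PowerSeries.X * (PowerSeries.X * rankSer x +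
        2 * PowerSeries.C x * (PowerSeries.X * rankSer x) +
        PowerSeries.C x * (PowerSeries.X * rankSer x) ^ 2) ∧
      ∀ k l, k < l → l < N → cl true x u N (core true k l) = PowerSeries.coeff (l - k + 1) Q := by
    intro N
    obtain ⟨Q, h₀, h₁, h₂, h₃⟩ := exists_core_series (N := N) (t := true) (x := x) (u := u)
      (fun lo n h => cl_cut_inner_B h)
    refine ⟨Q, h₀, h₁, ?_, h₃⟩
    have hI : (PowerSeries.mk fun n => PowerSeries.coeff n (chainSer x +
        PowerSeries.C x * (chainSer x * chainSer x))) = chainSer x +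
        PowerSeries.C x * (chainSer x * chainSer x) := by
      ext n
      simp
    have hI₀ : PowerSeries.C (PowerSeries.coeff 0 (chainSer x +
        PowerSeries.C x * (chainSer x * chainSer x))) = 1 + PowerSeries.C x := by
      simp [chainSer_eq]
    rw [hI, hI₀, chainSer_eq] at h₂
    rw [den]
    linear_combination h₂
  have hden : IsUnit (den x) := by
    rw [PowerSeries.isUnit_iff_constantCoeff]
    simp [den]
  obtain ⟨g, hg⟩ := hden.exists_right_inv
  set G : PowerSeries R := (1 + PowerSeries.X * rankSer x) *
    (1 - PowerSeries.C x * (PowerSeries.X * rankSer x)) * g with hG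
  have pos : ∀ lo N, lo ≤ N →
      cl true x u N (cut true lo N N lo N) = PowerSeries.coeff (N - lo) G := by
    intro lo N h
    obtain ⟨n, rfl⟩ : ∃ n, N = lo + n := ⟨N - lo, by omega⟩
    obtain ⟨Q, h₀, h₁, h₂, h₃⟩ := core (lo + n)
    rw [cl_cut_eq_coeff (O := fun n => PowerSeries.coeff n (chainSer x +
      PowerSeries.C x * (chainSer x * (PowerSeries.X * rankSer x)))) le_rfl
      (cl_cut_outer_B le_rfl) h₀ h₁ h₃, Nat.add_sub_cancel_left]
    congr 1
    have hO : (PowerSeries.mk fun n => PowerSeries.coeff n (chainSer x +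
      PowerSeries.C x * (chainSer x * (PowerSeries.X * rankSer x)))) = chainSer x +
      PowerSeries.C x * (chainSer x * (PowerSeries.X * rankSer x)) := by
      ext n
      simp
    rw [hO, hG, ← hden.mul_left_inj, chainSer_eq]
    have hd := den.eq_1 x
    linear_combination (1 + PowerSeries.X * rankSer x) * PowerSeries.C x * rankSer x * h₂ -
      (1 + PowerSeries.X * rankSer x) * (1 - PowerSeries.C x * (PowerSeries.X * rankSer x)) * hg +
      (1 + PowerSeries.X * rankSer x) * (1 + PowerSeries.C x * (PowerSeries.X * rankSer x)) * hd
  obtain ⟨f, hf⟩ := exists_mul_eq_of_constantCoeff_eq_one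
    (f := 1 - PowerSeries.C u * (PowerSeries.X * rankSer x)) (by simp)
  have full : ∀ n lo N, N = lo + n →
      cl true x u N (fullB lo lo N) = PowerSeries.coeff n (G * f) := by
    have hrec : G * f = G + PowerSeries.C u * (G * f * (PowerSeries.X * rankSer x)) := by
      linear_combination G * hf
    intro n
    induction n using Nat.strong_induction_on with
    | _ n ih =>
      rintro lo N rfl
      rw [cl_fullB_eq_sum (by omega), pos _ _ (by omega), hrec, map_add, PowerSeries.coeff_C_mul,
        coeff_mul_X_mul_rankSer, Nat.add_sub_cancel_left, Finset.sum_Ico_eq_sum_range,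
        Nat.add_sub_cancel_left, ← Finset.sum_range_reflect]
      congr 2
      refine Finset.sum_congr rfl fun i hi => ?_
      have := Finset.mem_range.1 hi
      rw [ih i this _ _ (by omega), mul_comm]
      congr 2
      omega
  have : serB x u = G * f := by
    ext n
    rw [serB, PowerSeries.coeff_mk, full n 0 n (by omega)]
  rw [this, hG]
  linear_combination (1 + PowerSeries.X * rankSer x) *
    (1 - PowerSeries.C x * (PowerSeries.X * rankSer x)) * (g * den x * hf + hg)

/-- The argument is that of type B, with the legs adding 2u times a type A series with one more
position and u² times the chain series. -/
theorem serD_spec (x u : R) :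
    serD x u * (1 - PowerSeries.C u * (PowerSeries.X * rankSer x)) * den x =
      (rankSer x + PowerSeries.C x * (rankSer x * (PowerSeries.X * rankSer x)) +
        PowerSeries.C x ^ 2 * ((1 + PowerSeries.X * rankSer x) * (PowerSeries.X * rankSer x)) +
        2 * PowerSeries.C u * rankSer x + PowerSeries.C u ^ 2 * (1 + PowerSeries.X * rankSer x) -
        (1 + PowerSeries.C u) ^ 2) * den x +
      PowerSeries.C x * (1 + PowerSeries.X * rankSer x) * (PowerSeries.X * rankSer x) *
        ((1 + PowerSeries.X * rankSer x) +
          2 * PowerSeries.C x * rankSer x * (1 + PowerSeries.X * rankSer x) +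
          PowerSeries.C x ^ 2 * (1 + PowerSeries.X * rankSer x) ^ 2 -
          (1 + PowerSeries.C x) ^ 2) := by
  have core : ∀ N, ∃ Q : PowerSeries R, PowerSeries.coeff 0 Q = 0 ∧ PowerSeries.coeff 1 Q = 0 ∧
      Q * den x = PowerSeries.X * ((1 + PowerSeries.X * rankSer x) +
          2 * PowerSeries.C x * rankSer x * (1 + PowerSeries.X * rankSer x) +
          PowerSeries.C x ^ 2 * (1 + PowerSeries.X * rankSer x) ^ 2 -
          (1 + PowerSeries.C x) ^ 2) ∧
      ∀ k l, k < l → l < N →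
        cl false x u N (core false k l) = PowerSeries.coeff (l - k + 1) Q := by
    intro N
    obtain ⟨Q, h₀, h₁, h₂, h₃⟩ := exists_core_series (N := N) (t := false) (x := x) (u := u)
      (fun lo n h => cl_cut_inner_D h)
    refine ⟨Q, h₀, h₁, ?_, h₃⟩
    have hI : (PowerSeries.mk fun n => PowerSeries.coeff n (chainSer x +
        2 * PowerSeries.C x * (rankSer x * chainSer x) +
        PowerSeries.C x ^ 2 * (chainSer x * chainSer x))) = chainSer x +
        2 * PowerSeries.C x * (rankSer x * chainSer x) +
        PowerSeries.C x ^ 2 * (chainSer x * chainSer x) := by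
      ext n
      simp
    have hI₀ : PowerSeries.C (PowerSeries.coeff 0 (chainSer x +
        2 * PowerSeries.C x * (rankSer x * chainSer x) +
        PowerSeries.C x ^ 2 * (chainSer x * chainSer x))) = (1 + PowerSeries.C x) ^ 2 := by
      have : PowerSeries.constantCoeff (rankSer x) = 1 := by
        rw [← PowerSeries.coeff_zero_eq_constantCoeff_apply]
        simp [rankSer]
      have h2 : PowerSeries.constantCoeff (2 : PowerSeries R) = 2 := map_ofNat _ 2
      simp only [PowerSeries.coeff_zero_eq_constantCoeff_apply, chainSer_eq, map_add, map_mul,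
        map_pow, this, h2, PowerSeries.constantCoeff_C, PowerSeries.constantCoeff_X, map_one,
        map_ofNat, zero_mul, add_zero]
      ring
    rw [hI, hI₀, chainSer_eq] at h₂
    rw [den]
    linear_combination h₂
  have hden : IsUnit (den x) := by
    rw [PowerSeries.isUnit_iff_constantCoeff]
    simp [den]
  obtain ⟨g, hg⟩ := hden.exists_right_inv
  set G : PowerSeries R := rankSer x + PowerSeries.C x * (rankSer x * (PowerSeries.X * rankSer x)) +
        PowerSeries.C x ^ 2 * ((1 + PowerSeries.X * rankSer x) * (PowerSeries.X * rankSer x)) +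
      PowerSeries.C x * (1 + PowerSeries.X * rankSer x) * (PowerSeries.X * rankSer x) *
        ((1 + PowerSeries.X * rankSer x) +
          2 * PowerSeries.C x * rankSer x * (1 + PowerSeries.X * rankSer x) +
          PowerSeries.C x ^ 2 * (1 + PowerSeries.X * rankSer x) ^ 2 -
          (1 + PowerSeries.C x) ^ 2) * g with hG
  have hv : rankSer x = 1 + PowerSeries.X * rankSer x +
      PowerSeries.C x * (rankSer x * (PowerSeries.X * rankSer x)) := by
    linear_combination rankSer_mul x
  have pos : ∀ lo N, lo ≤ N →
      cl false x u N (cut false lo N N lo N) = PowerSeries.coeff (N - lo) G := by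
    intro lo N h
    obtain ⟨n, rfl⟩ : ∃ n, N = lo + n := ⟨N - lo, by omega⟩
    obtain ⟨Q, h₀, h₁, h₂, h₃⟩ := core (lo + n)
    rw [cl_cut_eq_coeff (O := fun n => PowerSeries.coeff n (chainSer x +
      2 * PowerSeries.C x * (rankSer x * (PowerSeries.X * rankSer x)) +
        PowerSeries.C x ^ 2 * (chainSer x * (PowerSeries.X * rankSer x)))) le_rfl
      (cl_cut_outer_D le_rfl) h₀ h₁ h₃, Nat.add_sub_cancel_left]
    congr 1
    have hO : (PowerSeries.mk fun n => PowerSeries.coeff n (chainSer x +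
      2 * PowerSeries.C x * (rankSer x * (PowerSeries.X * rankSer x)) +
        PowerSeries.C x ^ 2 * (chainSer x * (PowerSeries.X * rankSer x)))) = chainSer x +
      2 * PowerSeries.C x * (rankSer x * (PowerSeries.X * rankSer x)) +
        PowerSeries.C x ^ 2 * (chainSer x * (PowerSeries.X * rankSer x)) := by
      ext n
      simp
    rw [hO, hG, ← hden.mul_left_inj, chainSer_eq]
    linear_combination (1 + PowerSeries.X * rankSer x) * PowerSeries.C x * rankSer x * h₂ -
      PowerSeries.C x * (1 + PowerSeries.X * rankSer x) * (PowerSeries.X * rankSer x) *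
        ((1 + PowerSeries.X * rankSer x) +
          2 * PowerSeries.C x * rankSer x * (1 + PowerSeries.X * rankSer x) +
          PowerSeries.C x ^ 2 * (1 + PowerSeries.X * rankSer x) ^ 2 -
          (1 + PowerSeries.C x) ^ 2) * hg - den x * hv
  obtain ⟨f, hf⟩ := exists_mul_eq_of_constantCoeff_eq_one
    (f := 1 - PowerSeries.C u * (PowerSeries.X * rankSer x)) (by simp)
  -- The recursion needs at least one position. Subtracting (1+u)² cancels the constant term 1 + 2u
  -- + u², in accordance with the value 0 in degree 0 of `serD`.
  set H : PowerSeries R := G + 2 * PowerSeries.C u * rankSer x +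
    PowerSeries.C u ^ 2 * chainSer x - PowerSeries.C ((1 + u) ^ 2) with hH
  have hG₀ : PowerSeries.coeff 0 G = 1 := by
    have : PowerSeries.constantCoeff (rankSer x) = 1 := by
      rw [← PowerSeries.coeff_zero_eq_constantCoeff_apply]
      simp [rankSer]
    simp [hG, this]
  have hH₀ : PowerSeries.coeff 0 H = 0 := by
    rw [PowerSeries.coeff_zero_eq_constantCoeff_apply] at hG₀ ⊢
    have : PowerSeries.constantCoeff (rankSer x) = 1 := by
      rw [← PowerSeries.coeff_zero_eq_constantCoeff_apply]
      simp [rankSer]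
    simp only [hH, map_add, map_sub, map_mul, map_pow, hG₀, this, chainSer_eq,
      PowerSeries.constantCoeff_C, PowerSeries.constantCoeff_X, map_one, map_ofNat]
    ring
  have hHn : ∀ n, n ≠ 0 → PowerSeries.coeff n H = PowerSeries.coeff n G +
      2 * u * chainSeq x (n + 1) + u ^ 2 * chainSeq x n := by
    intro n hn
    rw [hH, show (2 : PowerSeries R) * PowerSeries.C u = PowerSeries.C (2 * u) by
      rw [map_mul, map_ofNat], ← map_pow, map_sub, map_add, map_add, PowerSeries.coeff_C_mul,
      PowerSeries.coeff_C_mul, PowerSeries.coeff_C, if_neg hn]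
    simp [rankSer, chainSer]
  have hcomb : ∀ lo n e, cl false x u (lo + n) (comb lo (lo + n) (lo + n) e) =
      chainSeq x (n + 1) := by
    intro lo n e
    rw [cl_comb_D (by omega) (by omega) le_rfl le_rfl, chainSeq_succ_eq_sum,
      Finset.sum_Ico_eq_sum_range]
    simp [Nat.add_sub_add_left]
  have full : ∀ n lo N, N = lo + n → (if n = 0 then 0 else
      cl false x u N (fullD lo lo N)) = PowerSeries.coeff n (H * f) := by
    have hrec : H * f = H + PowerSeries.C u * (H * f * (PowerSeries.X * rankSer x)) := by
      linear_combination H * hf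
    intro n
    induction n using Nat.strong_induction_on with
    | _ n ih =>
      rintro lo N rfl
      rw [hrec, map_add, PowerSeries.coeff_C_mul, coeff_mul_X_mul_rankSer]
      rcases n with _ | n
      · simp [hH₀]
      · rw [if_neg (by omega), hHn _ (by omega), cl_fullD_eq_sum (by omega), pos _ _ (by omega),
          hcomb, hcomb, Nat.add_sub_cancel_left, Finset.sum_range_succ',
          ← ih 0 (by omega) 0 0 (by omega), Finset.sum_Ico_eq_sum_range,
          show lo + (n + 1) - 1 - lo = n by omega, ← Finset.sum_range_reflect]
        have : ∑ j ∈ Finset.range n, chainSeq x (lo + (n - 1 - j) + 1 - lo) *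
            cl false x u (lo + (n + 1)) (fullD (lo + (n - 1 - j) + 1) (lo + (n - 1 - j) + 1)
              (lo + (n + 1))) = ∑ k ∈ Finset.range n,
              PowerSeries.coeff (k + 1) (H * f) * chainSeq x (n + 1 - (k + 1)) := by
          refine Finset.sum_congr rfl fun i hi => ?_
          have := Finset.mem_range.1 hi
          rw [← ih (i + 1) (by omega) (lo + (n - 1 - i) + 1) (lo + (n + 1)) (by omega),
            if_neg (by omega), mul_comm]
          congr 2
          omega
        rw [this]
        simp only [if_true]
        ring
  have : serD x u = H * f := by
    ext n
    rw [serD, PowerSeries.coeff_mk, full n 0 n (by omega)]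
  have hH' : H = G + 2 * PowerSeries.C u * rankSer x + PowerSeries.C u ^ 2 *
      (1 + PowerSeries.X * rankSer x) - (1 + PowerSeries.C u) ^ 2 := by
    rw [hH, chainSer_eq]
    simp
  rw [this]
  linear_combination (H * den x) * hf + den x * hH' + den x * hG +
    PowerSeries.C x * (1 + PowerSeries.X * rankSer x) *
    (PowerSeries.X * rankSer x) * ((1 + PowerSeries.X * rankSer x) +
          2 * PowerSeries.C x * rankSer x * (1 + PowerSeries.X * rankSer x) +
          PowerSeries.C x ^ 2 * (1 + PowerSeries.X * rankSer x) ^ 2 -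
          (1 + PowerSeries.C x) ^ 2) * hg

end Vtx
end GammaTriangle

namespace GammaTriangle

/-! ## Power series with graded coefficients -/

section Graded

variable {R : Type*} [CommRing R]

/-- The additive group spanned by the products `q ^ i * s ^ j * m ^ k` with `2 * i + j + k = n`. -/
def gradedPiece (q s m : R) (n : ℕ) : AddSubgroup R :=
  AddSubgroup.closure {r | ∃ i j k, 2 * i + j + k = n ∧ r = q ^ i * s ^ j * m ^ k}

variable {q s m : R}

theorem pow_mem_gradedPiece (i j k : ℕ) :
    q ^ i * s ^ j * m ^ k ∈ gradedPiece q s m (2 * i + j + k) :=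
  AddSubgroup.subset_closure ⟨i, j, k, rfl, rfl⟩

theorem one_mem_gradedPiece : (1 : R) ∈ gradedPiece q s m 0 := by
  simpa using pow_mem_gradedPiece (q := q) (s := s) (m := m) 0 0 0

theorem mul_mem_gradedPiece {a b : R} {n k : ℕ} (ha : a ∈ gradedPiece q s m n)
    (hb : b ∈ gradedPiece q s m k) : a * b ∈ gradedPiece q s m (n + k) := by
  induction ha using AddSubgroup.closure_induction with
  | zero => simp
  | add x y _ _ hx hy => rw [add_mul]; exact add_mem hx hy
  | neg x _ hx => rw [neg_mul]; exact neg_mem hx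
  | mem x hx =>
    obtain ⟨i, j, l, rfl, rfl⟩ := hx
    induction hb using AddSubgroup.closure_induction with
    | zero => simp
    | add x y _ _ hx hy => rw [mul_add]; exact add_mem hx hy
    | neg x _ hx => rw [mul_neg]; exact neg_mem hx
    | mem x hx =>
      obtain ⟨i', j', l', rfl, rfl⟩ := hx
      refine AddSubgroup.subset_closure ⟨i + i', j + j', l + l', by ring, by ring⟩

/-- Setting s = 0 kills the generators with j > 0, so the piece on the left is the part that does
not use s. -/
theorem gradedPiece_zero_le (n : ℕ) : gradedPiece q 0 m n ≤ gradedPiece q s m n := by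
  refine (AddSubgroup.closure_le _).2 ?_
  rintro _ ⟨i, j, k, rfl, rfl⟩
  rcases j with _ | j
  · simpa using pow_mem_gradedPiece (q := q) (s := s) (m := m) i 0 k
  · simp

/-- The power series whose `n`-th coefficient is in the `n`-th graded piece. -/
def gradedSeries (q s m : R) : Subring (PowerSeries R) where
  carrier := {f | ∀ n, PowerSeries.coeff n f ∈ gradedPiece q s m n}
  zero_mem' n := by simp
  one_mem' n := by
    rw [PowerSeries.coeff_one]
    split_ifs with h
    · subst h; exact one_mem_gradedPiece
    · exact zero_mem _
  add_mem' hf hg n := by rw [map_add]; exact add_mem (hf n) (hg n)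
  neg_mem' hf n := by rw [map_neg]; exact neg_mem (hf n)
  mul_mem' hf hg n := by
    rw [PowerSeries.coeff_mul]
    refine sum_mem fun p hp => ?_
    rw [← Finset.HasAntidiagonal.mem_antidiagonal.1 hp]
    exact mul_mem_gradedPiece (hf _) (hg _)

theorem gradedSeries_zero_le : gradedSeries q 0 m ≤ gradedSeries q s m :=
  fun _ hf n => gradedPiece_zero_le n (hf n)

theorem C_mul_X_pow_mem {a : R} {n : ℕ} (ha : a ∈ gradedPiece q s m n) :
    PowerSeries.C a * PowerSeries.X ^ n ∈ gradedSeries q s m := by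
  intro k
  rw [PowerSeries.coeff_C_mul_X_pow]
  split_ifs with h
  · rwa [h]
  · exact zero_mem _

theorem m_mul_X_mem : PowerSeries.C m * PowerSeries.X ∈ gradedSeries q s m := by
  simpa using C_mul_X_pow_mem (n := 1)
    (by simpa using pow_mem_gradedPiece (q := q) (s := s) (m := m) 0 0 1)

theorem s_mul_X_mem : PowerSeries.C s * PowerSeries.X ∈ gradedSeries q s m := by
  simpa using C_mul_X_pow_mem (n := 1)
    (by simpa using pow_mem_gradedPiece (q := q) (s := s) (m := m) 0 1 0)

theorem q_mul_X_sq_mem : PowerSeries.C q * PowerSeries.X ^ 2 ∈ gradedSeries q s m :=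
  C_mul_X_pow_mem (n := 2) (by simpa using pow_mem_gradedPiece (q := q) (s := s) (m := m) 1 0 0)

/-- Division by a graded series with constant term 1: g = h - (f-1)g expresses each coefficient of g
through lower ones. -/
theorem mem_gradedSeries_of_mul {f g h : PowerSeries R} (hfg : f * g = h)
    (hf₁ : PowerSeries.constantCoeff f = 1) (hf : f ∈ gradedSeries q s m)
    (hh : h ∈ gradedSeries q s m) : g ∈ gradedSeries q s m := by
  intro n
  induction n using Nat.strong_induction_on with
  | _ n ih =>
    have e : PowerSeries.coeff n g = PowerSeries.coeff n h - PowerSeries.coeff n ((f - 1) * g) := by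
      rw [← map_sub]
      congr 1
      linear_combination hfg
    rw [e, PowerSeries.coeff_mul]
    refine sub_mem (hh n) (sum_mem fun p hp => ?_)
    have hp' := Finset.HasAntidiagonal.mem_antidiagonal.1 hp
    rcases Nat.eq_zero_or_pos p.1 with h0 | h0
    · have : PowerSeries.coeff p.1 (f - 1) = 0 := by rw [h0]; simp [hf₁]
      rw [this, zero_mul]
      exact zero_mem _
    · rw [← hp']
      exact mul_mem_gradedPiece (sub_mem hf (one_mem _) p.1) (ih p.2 (by omega))

/-- In the equation each t is accompanied by m and each t² by q. It is therefore homogeneous for the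
weights, and it determines the coefficients of A recursively. -/
theorem mem_gradedSeries_of_quadratic {A : PowerSeries R}
    (hA : A = 1 - PowerSeries.C m * (PowerSeries.X * A) +
      PowerSeries.C m * (PowerSeries.X * A) * A + PowerSeries.C q * (PowerSeries.X * A) ^ 2) :
    A ∈ gradedSeries q s m := by
  have hsq : ∀ n, (∀ k ≤ n, PowerSeries.coeff k A ∈ gradedPiece q s m k) →
      PowerSeries.coeff n (A * A) ∈ gradedPiece q s m n := by
    intro n h
    rw [PowerSeries.coeff_mul]
    refine sum_mem fun p hp => ?_
    have hp' := Finset.HasAntidiagonal.mem_antidiagonal.1 hp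
    rw [← hp']
    exact mul_mem_gradedPiece (h _ (by omega)) (h _ (by omega))
  have hm : m ∈ gradedPiece q s m 1 := by
    simpa using pow_mem_gradedPiece (q := q) (s := s) (m := m) 0 0 1
  have hq : q ∈ gradedPiece q s m 2 := by
    simpa using pow_mem_gradedPiece (q := q) (s := s) (m := m) 1 0 0
  intro n
  induction n using Nat.strong_induction_on with
  | _ n ih =>
    have e : A = 1 + PowerSeries.X * (PowerSeries.C m * (A * A) - PowerSeries.C m * A +
        PowerSeries.X * (PowerSeries.C q * (A * A))) := by linear_combination hA
    rw [e, map_add]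
    refine add_mem (one_mem (gradedSeries q s m) n) ?_
    rcases n with _ | n
    · simp
    · rw [PowerSeries.coeff_succ_X_mul, map_add, map_sub, PowerSeries.coeff_C_mul,
        PowerSeries.coeff_C_mul]
      refine add_mem (sub_mem ?_ ?_) ?_
      · rw [add_comm]
        exact mul_mem_gradedPiece hm (hsq n fun k hk => ih k (by omega))
      · rw [add_comm]
        exact mul_mem_gradedPiece hm (ih n (by omega))
      · rcases n with _ | n
        · simp
        · rw [PowerSeries.coeff_succ_X_mul, PowerSeries.coeff_C_mul, add_assoc, add_comm]
          exact mul_mem_gradedPiece hq (hsq n fun k hk => ih k (by omega))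

end Graded

/-! ### Rewriting the series of types B and D in the variables q, s, m. -/

namespace Vtx

variable {R : Type*} [CommRing R]

section Algebra

variable {S : Type*} [CommRing S] {x u p z E A w b m q s FB FD Δ : S}

/-- With w = z/E and A = p/E, clearing E²(1-xz) turns the claim into a polynomial identity modulo
the equation of p. -/
theorem quadratic_of_rank (hp : p * (1 - x * z) = 1 + z) (hE : E = 1 + (1 + x) * z)
    (hm : m = 1 + 2 * x) (hq : q = x * (1 + x)) (hA : A * E = p) (hw : w * E = z)
    (hEu : IsUnit E) (hzu : IsUnit (1 - x * z)) :
    A = 1 - m * w + m * w * A + q * w ^ 2 := by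
  rw [← (hEu.mul hEu |>.mul hzu).mul_left_inj]
  subst hE hm hq
  linear_combination (1 - x * z) * (1 + (1 + x) * z) * hA +
    (1 - x * z) * (1 + (1 + x) * z) * (1 + 2 * x) * hw -
    (1 - x * z) * (1 + 2 * x) * ((A * (1 + (1 + x) * z)) * hw + z * hA) -
    (1 - x * z) * (x * (1 + x)) * (w * (1 + (1 + x) * z) + z) * hw +
    ((1 + (1 + x) * z) - (1 + 2 * x) * z) * hp

/-- E is chosen so that 1-uz, 1-xz, Δ and 1+z become E(1-sw), E(1-mw), E²((1-mw)²-qw²) and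
E²(1-mw+qw²). Thus FB(1-sw) involves only w, m and q. -/
theorem rational_of_serB (hE : E = 1 + (1 + x) * z)
    (hm : m = 1 + 2 * x) (hq : q = x * (1 + x)) (hs : s = 1 + x + u) (hw : w * E = z)
    (hΔ : Δ = 1 - 2 * x * z - x * z ^ 2) (hEu : IsUnit E)
    (hB : FB * (1 - u * z) * Δ = (1 + z) * (1 - x * z)) :
    ((1 - m * w) ^ 2 - q * w ^ 2) * (FB * (1 - s * w)) =
      (1 - m * w + q * w ^ 2) * (1 - m * w) := by
  have h₁ : (1 - s * w) * E = 1 - u * z := by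
    subst hs; linear_combination hE - (1 + x + u) * hw
  have h₂ : (1 - m * w) * E = 1 - x * z := by
    subst hm; linear_combination hE - (1 + 2 * x) * hw
  have h₃ : w ^ 2 * E ^ 2 = z ^ 2 := by linear_combination (w * E + z) * hw
  have h₄ : ((1 - m * w) ^ 2 - q * w ^ 2) * E ^ 2 = Δ := by
    subst hq
    linear_combination ((1 - m * w) * E + (1 - x * z)) * h₂ - x * (1 + x) * h₃ - hΔ
  have h₅ : (1 - m * w + q * w ^ 2) * E ^ 2 = 1 + z := by
    subst hq
    linear_combination E * h₂ + x * (1 + x) * h₃ + (1 - x * z) * hE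
  rw [← (hEu.pow 3).mul_left_inj]
  linear_combination FB * (1 - s * w) * E * h₄ + FB * Δ * h₁ + hB -
    (1 - m * w) * E * h₅ - (1 + z) * h₂

/-- The point of the identity is its right side: FB enters only through FB(1-sw), where w = TA, so s
disappears. -/
theorem rational_of_serD {T : S} (hp : p * (1 - x * z) = 1 + z) (hz : z = T * p)
    (hE : E = 1 + (1 + x) * z)
    (hs : s = 1 + x + u) (hA : A * E = p)
    (hΔ : Δ = 1 - 2 * x * z - x * z ^ 2) (hEu : IsUnit E) (hzu : IsUnit (1 - x * z))
    (huu : IsUnit (1 - u * z)) (hΔu : IsUnit Δ)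
    (hB : FB * (1 - u * z) * Δ = (1 + z) * (1 - x * z))
    (hD : FD * (1 - u * z) * Δ = (p + x * (p * z) + x ^ 2 * ((1 + z) * z) + 2 * u * p +
      u ^ 2 * (1 + z) - (1 + u) ^ 2) * Δ + x * (1 + z) * z * ((1 + z) + 2 * x * p * (1 + z) +
      x ^ 2 * (1 + z) ^ 2 - (1 + x) ^ 2)) :
    A * (T * (FD - s * (FB - 1))) = FB * (1 - s * (T * A)) + 1 - 2 * A := by
  -- Here E - sz = 1 - uz. Dividing by E, with z = Tp and p = AE, gives the claim.
  have key : z * (FD - s * (FB - 1)) = (E - s * z) * FB + E - 2 * p := by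
    rw [← (hzu.mul (huu.mul hΔu)).mul_left_inj]
    subst hE hs hΔ
    linear_combination (1 - x * z) * z * hD - (1 - x * z) * (1 + (1 + x) * z) * hB +
      (z * ((1 + x * z + 2 * u) * (1 - 2 * x * z - x * z ^ 2) +
        x * (1 + z) * z * (2 * x * (1 + z))) +
        2 * (1 - u * z) * (1 - 2 * x * z - x * z ^ 2)) * hp
  rw [← hEu.mul_left_inj]
  linear_combination (T * (FD - s * (FB - 1)) + s * T * FB + 2) * hA + key -
    (FD - s * (FB - 1) + s * FB) * hz

end Algebra

/-- The comparison of the generating series of types `B` and `D`. -/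
theorem exists_series (x u : R) : ∃ D : PowerSeries R,
    D ∈ gradedSeries (x * (1 + x)) 0 (1 + 2 * x) ∧
    serB x u ∈ gradedSeries (x * (1 + x)) (1 + x + u) (1 + 2 * x) ∧
    PowerSeries.X * (serD x u - PowerSeries.C (1 + x + u) * (serB x u - 1)) = D := by
  set p := rankSer x with hp
  set z := PowerSeries.X * p with hz
  set E : PowerSeries R := 1 + (1 + PowerSeries.C x) * z with hE
  have unit : ∀ f : PowerSeries R, PowerSeries.constantCoeff f = 1 → IsUnit f := fun f hf => by
    rw [PowerSeries.isUnit_iff_constantCoeff, hf]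
    exact isUnit_one
  have hz₀ : PowerSeries.constantCoeff z = 0 := by simp [hz]
  have hEu : IsUnit E := unit E (by simp [hE, hz₀])
  have hzu : IsUnit (1 - PowerSeries.C x * z) := unit _ (by simp [hz₀])
  have huu : IsUnit (1 - PowerSeries.C u * z) := unit _ (by simp [hz₀])
  have hΔ : den x = 1 - 2 * PowerSeries.C x * z - PowerSeries.C x * z ^ 2 := rfl
  have hΔu : IsUnit (den x) := unit _ (by simp [hΔ, hz₀])
  obtain ⟨e, he⟩ := hEu.exists_right_inv
  set A := p * e with hA
  have hAE : A * E = p := by rw [hA]; linear_combination p * he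
  have hwE : PowerSeries.X * A * E = z := by rw [hz]; linear_combination PowerSeries.X * hAE
  have hpz : p * (1 - PowerSeries.C x * z) = 1 + z := rankSer_mul x
  have hm : PowerSeries.C (1 + 2 * x) = 1 + 2 * PowerSeries.C x := by
    rw [map_add, map_mul, map_one, map_ofNat]
  have hq : PowerSeries.C (x * (1 + x)) = PowerSeries.C x * (1 + PowerSeries.C x) := by simp
  have hs : PowerSeries.C (1 + x + u) = 1 + PowerSeries.C x + PowerSeries.C u := by simp
  have hAmem : A ∈ gradedSeries (x * (1 + x)) 0 (1 + 2 * x) :=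
    mem_gradedSeries_of_quadratic (quadratic_of_rank hpz hE hm hq hAE hwE hEu hzu)
  have hB := serB_spec x u
  have hb := rational_of_serB hE hm hq hs hwE hΔ hEu hB
  have hmw : PowerSeries.C (1 + 2 * x) * (PowerSeries.X * A) ∈
      gradedSeries (x * (1 + x)) 0 (1 + 2 * x) := by
    rw [← mul_assoc]
    exact mul_mem m_mul_X_mem hAmem
  have hqw : PowerSeries.C (x * (1 + x)) * (PowerSeries.X * A) ^ 2 ∈
      gradedSeries (x * (1 + x)) 0 (1 + 2 * x) := by
    rw [mul_pow, ← mul_assoc]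
    exact mul_mem q_mul_X_sq_mem (pow_mem hAmem 2)
  have hbmem : serB x u * (1 - PowerSeries.C (1 + x + u) * (PowerSeries.X * A)) ∈
      gradedSeries (x * (1 + x)) 0 (1 + 2 * x) := by
    refine mem_gradedSeries_of_mul hb (by simp) ?_ ?_
    · exact sub_mem (pow_mem (sub_mem (one_mem _) hmw) 2) hqw
    · exact mul_mem (add_mem (sub_mem (one_mem _) hmw) hqw) (sub_mem (one_mem _) hmw)
  refine ⟨_, ?_, ?_, rfl⟩
  -- Division by A, which has constant term 1; A and the right side are both graded without s.
  · refine mem_gradedSeries_of_mul (rational_of_serD hpz hz hE hs hAE hΔ hEu hzu huu hΔu hB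
      (serD_spec x u)) ?_ hAmem ?_
    · have := congrArg PowerSeries.constantCoeff hAE
      have hp₀ : PowerSeries.constantCoeff p = 1 := by
        rw [← PowerSeries.coeff_zero_eq_constantCoeff_apply, hp]
        simp [rankSer]
      simpa [hE, hz₀, hp₀] using this
    · refine sub_mem (add_mem hbmem (one_mem _)) ?_
      rw [two_mul A]
      exact add_mem hAmem hAmem
  -- Recovering type B itself requires division by 1-sw, and this is where s enters.
  · refine mem_gradedSeries_of_mul (f := 1 - PowerSeries.C (1 + x + u) * (PowerSeries.X * A))
      (mul_comm _ _) (by simp) (sub_mem (one_mem _) ?_) (gradedSeries_zero_le hbmem)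
    rw [← mul_assoc]
    exact mul_mem s_mul_X_mem (gradedSeries_zero_le hAmem)

/-- The face polynomials of types `B` and `D`: the difference `F_{D_{n+1}} - (1 + x + u) F_{B_n}`
is in the graded piece that does not involve `1 + x + u`. -/
theorem graded_comparison (x u : R) (n : ℕ) :
    cl true x u n (fullB 0 0 n) ∈ gradedPiece (x * (1 + x)) (1 + x + u) (1 + 2 * x) n ∧
    (1 ≤ n → cl false x u n (fullD 0 0 n) - (1 + x + u) * cl true x u n (fullB 0 0 n) ∈
      gradedPiece (x * (1 + x)) 0 (1 + 2 * x) (n + 1)) := by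
  obtain ⟨D, hD, hB, h⟩ := exists_series x u
  refine ⟨by simpa [serB] using hB n, fun hn => ?_⟩
  have := hD (n + 1)
  rw [← h, PowerSeries.coeff_succ_X_mul, map_sub, PowerSeries.coeff_C_mul, map_sub,
    PowerSeries.coeff_one, if_neg (by omega), sub_zero, serB, serD, PowerSeries.coeff_mk,
    PowerSeries.coeff_mk, if_neg (by omega)] at this
  exact this

end Vtx
end GammaTriangle

namespace GammaTriangle

set_option linter.unusedSectionVars false

/-! ## Roots and the Euler form of a Coxeter element -/

section Roots

variable {ι : Type*} [Fintype ι] [DecidableEq ι] {A : Matrix ι ι ℤ} {d : ι → ℤ}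

/-- The pairing `⟨v, α_i^∨⟩`. -/
def pairing (A : Matrix ι ι ℤ) (v : ι → ℤ) (i : ι) : ℤ := ∑ j, v j * A j i

/-- The symmetric bilinear form of the Cartan matrix `A` symmetrized by `d`. -/
def bilin (A : Matrix ι ι ℤ) (d : ι → ℤ) (u v : ι → ℤ) : ℤ := ∑ i, u i * d i * pairing A v i

/-- A Cartan matrix of finite type with symmetrizer `d`, where the vectors of the same norm as
some simple root are assumed to have coordinates of a constant sign. -/
structure IsFiniteType (A : Matrix ι ι ℤ) (d : ι → ℤ) : Prop where
  diag : ∀ i, A i i = 2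
  symm : ∀ i j, A i j * d j = A j i * d i
  d_eq : ∀ i, d i = 1 ∨ d i = 2
  sign : ∀ v, (∃ j, bilin A d v v = 2 * d j) → 0 ≤ v ∨ v ≤ 0
  anisotropic : ∀ v, bilin A d v v = 0 → v = 0
  finite : {v | 0 ≤ v ∧ ∃ j, bilin A d v v = 2 * d j}.Finite

@[simp] theorem simpleRoot_self (i : ι) : simpleRoot i i = 1 := by simp [simpleRoot]

theorem simpleRoot_of_ne {i j : ι} (h : j ≠ i) : simpleRoot i j = 0 := by simp [simpleRoot, h]

theorem simpleRoot_nonneg (i : ι) : 0 ≤ simpleRoot i := by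
  intro j
  by_cases h : j = i
  · subst h; simp
  · simp [simpleRoot_of_ne h]

theorem simpleRoot_inj {i j : ι} : simpleRoot i = simpleRoot j ↔ i = j := by
  refine ⟨fun h => ?_, fun h => h ▸ rfl⟩
  by_contra hij
  have := congrFun h i
  simp [simpleRoot_of_ne hij] at this

theorem not_nonneg_neg_simpleRoot (i : ι) : ¬0 ≤ -simpleRoot i := fun h => by
  have := h i
  simp at this

theorem reflection_apply_of_ne {s i : ι} (h : i ≠ s) (v : ι → ℤ) : reflection A s v i = v i := by
  simp [reflection, simpleRoot_of_ne h]

theorem reflection_apply_self (s : ι) (v : ι → ℤ) : reflection A s v s = v s - pairing A v s := by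
  simp [reflection, pairing]

theorem reflection_eq (s : ι) (v : ι → ℤ) :
    reflection A s v = v - pairing A v s • simpleRoot s := rfl

theorem pairing_add (u v : ι → ℤ) (i : ι) :
    pairing A (u + v) i = pairing A u i + pairing A v i := by
  simp [pairing, add_mul, Finset.sum_add_distrib]

theorem pairing_sub (u v : ι → ℤ) (i : ι) :
    pairing A (u - v) i = pairing A u i - pairing A v i := by
  simp [pairing, sub_mul, Finset.sum_sub_distrib]

theorem pairing_smul (k : ℤ) (v : ι → ℤ) (i : ι) : pairing A (k • v) i = k * pairing A v i := by
  simp [pairing, Finset.mul_sum, mul_assoc]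

theorem pairing_simpleRoot (i j : ι) : pairing A (simpleRoot i) j = A i j := by
  simp [pairing, simpleRoot, Pi.single_apply]

theorem bilin_simpleRoot_left (i : ι) (v : ι → ℤ) :
    bilin A d (simpleRoot i) v = d i * pairing A v i := by
  simp [bilin, simpleRoot, Pi.single_apply]

theorem bilin_sub_left (u v w : ι → ℤ) :
    bilin A d (u - v) w = bilin A d u w - bilin A d v w := by
  simp [bilin, sub_mul, Finset.sum_sub_distrib]

theorem bilin_smul_left (k : ℤ) (v w : ι → ℤ) : bilin A d (k • v) w = k * bilin A d v w := by
  simp [bilin, Finset.mul_sum, mul_assoc]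

theorem bilin_sub_right (u v w : ι → ℤ) :
    bilin A d w (u - v) = bilin A d w u - bilin A d w v := by
  simp [bilin, pairing_sub, mul_sub, Finset.sum_sub_distrib]

theorem bilin_smul_right (k : ℤ) (v w : ι → ℤ) : bilin A d w (k • v) = k * bilin A d w v := by
  simp only [bilin, pairing_smul, Finset.mul_sum]
  exact Finset.sum_congr rfl fun i _ => by ring

namespace IsFiniteType

variable (F : IsFiniteType A d)
include F

theorem d_pos (i : ι) : 0 < d i := by rcases F.d_eq i with h | h <;> omega

theorem bilin_comm (u v : ι → ℤ) : bilin A d u v = bilin A d v u := by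
  simp only [bilin, pairing, Finset.mul_sum]
  rw [Finset.sum_comm]
  refine Finset.sum_congr rfl fun i _ => Finset.sum_congr rfl fun j _ => ?_
  linear_combination u j * v i * F.symm i j

theorem bilin_simpleRoot_right (i : ι) (v : ι → ℤ) :
    bilin A d v (simpleRoot i) = d i * pairing A v i := by
  rw [F.bilin_comm, bilin_simpleRoot_left]

theorem bilin_simpleRoot_self (i : ι) : bilin A d (simpleRoot i) (simpleRoot i) = 2 * d i := by
  rw [bilin_simpleRoot_left, pairing_simpleRoot, F.diag]
  ring

theorem bilin_reflection (s : ι) (v : ι → ℤ) :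
    bilin A d (reflection A s v) (reflection A s v) = bilin A d v v := by
  rw [reflection_eq, bilin_sub_left, bilin_sub_right, bilin_sub_right, bilin_smul_left,
    bilin_smul_left, bilin_smul_right, bilin_smul_right, F.bilin_simpleRoot_self,
    F.bilin_simpleRoot_right, bilin_simpleRoot_left]
  ring

theorem reflection_reflection (s : ι) (v : ι → ℤ) : reflection A s (reflection A s v) = v := by
  funext i
  by_cases h : i = s
  · subst h
    rw [reflection_apply_self, reflection_apply_self, reflection_eq, pairing_sub, pairing_smul,
      pairing_simpleRoot, F.diag]
    ring
  · rw [reflection_apply_of_ne h, reflection_apply_of_ne h]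

theorem reflection_simpleRoot (s : ι) : reflection A s (simpleRoot s) = -simpleRoot s := by
  rw [reflection_eq, pairing_simpleRoot, F.diag, two_smul]
  abel

theorem reflection_neg_simpleRoot (s : ι) : reflection A s (-simpleRoot s) = simpleRoot s := by
  rw [← F.reflection_simpleRoot, F.reflection_reflection]

theorem bilin_of_isRoot {v : ι → ℤ} (h : IsRoot A v) : ∃ j, bilin A d v v = 2 * d j := by
  induction h with
  | simple i => exact ⟨i, F.bilin_simpleRoot_self i⟩
  | reflect i v _ ih => rwa [F.bilin_reflection]

/-- A reflection changes only the coordinate s, so a change of sign forces v to be a multiple of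
α_s. As symmetrizer values are 1 or 2, comparing norms forces the multiple to be 1. -/
theorem reflection_nonneg {v : ι → ℤ} (hv : 0 ≤ v) (hb : ∃ j, bilin A d v v = 2 * d j) {s : ι}
    (hs : v ≠ simpleRoot s) : 0 ≤ reflection A s v := by
  rcases F.sign (reflection A s v) (by rwa [F.bilin_reflection]) with h | h
  · exact h
  exfalso
  have h₀ : ∀ i, i ≠ s → v i = 0 := fun i hi => by
    have h₁ := h i
    rw [reflection_apply_of_ne hi] at h₁
    exact le_antisymm h₁ (hv i)
  have hvs : v = v s • simpleRoot s := by
    funext i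
    by_cases hi : i = s
    · subst hi; simp
    · simp [h₀ i hi, simpleRoot_of_ne hi]
  obtain ⟨j, hj⟩ := hb
  rw [hvs, bilin_smul_left, bilin_smul_right, F.bilin_simpleRoot_self] at hj
  have h1 : v s = 1 := by
    have hvs0 : (0 : ℤ) ≤ v s := hv s
    rcases F.d_eq s with h₁ | h₁ <;> rcases F.d_eq j with h₂ | h₂ <;> rw [h₁, h₂] at hj <;>
      nlinarith
  exact hs (by rw [hvs, h1, one_smul])

/-- Descent on the height: a positive norm yields a simple root pairing positively with v, and its
reflection lowers the sum of the coordinates until a simple root is reached. -/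
theorem isRoot_of_bilin {v : ι → ℤ} (hv : 0 ≤ v) (hb : ∃ j, bilin A d v v = 2 * d j) :
    IsRoot A v := by
  obtain ⟨n, hn⟩ : ∃ n : ℕ, ∑ i, v i = n := ⟨(∑ i, v i).toNat, by
    rw [Int.toNat_of_nonneg (Finset.sum_nonneg fun i _ => hv i)]⟩
  induction n using Nat.strong_induction_on generalizing v with
  | _ n ih =>
    have hpos : 0 < bilin A d v v := by
      obtain ⟨j, hj⟩ := hb
      have := F.d_pos j
      omega
    obtain ⟨i, -, hi⟩ := Finset.exists_lt_of_sum_lt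
      (show ∑ i : ι, (0 : ℤ) < ∑ i, v i * d i * pairing A v i by simpa [bilin] using hpos)
    have hvi : 0 ≤ v i * d i := mul_nonneg (hv i) (F.d_pos i).le
    have hp : 0 < pairing A v i := by
      by_contra hc
      have := mul_nonneg hvi (sub_nonneg.2 (not_lt.1 hc))
      linarith
    by_cases hs : v = simpleRoot i
    · rw [hs]; exact IsRoot.simple i
    have h₁ := F.reflection_nonneg hv hb hs
    have hsum : ∑ k, reflection A i v k = n - pairing A v i := by
      rw [← hn]
      simp [reflection_eq, Finset.sum_sub_distrib, simpleRoot, ← Finset.mul_sum]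
    have h₂ : 0 ≤ ∑ k, reflection A i v k := Finset.sum_nonneg fun k _ => h₁ k
    rw [← F.reflection_reflection i v]
    refine IsRoot.reflect i _ (ih (n - pairing A v i).toNat ?_ h₁ ?_ ?_)
    · omega
    · rwa [F.bilin_reflection]
    · omega

theorem mem_positiveRoots_iff {v : ι → ℤ} :
    v ∈ positiveRoots A ↔ 0 ≤ v ∧ ∃ j, bilin A d v v = 2 * d j :=
  ⟨fun h => ⟨h.2, F.bilin_of_isRoot h.1⟩, fun h => ⟨F.isRoot_of_bilin h.1 h.2, h.1⟩⟩

theorem finite_positiveRoots : (positiveRoots A).Finite :=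
  F.finite.subset fun _ hv => F.mem_positiveRoots_iff.1 hv

theorem reflection_mem_positiveRoots {v : ι → ℤ} (hv : v ∈ positiveRoots A) {s : ι}
    (hs : v ≠ simpleRoot s) : reflection A s v ∈ positiveRoots A :=
  ⟨hv.1.reflect s, F.reflection_nonneg hv.2 (F.bilin_of_isRoot hv.1) hs⟩

theorem simpleRoot_mem_positiveRoots (s : ι) : simpleRoot s ∈ positiveRoots A :=
  ⟨IsRoot.simple s, simpleRoot_nonneg s⟩

end IsFiniteType

/-! ### The Euler form -/

/-- The Euler form of the Coxeter element of the word `c`. -/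
def euler (A : Matrix ι ι ℤ) (d : ι → ℤ) : List ι → (ι → ℤ) → (ι → ℤ) → ℤ
  | [], _, _ => 0
  | s :: c, u, v =>
    d s * u s * v s + u s * (c.map fun j => A s j * d j * v j).sum + euler A d c u v

theorem euler_append (a b : List ι) (u v : ι → ℤ) :
    euler A d (a ++ b) u v = euler A d a u v + euler A d b u v +
      (a.map fun i => u i * (b.map fun j => A i j * d j * v j).sum).sum := by
  induction a with
  | nil => simp [euler]
  | cons s a ih =>
    simp only [List.cons_append, euler, ih, List.map_append, List.sum_append, List.map_cons,
      List.sum_cons]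
    ring

theorem euler_congr {c : List ι} {u u' v v' : ι → ℤ} (hu : ∀ i ∈ c, u i = u' i)
    (hv : ∀ i ∈ c, v i = v' i) : euler A d c u v = euler A d c u' v' := by
  induction c with
  | nil => rfl
  | cons s c ih =>
    simp only [List.mem_cons, forall_eq_or_imp] at hu hv
    rw [euler, euler, ih hu.2 hv.2, hu.1, hv.1]
    rw [show (c.map fun j => A s j * d j * v j) = c.map fun j => A s j * d j * v' j from
      List.map_congr_left fun j hj => by rw [hv.2 j hj]]

theorem euler_eq_zero_left {c : List ι} {u : ι → ℤ} (hu : ∀ i ∈ c, u i = 0) (v : ι → ℤ) :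
    euler A d c u v = 0 := by
  induction c with
  | nil => rfl
  | cons s c ih =>
    simp only [List.mem_cons, forall_eq_or_imp] at hu
    rw [euler, ih hu.2, hu.1]
    ring

theorem sum_map_eq_zero {c : List ι} {f : ι → ℤ} (h : ∀ i ∈ c, f i = 0) : (c.map f).sum = 0 :=
  List.sum_eq_zero fun x hx => by
    obtain ⟨i, hi, rfl⟩ := List.mem_map.1 hx
    exact h i hi

theorem euler_eq_zero_right {c : List ι} {v : ι → ℤ} (hv : ∀ i ∈ c, v i = 0) (u : ι → ℤ) :
    euler A d c u v = 0 := by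
  induction c with
  | nil => rfl
  | cons s c ih =>
    simp only [List.mem_cons, forall_eq_or_imp] at hv
    rw [euler, ih hv.2, hv.1, sum_map_eq_zero fun j hj => by rw [hv.2 j hj, mul_zero]]
    ring

theorem pairing_eq_list_sum {s : ι} {c : List ι} (hc : (s :: c).Nodup) {u : ι → ℤ}
    (hu : ∀ i, i ∉ s :: c → u i = 0) (hs : A s s = 2) :
    pairing A u s = 2 * u s + (c.map fun j => u j * A j s).sum := by
  have : pairing A u s = ((s :: c).map fun j => u j * A j s).sum := by
    rw [← List.sum_toFinset _ hc, pairing]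
    refine (Finset.sum_subset (Finset.subset_univ _) fun i _ hi => ?_).symm
    rw [hu i (by simpa using hi), zero_mul]
  rw [this, List.map_cons, List.sum_cons, hs]
  ring

namespace IsFiniteType

variable (F : IsFiniteType A d)
include F

/-- Symmetrizability moves the sum onto column s of A, so the bracket is minus the s-coordinate of
the reflected v when c exhausts the rest of the support. -/
theorem euler_initial {s : ι} {c : List ι} (u v : ι → ℤ) :
    euler A d (s :: c) u v = d s * u s * (v s + (c.map fun j => v j * A j s).sum) +
      euler A d c u v := by
  have : (c.map fun j => A s j * d j * v j).sum = d s * (c.map fun j => v j * A j s).sum := by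
    rw [← List.sum_map_mul_left]
    congr 1
    refine List.map_congr_left fun j _ => ?_
    linear_combination v j * F.symm s j
  rw [euler, this]
  ring

omit F in
theorem euler_final {s : ι} {c : List ι} (u v : ι → ℤ) :
    euler A d (c ++ [s]) u v = d s * v s * (u s + (c.map fun j => u j * A j s).sum) +
      euler A d c u v := by
  have : (c.map fun i => u i * (A i s * d s * v s)).sum =
      d s * v s * (c.map fun j => u j * A j s).sum := by
    rw [← List.sum_map_mul_left]
    congr 1
    exact List.map_congr_left fun j _ => by ring
  rw [euler_append]
  simp only [euler, List.map_cons, List.map_nil, List.sum_cons, List.sum_nil, mul_zero, add_zero]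
  rw [this]
  ring

section

variable {s : ι} {c : List ι} (hc : (s :: c).Nodup) {u v : ι → ℤ}
  (hu : ∀ i, i ∉ s :: c → u i = 0) (hv : ∀ i, i ∉ s :: c → v i = 0)
include hc

include hu in
theorem reflection_apply_initial :
    reflection A s u s = -(u s + (c.map fun j => u j * A j s).sum) := by
  rw [reflection_apply_self, pairing_eq_list_sum hc hu (F.diag s)]
  ring

-- Passing s from the first to the last place exchanges the two factors of the s-term. The
-- reflection does the same up to two signs, and it leaves the coordinates in c alone.
include hu hv in
theorem euler_reflection :
    euler A d (c ++ [s]) (reflection A s u) (reflection A s v) = euler A d (s :: c) u v := by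
  have hsc : ∀ i ∈ c, i ≠ s := fun i hi h => (List.nodup_cons.1 hc).1 (h ▸ hi)
  rw [euler_final, F.euler_initial,
    euler_congr (fun i hi => reflection_apply_of_ne (hsc i hi) u)
      (fun i hi => reflection_apply_of_ne (hsc i hi) v),
    show (c.map fun j => reflection A s u j * A j s) = c.map fun j => u j * A j s from
      List.map_congr_left fun j hj => by rw [reflection_apply_of_ne (hsc j hj)],
    F.reflection_apply_initial hc hu, F.reflection_apply_initial hc hv]
  ring

omit F in
theorem simpleRoot_apply_eq_zero {i : ι} (hi : i ∈ c) : simpleRoot s i = 0 :=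
  simpleRoot_of_ne fun h => (List.nodup_cons.1 hc).1 (h ▸ hi)

theorem euler_initial_simpleRoot_right (u : ι → ℤ) :
    euler A d (s :: c) u (simpleRoot s) = d s * u s := by
  rw [F.euler_initial, euler_eq_zero_right fun i hi => simpleRoot_apply_eq_zero hc hi,
    sum_map_eq_zero fun j hj => by rw [simpleRoot_apply_eq_zero hc hj, zero_mul]]
  simp

include hv in
theorem euler_initial_simpleRoot_left :
    euler A d (s :: c) (simpleRoot s) v = -(d s * reflection A s v s) := by
  rw [F.euler_initial, euler_eq_zero_left fun i hi => simpleRoot_apply_eq_zero hc hi,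
    F.reflection_apply_initial hc hv, simpleRoot_self]
  ring

omit F in
theorem euler_final_simpleRoot_left (v : ι → ℤ) :
    euler A d (c ++ [s]) (simpleRoot s) v = d s * v s := by
  rw [euler_final, euler_eq_zero_left fun i hi => simpleRoot_apply_eq_zero hc hi,
    sum_map_eq_zero fun j hj => by rw [simpleRoot_apply_eq_zero hc hj, zero_mul]]
  simp

include hu in
theorem euler_final_simpleRoot_right :
    euler A d (c ++ [s]) u (simpleRoot s) = -(d s * reflection A s u s) := by
  rw [euler_final, euler_eq_zero_right fun i hi => simpleRoot_apply_eq_zero hc hi,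
    F.reflection_apply_initial hc hu, simpleRoot_self]
  ring

end

end IsFiniteType

end Roots

end GammaTriangle

namespace GammaTriangle

set_option linter.unusedSectionVars false

/-! ## Compatibility in terms of the Euler form -/

section Compatibility

variable {ι : Type*} [Fintype ι] [DecidableEq ι] {A : Matrix ι ι ℤ} {d : ι → ℤ}

/-- Compatibility with respect to the Coxeter element of the word `c`, by means of the Euler form
of `c`. -/
def EulerCompatible (A : Matrix ι ι ℤ) (d : ι → ℤ) (c : List ι) (u v : ι → ℤ) : Prop :=
  (∀ i, u = -simpleRoot i → v i = 0) ∧ (∀ i, v = -simpleRoot i → u i = 0) ∧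
    (0 ≤ u → 0 ≤ v → 0 ≤ euler A d c u v ∧ 0 ≤ euler A d c v u)

/-- The almost positive roots of the standard parabolic subsystem `J`. -/
def parabolicRoots (A : Matrix ι ι ℤ) (J : Finset ι) : Set (ι → ℤ) :=
  {v | v ∈ positiveRoots A ∧ ∀ i, i ∉ J → v i = 0} ∪ {v | ∃ i ∈ J, v = -simpleRoot i}

theorem EulerCompatible.symm {c : List ι} {u v : ι → ℤ} (h : EulerCompatible A d c u v) :
    EulerCompatible A d c v u :=
  ⟨h.2.1, h.1, fun hv hu => (h.2.2 hu hv).symm⟩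

theorem eulerCompatible_comm {c : List ι} {u v : ι → ℤ} :
    EulerCompatible A d c u v ↔ EulerCompatible A d c v u := ⟨.symm, .symm⟩

theorem neg_simpleRoot_inj {i j : ι} : -simpleRoot i = -simpleRoot j ↔ i = j := by
  rw [neg_inj, simpleRoot_inj]

theorem ne_neg_simpleRoot {v : ι → ℤ} (hv : 0 ≤ v) (i : ι) : v ≠ -simpleRoot i := fun h =>
  not_nonneg_neg_simpleRoot i (h ▸ hv)

theorem eulerCompatible_neg_iff {c : List ι} {i : ι} {v : ι → ℤ} (hv : v ≠ -simpleRoot i) :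
    EulerCompatible A d c (-simpleRoot i) v ↔ v i = 0 := by
  refine ⟨fun h => h.1 i rfl, fun h => ⟨fun j hj => ?_, fun j hj => ?_, fun h₁ => ?_⟩⟩
  · rwa [← neg_simpleRoot_inj.1 hj]
  · have : j ≠ i := fun e => hv (e ▸ hj)
    simp [simpleRoot_of_ne this]
  · exact absurd h₁ (not_nonneg_neg_simpleRoot i)

theorem eulerCompatible_iff {c : List ι} {u v : ι → ℤ} (hu : 0 ≤ u) (hv : 0 ≤ v) :
    EulerCompatible A d c u v ↔ 0 ≤ euler A d c u v ∧ 0 ≤ euler A d c v u :=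
  ⟨fun h => h.2.2 hu hv, fun h => ⟨fun i hi => absurd hi (ne_neg_simpleRoot hu i),
    fun i hi => absurd hi (ne_neg_simpleRoot hv i), fun _ _ => h⟩⟩

theorem tau_neg_of_ne {i s : ι} (h : i ≠ s) : tau A s (-simpleRoot i) = -simpleRoot i := by
  rw [tau, if_pos ⟨i, h, rfl⟩]

theorem tau_of_nonneg {s : ι} {v : ι → ℤ} (hv : 0 ≤ v) : tau A s v = reflection A s v := by
  rw [tau, if_neg]
  rintro ⟨i, -, rfl⟩
  exact not_nonneg_neg_simpleRoot i hv

namespace IsFiniteType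

variable (F : IsFiniteType A d)
include F

theorem tau_neg_self (s : ι) : tau A s (-simpleRoot s) = simpleRoot s := by
  rw [tau, if_neg, F.reflection_neg_simpleRoot]
  rintro ⟨i, hi, h⟩
  exact hi (neg_simpleRoot_inj.1 h).symm

theorem tau_simpleRoot (s : ι) : tau A s (simpleRoot s) = -simpleRoot s := by
  rw [tau_of_nonneg (simpleRoot_nonneg s), F.reflection_simpleRoot]

theorem tau_tau {J : Finset ι} {s : ι} {v : ι → ℤ} (hv : v ∈ parabolicRoots A J) :
    tau A s (tau A s v) = v := by
  rcases hv with ⟨hv, -⟩ | ⟨i, -, rfl⟩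
  · by_cases hs : v = simpleRoot s
    · rw [hs, F.tau_simpleRoot, F.tau_neg_self]
    · rw [tau_of_nonneg hv.2, tau_of_nonneg (F.reflection_mem_positiveRoots hv hs).2,
        F.reflection_reflection]
  · by_cases h : i = s
    · rw [h, F.tau_neg_self, F.tau_simpleRoot]
    · rw [tau_neg_of_ne h, tau_neg_of_ne h]

theorem tau_mem {J : Finset ι} {s : ι} (hs : s ∈ J) {v : ι → ℤ} (hv : v ∈ parabolicRoots A J) :
    tau A s v ∈ parabolicRoots A J := by
  rcases hv with ⟨hv, hJ⟩ | ⟨i, hi, rfl⟩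
  · by_cases hvs : v = simpleRoot s
    · rw [hvs, F.tau_simpleRoot]
      exact Or.inr ⟨s, hs, rfl⟩
    · rw [tau_of_nonneg hv.2]
      refine Or.inl ⟨F.reflection_mem_positiveRoots hv hvs, fun i hi => ?_⟩
      rw [reflection_apply_of_ne fun h => hi (by rw [h]; exact hs), hJ i hi]
  · by_cases h : i = s
    · rw [h, F.tau_neg_self]
      refine Or.inl ⟨simpleRoot_mem_positiveRoots F s, fun j hj => simpleRoot_of_ne ?_⟩
      rintro rfl
      exact hj hs
    · rw [tau_neg_of_ne h]
      exact Or.inr ⟨i, hi, rfl⟩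

theorem tau_injOn (J : Finset ι) (s : ι) : Set.InjOn (tau A s) (parabolicRoots A J) :=
  fun u hu v hv h => by rw [← F.tau_tau hu (s := s), h, F.tau_tau hv]

theorem tau_apply_of_ne {s i : ι} (h : i ≠ s) (v : ι → ℤ) : tau A s v i = v i := by
  rw [tau]
  split_ifs
  · rfl
  · exact reflection_apply_of_ne h v

/-! ### Invariance of Euler compatibility under rotation. -/

section Rotate

variable {s : ι} {c : List ι} (hc : (s :: c).Nodup)
include hc

theorem eulerCompatible_rotate_neg {i : ι} (hi : i ∈ s :: c) (his : i ≠ s) {v : ι → ℤ}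
    (hv : v ∈ parabolicRoots A (s :: c).toFinset) (h : v ≠ -simpleRoot i) :
    EulerCompatible A d (s :: c) (-simpleRoot i) v ↔
      EulerCompatible A d (c ++ [s]) (tau A s (-simpleRoot i)) (tau A s v) := by
  have hi' : -simpleRoot i ∈ parabolicRoots A (s :: c).toFinset :=
    Or.inr ⟨i, List.mem_toFinset.2 hi, rfl⟩
  rw [eulerCompatible_neg_iff h, tau_neg_of_ne his, eulerCompatible_neg_iff,
    F.tau_apply_of_ne his]
  intro hc
  rw [← tau_neg_of_ne (A := A) his] at hc
  exact h (F.tau_injOn _ s hv hi' hc)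

/-- For s initial, the form of α_s against v is -d_s times the s-coordinate of the reflected root,
which is itself nonnegative. Nonnegativity of the form therefore means that this coordinate
vanishes, which is compatibility with -α_s after rotation. -/
theorem eulerCompatible_rotate_simple {v : ι → ℤ}
    (hv : v ∈ parabolicRoots A (s :: c).toFinset) (h : v ≠ simpleRoot s) :
    EulerCompatible A d (s :: c) (simpleRoot s) v ↔
      EulerCompatible A d (c ++ [s]) (tau A s (simpleRoot s)) (tau A s v) := by
  rcases hv with ⟨hv, hJ⟩ | ⟨i, hi, rfl⟩
  · have hJ' : ∀ i, i ∉ s :: c → v i = 0 := fun i hi => hJ i (by simpa using hi)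
    have hp := F.reflection_mem_positiveRoots hv h
    have h₀ := hp.2 s
    have hv₀ := hv.2 s
    have hd := F.d_pos s
    rw [eulerCompatible_iff (simpleRoot_nonneg s) hv.2, F.tau_simpleRoot, tau_of_nonneg hv.2,
      eulerCompatible_neg_iff (ne_neg_simpleRoot hp.2 s), F.euler_initial_simpleRoot_left hc hJ',
      F.euler_initial_simpleRoot_right hc]
    simp only [Pi.zero_apply] at h₀ hv₀
    constructor
    · rintro ⟨h₁, -⟩
      nlinarith
    · intro h₁
      rw [h₁]
      exact ⟨by simp, mul_nonneg hd.le hv₀⟩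
  · by_cases his : i = s
    · subst his
      rw [eulerCompatible_comm, eulerCompatible_neg_iff (ne_neg_simpleRoot (simpleRoot_nonneg i) i),
        F.tau_neg_self, F.tau_simpleRoot,
        eulerCompatible_neg_iff (ne_neg_simpleRoot (simpleRoot_nonneg i) i)]
    · have hs : simpleRoot s ∈ parabolicRoots A (s :: c).toFinset := by
        refine Or.inl ⟨simpleRoot_mem_positiveRoots F s, fun j hj => simpleRoot_of_ne ?_⟩
        rintro rfl
        simp at hj
      rw [eulerCompatible_comm, F.eulerCompatible_rotate_neg hc (by simpa using hi) his hs h.symm,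
        eulerCompatible_comm]

theorem eulerCompatible_rotate_neg_self {v : ι → ℤ}
    (hv : v ∈ parabolicRoots A (s :: c).toFinset) (h : v ≠ -simpleRoot s) :
    EulerCompatible A d (s :: c) (-simpleRoot s) v ↔
      EulerCompatible A d (c ++ [s]) (tau A s (-simpleRoot s)) (tau A s v) := by
  have hs : -simpleRoot s ∈ parabolicRoots A (s :: c).toFinset := Or.inr ⟨s, by simp, rfl⟩
  rcases hv with ⟨hv, hJ⟩ | ⟨i, hi, rfl⟩
  · by_cases hvs : v = simpleRoot s
    · rw [eulerCompatible_comm, hvs, F.eulerCompatible_rotate_simple hc hs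
        (ne_neg_simpleRoot (simpleRoot_nonneg s) s).symm, eulerCompatible_comm]
    have hJ' : ∀ i, i ∉ s :: c → v i = 0 := fun i hi => hJ i (by simpa using hi)
    have hp := F.reflection_mem_positiveRoots hv hvs
    have hpJ : ∀ i, i ∉ s :: c → reflection A s v i = 0 := fun i hi => by
      rw [reflection_apply_of_ne fun e => hi (by simp [e]), hJ' i hi]
    have h₀ := hp.2 s
    have hv₀ := hv.2 s
    have hd := F.d_pos s
    rw [eulerCompatible_neg_iff h, F.tau_neg_self, tau_of_nonneg hv.2,
      eulerCompatible_iff (simpleRoot_nonneg s) hp.2, euler_final_simpleRoot_left hc,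
      F.euler_final_simpleRoot_right hc hpJ, F.reflection_reflection]
    simp only [Pi.zero_apply] at h₀ hv₀
    constructor
    · intro h₁
      rw [h₁]
      exact ⟨mul_nonneg hd.le h₀, by simp⟩
    · rintro ⟨-, h₁⟩
      nlinarith
  · have his : i ≠ s := fun e => h (e ▸ rfl)
    rw [eulerCompatible_comm, F.eulerCompatible_rotate_neg hc (by simpa using hi) his hs h.symm,
      eulerCompatible_comm]

/-- Rotation of the word. -/
theorem eulerCompatible_rotate {u v : ι → ℤ} (hu : u ∈ parabolicRoots A (s :: c).toFinset)
    (hv : v ∈ parabolicRoots A (s :: c).toFinset) (h : u ≠ v) :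
    EulerCompatible A d (s :: c) u v ↔
      EulerCompatible A d (c ++ [s]) (tau A s u) (tau A s v) := by
  have neg : ∀ {i : ι} {v : ι → ℤ}, i ∈ s :: c → v ∈ parabolicRoots A (s :: c).toFinset →
      v ≠ -simpleRoot i → (EulerCompatible A d (s :: c) (-simpleRoot i) v ↔
      EulerCompatible A d (c ++ [s]) (tau A s (-simpleRoot i)) (tau A s v)) := by
    intro i v hi hv h
    by_cases his : i = s
    · subst his
      exact F.eulerCompatible_rotate_neg_self hc hv h
    · exact F.eulerCompatible_rotate_neg hc hi his hv h
  by_cases hus : u = simpleRoot s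
  · subst hus
    exact F.eulerCompatible_rotate_simple hc hv h.symm
  by_cases hvs : v = simpleRoot s
  · subst hvs
    rw [eulerCompatible_comm, F.eulerCompatible_rotate_simple hc hu h, eulerCompatible_comm]
  rcases hu with ⟨hu, hu'⟩ | ⟨i, hi, rfl⟩
  swap
  · exact neg (by simpa using hi) hv h.symm
  rcases hv with ⟨hv, hv'⟩ | ⟨i, hi, rfl⟩
  swap
  · rw [eulerCompatible_comm, neg (by simpa using hi) (Or.inl ⟨hu, hu'⟩) h, eulerCompatible_comm]
  have hu'' : ∀ i, i ∉ s :: c → u i = 0 := fun i hi => hu' i (by simpa using hi)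
  have hv'' : ∀ i, i ∉ s :: c → v i = 0 := fun i hi => hv' i (by simpa using hi)
  rw [eulerCompatible_iff hu.2 hv.2, tau_of_nonneg hu.2, tau_of_nonneg hv.2,
    eulerCompatible_iff (F.reflection_mem_positiveRoots hu hus).2
      (F.reflection_mem_positiveRoots hv hvs).2, F.euler_reflection hc hu'' hv'',
    F.euler_reflection hc hv'' hu'']

end Rotate

/-! ### The compatibility relation of a Coxeter element -/

omit F in
theorem parabolicRoots_univ : parabolicRoots A Finset.univ = almostPositiveRoots A := by
  ext v
  simp [parabolicRoots, almostPositiveRoots, negSimpleRoots]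

omit F in
theorem toFinset_eq_univ {c : List ι} (hc : IsCoxeterWord c) : c.toFinset = Finset.univ := by
  ext i
  simpa using hc.2 i

omit F in
theorem isCoxeterWord_rotate {s : ι} {c : List ι} (hc : IsCoxeterWord (s :: c)) :
    IsCoxeterWord (c ++ [s]) :=
  ⟨((List.perm_append_singleton s c).nodup_iff).2 hc.1, fun i =>
    ((List.perm_append_singleton s c).mem_iff).2 (hc.2 i)⟩

theorem eulerCompatible_of_compatible {c : List ι} {u v : ι → ℤ} (h : Compatible A c u v)
    (hc : IsCoxeterWord c) (hu : u ∈ parabolicRoots A Finset.univ)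
    (hv : v ∈ parabolicRoots A Finset.univ) (huv : u ≠ v) : EulerCompatible A d c u v := by
  induction h with
  | neg_left c i β h => exact (eulerCompatible_neg_iff huv.symm).2 h
  | neg_right c i β h => exact ((eulerCompatible_neg_iff huv).2 h).symm
  | rotate s c β γ h ih =>
    rw [F.eulerCompatible_rotate hc.1 (by rwa [toFinset_eq_univ hc])
      (by rwa [toFinset_eq_univ hc]) huv]
    exact ih (isCoxeterWord_rotate hc) (F.tau_mem (Finset.mem_univ s) hu)
      (F.tau_mem (Finset.mem_univ s) hv) fun e => huv (F.tau_injOn _ s hu hv e)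

omit F in
/-- The action of the word `c` on the root lattice. -/
def wordAction (A : Matrix ι ι ℤ) (c : List ι) (v : ι → ℤ) : ι → ℤ :=
  c.foldl (fun v s => reflection A s v) v

omit F in
theorem wordAction_apply_of_notMem {c : List ι} {i : ι} (hi : i ∉ c) (v : ι → ℤ) :
    wordAction A c v i = v i := by
  induction c generalizing v with
  | nil => rfl
  | cons s c ih =>
    simp only [List.mem_cons, not_or] at hi
    rw [wordAction, List.foldl_cons]
    exact (ih hi.2 _).trans (reflection_apply_of_ne hi.1 v)

omit F in
theorem wordAction_add (c : List ι) (u v : ι → ℤ) :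
    wordAction A c (u + v) = wordAction A c u + wordAction A c v := by
  induction c generalizing u v with
  | nil => rfl
  | cons s c ih =>
    have : reflection A s (u + v) = reflection A s u + reflection A s v := by
      rw [reflection_eq, reflection_eq, reflection_eq, pairing_add, add_smul]
      abel
    simpa only [wordAction, List.foldl_cons, this] using ih _ _

omit F in
theorem wordAction_sum (c : List ι) {κ : Type*} (S : Finset κ) (f : κ → ι → ℤ) :
    wordAction A c (∑ k ∈ S, f k) = ∑ k ∈ S, wordAction A c (f k) := by
  have h0 : wordAction A c (0 : ι → ℤ) = 0 := by
    have := wordAction_add (A := A) c 0 0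
    rw [add_zero] at this
    exact left_eq_add.1 this
  exact map_sum (⟨⟨wordAction A c, h0⟩, wordAction_add c⟩ : (ι → ℤ) →+ (ι → ℤ)) f S

-- The first letter alone can change its own coordinate, and the word contains it once. A fixed
-- vector is thus fixed by the first reflection, then by the next ones.
omit F in
theorem reflection_eq_of_wordAction_eq {c : List ι} (hc : c.Nodup) {v : ι → ℤ}
    (h : wordAction A c v = v) : ∀ s ∈ c, reflection A s v = v := by
  induction c with
  | nil => simp
  | cons s c ih =>
    obtain ⟨hs, hc⟩ := List.nodup_cons.1 hc
    have h' : wordAction A c (reflection A s v) = v := h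
    have hv : reflection A s v = v := by
      funext i
      by_cases hi : i = s
      · subst hi
        rw [← wordAction_apply_of_notMem hs (reflection A i v), h']
      · exact reflection_apply_of_ne hi v
    rw [hv] at h'
    intro i hi
    rcases List.mem_cons.1 hi with rfl | hi
    · exact hv
    · exact ih hc h' i hi

/-- A Coxeter element does not fix a nonzero vector. -/
theorem eq_zero_of_wordAction_eq {c : List ι} (hc : IsCoxeterWord c) {v : ι → ℤ}
    (h : wordAction A c v = v) : v = 0 := by
  refine F.anisotropic v (Finset.sum_eq_zero fun i _ => ?_)
  have h₁ := congrFun (reflection_eq_of_wordAction_eq hc.1 h i (hc.2 i)) i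
  rw [reflection_apply_self] at h₁
  have : pairing A v i = 0 := by omega
  rw [this, mul_zero]

/-- Every positive root leaves the set of the positive roots under some power of a Coxeter
element. -/
theorem exists_iterate_notMem {c : List ι} (hc : IsCoxeterWord c) (v : ι → ℤ) :
    ∃ k : ℕ, (wordAction A c)^[k] v ∉ positiveRoots A := by
  by_contra! hcon
  obtain ⟨a, b, hab, h⟩ := F.finite_positiveRoots.exists_lt_map_eq_of_forall_mem hcon
  set f : ℕ → ι → ℤ := fun k => (wordAction A c)^[k] v with hf
  have hsucc : ∀ k, wordAction A c (f k) = f (k + 1) := fun k =>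
    (Function.iterate_succ_apply' _ _ _).symm
  -- Two iterates coincide by finiteness. The sum over the resulting period is fixed, hence zero,
  -- although its terms are nonnegative and nonzero.
  have hfix : wordAction A c (∑ k ∈ Finset.Ico a b, f k) = ∑ k ∈ Finset.Ico a b, f k := by
    rw [wordAction_sum]
    simp only [hsucc]
    rw [Finset.sum_Ico_add' f a b 1, Finset.sum_Ico_succ_top (by omega),
      Finset.sum_eq_sum_Ico_succ_bot hab]
    have : f b = f a := h.symm
    rw [this, add_comm]
  have h₀ := F.eq_zero_of_wordAction_eq hc hfix
  have hnn : ∀ k ∈ Finset.Ico a b, 0 ≤ f k := fun k _ => (hcon k).2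
  have hfa : f a = 0 := (Finset.sum_eq_zero_iff_of_nonneg hnn).1 h₀ a (by simp [hab])
  obtain ⟨j, hj⟩ := F.bilin_of_isRoot (hcon a).1
  have := F.d_pos j
  have e : (wordAction A c)^[a] v = 0 := hfa
  rw [e] at hj
  simp [bilin] at hj
  omega

/-- A counterexample stays a counterexample after each rotation, and its first root must remain
positive, since a negative simple root would give compatibility at once. This contradicts
`exists_iterate_notMem`. -/
theorem compatible_of_eulerCompatible {c : List ι} (hc : IsCoxeterWord c) {u v : ι → ℤ}
    (hu : u ∈ parabolicRoots A Finset.univ) (hv : v ∈ parabolicRoots A Finset.univ)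
    (huv : u ≠ v) (h : EulerCompatible A d c u v) : Compatible A c u v := by
  have key : ∀ (l r : List ι) (u v : ι → ℤ), IsCoxeterWord (l ++ r) → u ∈ positiveRoots A →
      v ∈ parabolicRoots A Finset.univ → u ≠ v → EulerCompatible A d (l ++ r) u v →
      ¬Compatible A (l ++ r) u v →
      wordAction A l u ∈ positiveRoots A ∧ ∃ v, v ∈ parabolicRoots A Finset.univ ∧
        wordAction A l u ≠ v ∧ EulerCompatible A d (r ++ l) (wordAction A l u) v ∧
        ¬Compatible A (r ++ l) (wordAction A l u) v := by
    intro l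
    induction l with
    | nil =>
      intro r u v hc hu hv huv h hn
      exact ⟨hu, v, hv, huv, by simpa [wordAction] using h, by simpa [wordAction] using hn⟩
    | cons s l ih =>
      intro r u v hc hu hv huv h hn
      have hu' : u ∈ parabolicRoots A Finset.univ := Or.inl ⟨hu, by simp⟩
      have hc' : IsCoxeterWord (l ++ (r ++ [s])) := by
        rw [← List.append_assoc]; exact isCoxeterWord_rotate hc
      have hne : tau A s u ≠ tau A s v := fun e => huv (F.tau_injOn _ s hu' hv e)
      have h' : EulerCompatible A d (l ++ (r ++ [s])) (tau A s u) (tau A s v) := by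
        have ht : (s :: (l ++ r)).toFinset = Finset.univ := toFinset_eq_univ hc
        have e := (F.eulerCompatible_rotate (c := l ++ r) (s := s) hc.1 (by rw [ht]; exact hu')
          (by rw [ht]; exact hv) huv).1 h
        rwa [List.append_assoc] at e
      have hn' : ¬Compatible A (l ++ (r ++ [s])) (tau A s u) (tau A s v) := by
        rw [← List.append_assoc]
        exact fun hcomp => hn (Compatible.rotate s _ _ _ hcomp)
      -- Otherwise the rotation makes u equal to -α_s, and the base case of `Compatible` applies.
      have hus : u ≠ simpleRoot s := by
        rintro rfl
        rw [F.tau_simpleRoot] at h' hn'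
        exact hn' (Compatible.neg_left _ _ _ (h'.1 s rfl))
      rw [tau_of_nonneg hu.2] at h' hn' hne
      have := ih (r ++ [s]) _ _ hc' (F.reflection_mem_positiveRoots hu hus)
        (F.tau_mem (Finset.mem_univ s) hv) hne h' hn'
      simpa [List.append_assoc, wordAction] using this
  by_contra hn
  rcases hu with ⟨hu, -⟩ | ⟨i, -, rfl⟩
  swap
  · exact hn (Compatible.neg_left _ _ _ (h.1 i rfl))
  obtain ⟨k, hk⟩ := F.exists_iterate_notMem hc u
  have : ∀ k : ℕ, (wordAction A c)^[k] u ∈ positiveRoots A ∧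
      ∃ v, v ∈ parabolicRoots A Finset.univ ∧ (wordAction A c)^[k] u ≠ v ∧
        EulerCompatible A d c ((wordAction A c)^[k] u) v ∧
        ¬Compatible A c ((wordAction A c)^[k] u) v := by
    intro k
    induction k with
    | zero => exact ⟨hu, v, hv, huv, h, hn⟩
    | succ k ih =>
      obtain ⟨h₁, v, h₂, h₃, h₄, h₅⟩ := ih
      rw [Function.iterate_succ_apply']
      have := key c [] _ v (by simpa using hc) h₁ h₂ h₃ (by simpa using h₄) (by simpa using h₅)
      simpa using this
  exact hk (this k).1

theorem compatible_iff {c : List ι} (hc : IsCoxeterWord c) {u v : ι → ℤ}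
    (hu : u ∈ almostPositiveRoots A) (hv : v ∈ almostPositiveRoots A) (huv : u ≠ v) :
    Compatible A c u v ↔ EulerCompatible A d c u v := by
  rw [← parabolicRoots_univ] at hu hv
  exact ⟨fun h => F.eulerCompatible_of_compatible h hc hu hv huv,
    F.compatible_of_eulerCompatible hc hu hv huv⟩

end IsFiniteType

end Compatibility

end GammaTriangle

namespace GammaTriangle

set_option linter.unusedSectionVars false

/-! ## Independence of the Coxeter element -/

section Words

variable {ι : Type*}

/-- The moves that relate the words of the Coxeter elements: rotations and exchanges of adjacent
commuting letters. -/
inductive Move (A : Matrix ι ι ℤ) : List ι → List ι → Prop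
  | rotate (s : ι) (c : List ι) : Move A (s :: c) (c ++ [s])
  | swap (a : List ι) (p q : ι) (b : List ι) : A p q = 0 → A q p = 0 →
      Move A (a ++ p :: q :: b) (a ++ q :: p :: b)

variable {A : Matrix ι ι ℤ}

open Relation in
theorem perm_of_eqvGen_move {c c' : List ι} (h : EqvGen (Move A) c c') : c.Perm c' := by
  induction h with
  | rel c c' h =>
    cases h with
    | rotate s c => exact (List.perm_append_singleton s c).symm
    | swap a p q b => exact List.Perm.append_left a (List.Perm.swap q p b)
  | refl => exact List.Perm.refl _
  | symm _ _ _ ih => exact ih.symm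
  | trans _ _ _ _ _ ih₁ ih₂ => exact ih₁.trans ih₂

open Relation in
theorem eqvGen_rotate (a b : List ι) : EqvGen (Move A) (a ++ b) (b ++ a) := by
  induction a generalizing b with
  | nil => simpa using EqvGen.refl b
  | cons s a ih =>
    have h : EqvGen (Move A) (a ++ b ++ [s]) (b ++ s :: a) := by simpa using ih (b ++ [s])
    exact (EqvGen.rel _ _ (Move.rotate s (a ++ b))).trans _ _ _ h

open Relation in
theorem eqvGen_commute (a : List ι) (s : ι) (b : List ι) (h : ∀ t ∈ b, A s t = 0 ∧ A t s = 0) :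
    EqvGen (Move A) (a ++ s :: b) (a ++ b ++ [s]) := by
  induction b generalizing a with
  | nil => simpa using EqvGen.refl (a ++ [s])
  | cons t b ih =>
    have ht := h t (by simp)
    have := ih (a ++ [t]) fun t' ht' => h t' (by simp [ht'])
    rw [List.append_assoc a [t] b, List.append_assoc a [t], List.singleton_append,
      List.singleton_append] at this
    exact (EqvGen.rel _ _ (Move.swap a s t b ht.1 ht.2)).trans _ _ _ this

variable [LinearOrder ι]

-- The hypothesis `hleaf` says that each vertex has at most one smaller neighbour, so l is a leaf or
-- isolated. Either l commutes with the letter s being rotated, or it commutes with all others.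
open Relation in
theorem eqvGen_cons (hA : ∀ i j, A i j = 0 → A j i = 0)
    (hleaf : ∀ i j k, j < i → k < i → A i j ≠ 0 → A i k ≠ 0 → j = k) {l : ι} {c c' : List ι}
    (h : EqvGen (Move A) c c') (hc : c.Nodup) (hl : ∀ i ∈ c, i < l) :
    EqvGen (Move A) (l :: c) (l :: c') := by
  induction h with
  | rel c c' h =>
    cases h with
    | rotate s c =>
      have hs : s < l := hl s (by simp)
      by_cases h₀ : A l s = 0
      · exact (EqvGen.rel _ _ (Move.swap [] l s c h₀ (hA _ _ h₀))).trans _ _ _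
          (EqvGen.rel _ _ (Move.rotate s (l :: c)))
      · have hcomm : ∀ t ∈ c, A l t = 0 ∧ A t l = 0 := by
          intro t ht
          have : A l t = 0 := by
            by_contra h₁
            have := hleaf l s t hs (hl t (by simp [ht])) h₀ h₁
            exact (List.nodup_cons.1 hc).1 (this ▸ ht)
          exact ⟨this, hA _ _ this⟩
        -- Here s is the only neighbour of l: l is rotated to the end, commuted back through c to
        -- stand after s, and then s is rotated.
        have h₁ : EqvGen (Move A) (l :: s :: c) (s :: c ++ [l]) :=
          EqvGen.rel _ _ (Move.rotate l (s :: c))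
        have h₂ : EqvGen (Move A) (s :: c ++ [l]) (s :: l :: c) := by
          have := (eqvGen_commute [s] l c hcomm).symm
          simpa using this
        exact h₁.trans _ _ _ (h₂.trans _ _ _ (EqvGen.rel _ _ (Move.rotate s (l :: c))))
    | swap a p q b h₁ h₂ => exact EqvGen.rel _ _ (Move.swap (l :: a) p q b h₁ h₂)
  | refl => exact EqvGen.refl _
  | symm c c' h ih =>
    have hp := perm_of_eqvGen_move h
    exact (ih (hp.nodup_iff.2 hc) fun i hi => hl i (hp.mem_iff.1 hi)).symm
  | trans c c' c'' h _ ih₁ ih₂ =>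
    have hp := perm_of_eqvGen_move h
    exact (ih₁ hc hl).trans _ _ _
      (ih₂ (hp.nodup_iff.1 hc) fun i hi => hl i (hp.mem_iff.2 hi))

open Relation in
/-- For a forest, all Coxeter words are related by moves. -/
theorem eqvGen_move (hA : ∀ i j, A i j = 0 → A j i = 0)
    (hleaf : ∀ i j k, j < i → k < i → A i j ≠ 0 → A i k ≠ 0 → j = k) (J : Finset ι) :
    ∀ c c' : List ι, c.Nodup → c'.Nodup → c.toFinset = J → c'.toFinset = J →
      EqvGen (Move A) c c' := by
  induction J using Finset.induction_on_max with
  | empty =>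
    intro c c' _ _ h h'
    rw [List.toFinset_eq_empty_iff] at h h'
    rw [h, h']
    exact EqvGen.refl _
  | insert l J hl ih =>
    have front : ∀ c : List ι, c.Nodup → c.toFinset = insert l J → ∃ c₁ : List ι, c₁.Nodup ∧
        c₁.toFinset = J ∧ EqvGen (Move A) c (l :: c₁) := by
      intro c hc hcJ
      have hmem : l ∈ c := by
        rw [← List.mem_toFinset, hcJ]; exact Finset.mem_insert_self _ _
      obtain ⟨a, b, rfl⟩ := List.append_of_mem hmem
      -- The largest letter is rotated to the front, so only words on the smaller letters remain to
      -- be compared.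
      have hE : EqvGen (Move A) (a ++ l :: b) (l :: (b ++ a)) := eqvGen_rotate a (l :: b)
      have hp := perm_of_eqvGen_move hE
      have hn := hp.nodup_iff.1 hc
      refine ⟨b ++ a, (List.nodup_cons.1 hn).2, ?_, hE⟩
      have hlJ : l ∉ J := fun h => lt_irrefl _ (hl l h)
      have : insert l (b ++ a).toFinset = insert l J := by
        rw [← hcJ, ← List.toFinset_cons]
        exact (List.toFinset_eq_of_perm _ _ hp).symm
      have hl' : l ∉ (b ++ a).toFinset := by simpa using (List.nodup_cons.1 hn).1
      rw [← Finset.erase_insert hl', this, Finset.erase_insert hlJ]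
    intro c c' hc hc' h h'
    obtain ⟨c₁, hn₁, hJ₁, hE₁⟩ := front c hc h
    obtain ⟨c₂, hn₂, hJ₂, hE₂⟩ := front c' hc' h'
    refine hE₁.trans _ _ _ (EqvGen.trans _ _ _ ?_ hE₂.symm)
    refine eqvGen_cons hA hleaf (ih _ _ hn₁ hn₂ hJ₁ hJ₂) hn₁ fun i hi => hl i ?_
    rw [← hJ₁]
    simpa using hi

end Words

/-! ### Face polynomials do not depend on the Coxeter word. -/

section Independence

variable {ι : Type*} [Fintype ι] [DecidableEq ι] {A : Matrix ι ι ℤ} {d : ι → ℤ}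
variable {R : Type*} [CommRing R]

theorem euler_swap {p q : ι} (h₁ : A p q = 0) (h₂ : A q p = 0) (a b : List ι) (u v : ι → ℤ) :
    euler A d (a ++ p :: q :: b) u v = euler A d (a ++ q :: p :: b) u v := by
  have e : ∀ f : ι → ℤ, ((p :: q :: b).map f).sum = ((q :: p :: b).map f).sum := fun f => by
    simp only [List.map_cons, List.sum_cons]; ring
  rw [euler_append, euler_append]
  simp only [e]
  congr 2
  simp only [euler, List.map_cons, List.sum_cons, h₁, h₂]
  ring

theorem euler_filter (c : List ι) (p : ι → Bool) {u v : ι → ℤ} (hu : ∀ i, p i = false → u i = 0)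
    (hv : ∀ i, p i = false → v i = 0) : euler A d (c.filter p) u v = euler A d c u v := by
  have hs : ∀ (c : List ι) (f : ι → ℤ), ((c.filter p).map fun j => f j * v j).sum =
      (c.map fun j => f j * v j).sum := by
    intro c f
    induction c with
    | nil => rfl
    | cons s c ih =>
      by_cases h : p s
      · simp [List.filter_cons_of_pos h, ih]
      · simp [List.filter_cons_of_neg h, ih, hv s (by simpa using h)]
  induction c with
  | nil => rfl
  | cons s c ih =>
    by_cases h : p s
    · rw [List.filter_cons_of_pos h, euler, euler, ih, hs]
    · rw [List.filter_cons_of_neg h, euler, ih, hu s (by simpa using h)]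
      ring

namespace IsFiniteType

variable (F : IsFiniteType A d)

open Classical in
/-- The positive roots supported in `J`. -/
noncomputable def posFinset (J : Finset ι) : Finset (ι → ℤ) :=
  F.finite_positiveRoots.toFinset.filter fun v => ∀ i, i ∉ J → v i = 0

theorem mem_posFinset {J : Finset ι} {v : ι → ℤ} :
    v ∈ F.posFinset J ↔ v ∈ positiveRoots A ∧ ∀ i, i ∉ J → v i = 0 := by
  simp [posFinset]

open Classical in
/-- The almost positive roots of the standard parabolic subsystem `J`. -/
noncomputable def rootFinset (J : Finset ι) : Finset (ι → ℤ) :=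
  F.posFinset J ∪ J.image fun i => -simpleRoot i

theorem mem_rootFinset {J : Finset ι} {v : ι → ℤ} :
    v ∈ F.rootFinset J ↔ v ∈ parabolicRoots A J := by
  simp only [rootFinset, Finset.mem_union, mem_posFinset, Finset.mem_image, parabolicRoots,
    Set.mem_union, Set.mem_ofPred_eq, eq_comm]

theorem coe_rootFinset (J : Finset ι) : (F.rootFinset J : Set (ι → ℤ)) = parabolicRoots A J :=
  Set.ext fun _ => F.mem_rootFinset

/-- The face polynomial of the positive part of the cluster complex of the subsystem `J`. -/
noncomputable def posPoly (c : List ι) (x : R) (J : Finset ι) : R :=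
  cliquePoly (EulerCompatible A d c) (fun _ => x) (F.posFinset J)

open Classical in
/-- The weight `x` on positive roots and `u` on negative simple roots. -/
noncomputable def _root_.GammaTriangle.rootWeight (x u : R) (v : ι → ℤ) : R :=
  if 0 ≤ v then x else u

/-- The face polynomial of the cluster complex of the subsystem `J`. -/
noncomputable def rootPoly (c : List ι) (x u : R) (J : Finset ι) : R :=
  cliquePoly (EulerCompatible A d c) (rootWeight x u) (F.rootFinset J)

theorem rootWeight_neg (x u : R) (i : ι) : rootWeight x u (-simpleRoot i) = u :=
  if_neg (not_nonneg_neg_simpleRoot i)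

/-- A face is sorted by the set T of its negative simple roots. They are pairwise compatible, and
their link among the positive roots is the positive part for J \ T. -/
theorem rootPoly_eq_sum (c : List ι) (x u : R) (J : Finset ι) :
    F.rootPoly c x u J = ∑ T ∈ J.powerset, u ^ T.card * F.posPoly c x (J \ T) := by
  classical
  have hinj : Function.Injective fun i : ι => -simpleRoot i := fun i j h =>
    neg_simpleRoot_inj.1 h
  have hU : F.rootPoly c x u J = _ := Eq.trans (by rw [rootPoly, rootFinset]; congr!)
    (cliquePoly_union_clique (r := EulerCompatible A d c) (fun _ _ h => h.symm) (rootWeight x u)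
      (F.posFinset J) (J.image fun i => -simpleRoot i) ?_ ?_)
  rw [hU]
  · rw [Finset.powerset_image, Finset.sum_image fun a _ b _ h => Finset.image_injective hinj h]
    refine Finset.sum_congr rfl fun T hT => ?_
    rw [Finset.mem_powerset] at hT
    rw [Finset.prod_image fun a _ b _ h => hinj h]
    simp only [rootWeight_neg, Finset.prod_const]
    congr 1
    have e : (F.posFinset J).filter (fun v => ∀ t ∈ T.image fun i => -simpleRoot i,
        EulerCompatible A d c t v) = F.posFinset (J \ T) := by
      ext v
      simp only [Finset.mem_filter, mem_posFinset, Finset.forall_mem_image, Finset.mem_sdiff]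
      constructor
      · rintro ⟨⟨h₁, h₂⟩, h₃⟩
        refine ⟨h₁, fun i hi => ?_⟩
        by_cases hiJ : i ∈ J
        · by_cases hiT : i ∈ T
          · exact (h₃ hiT).1 i rfl
          · exact absurd ⟨hiJ, hiT⟩ hi
        · exact h₂ i hiJ
      · rintro ⟨h₁, h₂⟩
        refine ⟨⟨h₁, fun i hi => h₂ i fun h => hi h.1⟩, fun i hi => ?_⟩
        rw [eulerCompatible_neg_iff (ne_neg_simpleRoot h₁.2 i)]
        exact h₂ i fun h => h.2 hi
    have e' : cliquePoly (EulerCompatible A d c) (rootWeight x u) (F.posFinset (J \ T)) =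
        F.posPoly c x (J \ T) := cliquePoly_congr (fun _ _ _ _ _ => Iff.rfl) fun v hv =>
      if_pos ((F.mem_posFinset.1 hv).1.2)
    rw [← e', ← e]
    congr!
  · intro a ha b hb hab
    simp only [Finset.coe_image, Set.mem_image, Finset.mem_coe] at ha hb
    obtain ⟨i, -, rfl⟩ := ha
    obtain ⟨j, -, rfl⟩ := hb
    rw [eulerCompatible_neg_iff hab.symm]
    have : i ≠ j := fun h => hab (by rw [h])
    simp [simpleRoot_of_ne this]
  · rw [Finset.disjoint_left]
    intro v hv h
    simp only [Finset.mem_image] at h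
    obtain ⟨i, -, rfl⟩ := h
    exact not_nonneg_neg_simpleRoot i (F.mem_posFinset.1 hv).1.2

/-- A rotation acts by the bijection τ_s, which exchanges α_s and -α_s; this is why both weights
must equal x. Commuting letters leave the Euler form unchanged. -/
theorem rootPoly_move {c c' : List ι} (h : Move A c c') (hc : c.Nodup) (x : R) :
    F.rootPoly c x x c.toFinset = F.rootPoly c' x x c.toFinset := by
  classical
  have hw : (rootWeight x x : (ι → ℤ) → R) = fun _ => x := funext fun v => by simp [rootWeight]
  rw [rootPoly, rootPoly, hw]
  cases h with
  | rotate s c =>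
    have himg : (F.rootFinset (s :: c).toFinset).image (tau A s) =
        F.rootFinset (s :: c).toFinset := by
      refine Finset.eq_of_subset_of_card_le ?_ ?_
      · refine Finset.image_subset_iff.2 fun v hv => F.mem_rootFinset.2 ?_
        exact F.tau_mem (by simp) (F.mem_rootFinset.1 hv)
      · rw [Finset.card_image_of_injOn]
        rw [F.coe_rootFinset]
        exact F.tau_injOn _ s
    rw [cliquePoly_image (r' := EulerCompatible A d (c ++ [s])) (w' := fun _ => x) (f := tau A s)]
    · congr 1
      convert himg
    · rw [F.coe_rootFinset]
      exact F.tau_injOn _ s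
    · intro a ha b hb hab
      exact F.eulerCompatible_rotate hc (F.mem_rootFinset.1 ha) (F.mem_rootFinset.1 hb) hab
    · exact fun _ _ => rfl
  | swap a p q b h₁ h₂ =>
    refine cliquePoly_congr (fun u _ v _ _ => ?_) fun _ _ => rfl
    simp only [EulerCompatible, euler_swap h₁ h₂]

theorem rootPoly_eqvGen {c c' : List ι} (h : Relation.EqvGen (Move A) c c') (hc : c.Nodup)
    (x : R) : F.rootPoly c x x c.toFinset = F.rootPoly c' x x c.toFinset := by
  induction h with
  | rel c c' h => exact F.rootPoly_move h hc x
  | refl => rfl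
  | symm c c' h ih =>
    have hp := perm_of_eqvGen_move h
    rw [← List.toFinset_eq_of_perm _ _ hp, ih (hp.nodup_iff.2 hc)]
  | trans c c' c'' h _ ih₁ ih₂ =>
    have hp := perm_of_eqvGen_move h
    rw [ih₁ hc, List.toFinset_eq_of_perm _ _ hp, ih₂ (hp.nodup_iff.1 hc)]

theorem posPoly_filter (c : List ι) (x : R) (J : Finset ι) :
    F.posPoly (c.filter fun i => decide (i ∈ J)) x J = F.posPoly c x J := by
  have h₀ : ∀ v ∈ F.posFinset J, ∀ i, decide (i ∈ J) = false → v i = 0 := fun v hv i hi =>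
    (F.mem_posFinset.1 hv).2 i (by simpa using hi)
  refine cliquePoly_congr (fun u hu v hv _ => ?_) fun _ _ => rfl
  simp only [EulerCompatible, euler_filter c _ (h₀ u hu) (h₀ v hv),
    euler_filter c _ (h₀ v hv) (h₀ u hu)]

/-- The face polynomials of the positive parts do not depend on the Coxeter element. -/
theorem posPoly_eq
    (hmove : ∀ c c' : List ι, c.Nodup → c'.Nodup → c.toFinset = c'.toFinset →
      Relation.EqvGen (Move A) c c') {c c' : List ι} (hc : IsCoxeterWord c)
    (hc' : IsCoxeterWord c') (x : R) (J : Finset ι) : F.posPoly c x J = F.posPoly c' x J := by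
  induction J using Finset.strongInduction with
  | H J ih =>
    have hJ : ∀ c : List ι, IsCoxeterWord c →
        (c.filter fun i => decide (i ∈ J)).toFinset = J := by
      intro c hc
      ext i
      simp [hc.2 i]
    have h := F.rootPoly_eqvGen (hmove (c.filter fun i => decide (i ∈ J))
      (c'.filter fun i => decide (i ∈ J)) (hc.1.filter _) (hc'.1.filter _)
      (by rw [hJ c hc, hJ c' hc'])) (hc.1.filter _) x
    rw [hJ c hc, F.rootPoly_eq_sum, F.rootPoly_eq_sum] at h
    have sub : ∀ (c : List ι) (T : Finset ι), F.posPoly (c.filter fun i => decide (i ∈ J)) x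
        (J \ T) = F.posPoly c x (J \ T) := by
      intro c T
      rw [← F.posPoly_filter, ← F.posPoly_filter c, List.filter_filter]
      congr 1
      refine List.filter_congr fun i _ => ?_
      simp only [Finset.mem_sdiff]
      by_cases i ∈ J <;> simp [*]
    simp only [sub] at h
    -- The term T = ∅ is the positive part for J; the others belong to proper subsets and agree by
    -- induction.
    rw [← Finset.add_sum_erase _ _ (Finset.empty_mem_powerset J),
      ← Finset.add_sum_erase _ _ (Finset.empty_mem_powerset J)] at h
    have e : ∀ T ∈ J.powerset.erase ∅, x ^ T.card * F.posPoly c x (J \ T) =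
        x ^ T.card * F.posPoly c' x (J \ T) := by
      intro T hT
      rw [Finset.mem_erase, Finset.mem_powerset] at hT
      rw [ih (J \ T) (Finset.sdiff_ssubset hT.2 (Finset.nonempty_iff_ne_empty.2 hT.1))]
    rw [Finset.sum_congr rfl e] at h
    simpa using add_right_cancel h

end IsFiniteType

end Independence

end GammaTriangle

namespace GammaTriangle

set_option linter.unusedSectionVars false

/-! ## Step functions and the quadratic form `∑ (F (i + 1) - F i) ^ 2` -/

/-- The indicator function of `{i | k ≤ i}`. -/
def step (k i : ℕ) : ℤ := if k ≤ i then 1 else 0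

/-- The Euler form of type `B` on functions on `{0, …, M}`. -/
def stepForm (M : ℕ) (F G : ℕ → ℤ) : ℤ :=
  F M * G M - 2 * ∑ i ∈ Finset.range M, F i * (G (i + 1) - G i)

theorem stepForm_add_left (M : ℕ) (F F' G : ℕ → ℤ) :
    stepForm M (F + F') G = stepForm M F G + stepForm M F' G := by
  simp only [stepForm, Pi.add_apply, add_mul, Finset.sum_add_distrib]
  ring

theorem stepForm_add_right (M : ℕ) (F G G' : ℕ → ℤ) :
    stepForm M F (G + G') = stepForm M F G + stepForm M F G' := by
  have : ∀ i, F i * ((G + G') (i + 1) - (G + G') i) =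
      F i * (G (i + 1) - G i) + F i * (G' (i + 1) - G' i) := fun i => by
    simp only [Pi.add_apply]; ring
  simp only [stepForm, this, Finset.sum_add_distrib]
  simp only [Pi.add_apply]
  ring

theorem stepForm_sub_left (M : ℕ) (F F' G : ℕ → ℤ) :
    stepForm M (F - F') G = stepForm M F G - stepForm M F' G := by
  rw [eq_sub_iff_add_eq, ← stepForm_add_left, sub_add_cancel]

theorem stepForm_sub_right (M : ℕ) (F G G' : ℕ → ℤ) :
    stepForm M F (G - G') = stepForm M F G - stepForm M F G' := by
  rw [eq_sub_iff_add_eq, ← stepForm_add_right, sub_add_cancel]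

theorem stepForm_congr {M : ℕ} {F F' G G' : ℕ → ℤ} (h : ∀ i ≤ M, F i = F' i)
    (h' : ∀ i ≤ M, G i = G' i) : stepForm M F G = stepForm M F' G' := by
  rw [stepForm, stepForm, h M le_rfl, h' M le_rfl]
  congr 2
  refine Finset.sum_congr rfl fun i hi => ?_
  rw [Finset.mem_range] at hi
  rw [h i hi.le, h' i hi.le, h' (i + 1) hi]

/-- In the simple root coordinates of type B the vector e_k is `step k`. The form takes only the
values ±1 on these vectors, so compatibility becomes a matter of comparing indices. -/
theorem stepForm_step {M k l : ℕ} (hk : k ≤ M) (hl : l ≤ M) :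
    stepForm M (step k) (step l) = if l ≤ k then 1 else -1 := by
  have h : ∑ i ∈ Finset.range M, step k i * (step l (i + 1) - step l i) =
      if l ≤ k then 0 else 1 := by
    rcases l with _ | l
    · simp [step]
    · have : ∀ i, step k i * (step (l + 1) (i + 1) - step (l + 1) i) =
          if i = l then step k l else 0 := by
        intro i
        simp only [step]
        split_ifs <;> omega
      simp only [this]
      rw [Finset.sum_ite_eq', if_pos (by simpa using hl)]
      simp only [step]
      split_ifs <;> omega
  rw [stepForm, h]
  simp only [step, if_pos hk, if_pos hl]
  split_ifs <;> simp

/-- The norm is the sum of the squared jumps, counting the jump from 0 to F 0. Hence norm 1 means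
one unit jump and norm 2 means two. -/
theorem stepForm_self (M : ℕ) (F : ℕ → ℤ) :
    stepForm M F F = F 0 ^ 2 + ∑ i ∈ Finset.range M, (F (i + 1) - F i) ^ 2 := by
  induction M with
  | zero => simp [stepForm, sq]
  | succ M ih =>
    rw [Finset.sum_range_succ, ← add_assoc, ← ih]
    simp only [stepForm, Finset.sum_range_succ]
    ring

theorem stepForm_self_succ (M : ℕ) (F : ℕ → ℤ) :
    stepForm (M + 1) F F = stepForm M F F + (F (M + 1) - F M) ^ 2 := by
  rw [stepForm_self, stepForm_self, Finset.sum_range_succ, add_assoc]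

theorem stepForm_self_nonneg (M : ℕ) (F : ℕ → ℤ) : 0 ≤ stepForm M F F := by
  rw [stepForm_self]
  exact add_nonneg (sq_nonneg _) (Finset.sum_nonneg fun _ _ => sq_nonneg _)

theorem eq_zero_of_stepForm_self {M : ℕ} {F : ℕ → ℤ} (h : stepForm M F F = 0) :
    ∀ i ≤ M, F i = 0 := by
  induction M with
  | zero =>
    intro i hi
    obtain rfl : i = 0 := by omega
    simpa [stepForm] using h
  | succ M ih =>
    have h₁ := stepForm_self_nonneg M F
    have h₂ := sq_nonneg (F (M + 1) - F M)
    rw [stepForm_self_succ] at h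
    have h₃ := ih (by omega)
    have h₄ : F (M + 1) - F M = 0 := pow_eq_zero_iff (two_ne_zero) |>.1 (by omega)
    intro i hi
    rcases hi.eq_or_lt with rfl | hi
    · rw [sub_eq_zero.1 h₄, h₃ M le_rfl]
    · exact h₃ i (by omega)

theorem int_sq_le_two {w : ℤ} (h : w ^ 2 ≤ 2) : w = 0 ∨ w = 1 ∨ w = -1 := by
  have h₁ : w ≤ 1 := by nlinarith
  have h₂ : -1 ≤ w := by nlinarith
  omega

theorem exists_of_stepForm_self_eq_one {M : ℕ} {F : ℕ → ℤ} (h : stepForm M F F = 1) :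
    ∃ k ≤ M, ∃ e : ℤ, (e = 1 ∨ e = -1) ∧ ∀ i ≤ M, F i = e * step k i := by
  induction M with
  | zero =>
    refine ⟨0, le_rfl, F 0, ?_, fun i hi => ?_⟩
    · have h₀ : F 0 * F 0 = 1 := by simpa [stepForm] using h
      have := int_sq_le_two (w := F 0) (by nlinarith)
      rcases this with h₁ | h₁
      · rw [h₁] at h₀; simp at h₀
      · exact h₁
    · obtain rfl : i = 0 := by omega
      simp [step]
  | succ M ih =>
    have h₁ := stepForm_self_nonneg M F
    rw [stepForm_self_succ] at h
    rcases int_sq_le_two (w := F (M + 1) - F M) (by omega) with h₂ | h₂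
    · rw [h₂] at h
      obtain ⟨k, hk, e, he, hF⟩ := ih (by linarith)
      refine ⟨k, by omega, e, he, fun i hi => ?_⟩
      rcases hi.eq_or_lt with rfl | hi
      · rw [sub_eq_zero.1 h₂, hF M le_rfl]
        simp [step, hk, show k ≤ M + 1 by omega]
      · exact hF i (by omega)
    · have h₃ : stepForm M F F = 0 := by
        rcases h₂ with h₂ | h₂ <;> rw [h₂] at h <;> linarith
      have h₄ := eq_zero_of_stepForm_self h₃
      rw [h₄ M le_rfl, sub_zero] at h₂
      refine ⟨M + 1, le_rfl, F (M + 1), h₂, fun i hi => ?_⟩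
      rcases hi.eq_or_lt with rfl | hi
      · simp [step]
      · rw [h₄ i (by omega)]
        simp [step, show ¬M + 1 ≤ i by omega]

theorem exists_of_stepForm_self_eq_two {M : ℕ} {F : ℕ → ℤ} (h : stepForm M F F = 2) :
    ∃ k l, k < l ∧ l ≤ M ∧ ∃ e e' : ℤ, (e = 1 ∨ e = -1) ∧ (e' = 1 ∨ e' = -1) ∧
      ∀ i ≤ M, F i = e * step k i + e' * step l i := by
  induction M with
  | zero =>
    exfalso
    have h₀ : F 0 * F 0 = 2 := by simpa [stepForm] using h
    rcases int_sq_le_two (w := F 0) (by nlinarith) with h₁ | h₁ | h₁ <;> rw [h₁] at h₀ <;>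
      norm_num at h₀
  | succ M ih =>
    rw [stepForm_self_succ] at h
    have h₁ := stepForm_self_nonneg M F
    rcases int_sq_le_two (w := F (M + 1) - F M) (by omega) with h₂ | h₂
    · rw [h₂] at h
      obtain ⟨k, l, hk, hl, e, e', he, he', hF⟩ := ih (by linarith)
      refine ⟨k, l, hk, by omega, e, e', he, he', fun i hi => ?_⟩
      rcases hi.eq_or_lt with rfl | hi
      · rw [sub_eq_zero.1 h₂, hF M le_rfl]
        simp [step, hl, show k ≤ M by omega, show k ≤ M + 1 by omega, show l ≤ M + 1 by omega]
      · exact hF i (by omega)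
    · have h₃ : stepForm M F F = 1 := by
        rcases h₂ with h₂ | h₂ <;> rw [h₂] at h <;> linarith
      obtain ⟨k, hk, e, he, hF⟩ := exists_of_stepForm_self_eq_one h₃
      refine ⟨k, M + 1, by omega, le_rfl, e, F (M + 1) - F M, he, h₂, fun i hi => ?_⟩
      rcases hi.eq_or_lt with rfl | hi
      · rw [hF M le_rfl]
        simp [step, hk, show k ≤ M + 1 by omega]
      · rw [hF i (by omega)]
        simp [step, show ¬M + 1 ≤ i by omega]

/-! ### Vertices of the model as step functions. -/

namespace Vtx

/-- The positive root, or the negative simple root, of a vertex of type `B`. -/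
def profile : Vtx → ℕ → ℤ
  | minus a b => step a - step b
  | plus k l => step k + step l
  | single k _ => step k
  | neg i => fun j => if j = i then -1 else 0
  | leg _ => 0

/-- The vertices that stand for positive roots. -/
def Positive (t : Bool) : Vtx → Prop
  | minus a b => a < b
  | plus k l => k < l
  | single _ e => t = true → e = true
  | _ => False

/-- The last coordinate of a root of type `D` in an orthonormal basis. -/
def spin : Vtx → ℤ
  | single _ e => if e = true then 1 else -1
  | _ => 0

theorem profile_nonneg {t : Bool} {v : Vtx} (hv : v.Positive t) (i : ℕ) : 0 ≤ profile v i := by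
  rcases v with i | e | ⟨a, b⟩ | ⟨a, b⟩ | ⟨i, e⟩ <;>
    simp only [Positive] at hv <;> simp only [profile, step, Pi.add_apply, Pi.sub_apply] <;>
    split_ifs <;> omega

theorem stepForm_profile_rel {M : ℕ} {v w : Vtx} (hv : v.Positive true) (hw : w.Positive true)
    (hv' : Bdd (M + 1) v) (hw' : Bdd (M + 1) w) (h : v ≠ w) :
    (0 ≤ stepForm M (profile v) (profile w) ∧ 0 ≤ stepForm M (profile w) (profile v)) ↔
      Rel true v w := by
  rcases v with i | e | ⟨a, b⟩ | ⟨a, b⟩ | ⟨i, e⟩ <;>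
  rcases w with i' | e' | ⟨c, d⟩ | ⟨c, d⟩ | ⟨j, e'⟩ <;>
    simp only [Positive, Bdd, Order.lt_add_one_iff, forall_const] at hv hw hv' hw' <;>
    simp only [profile, Rel, Bad, stepForm_sub_left, stepForm_sub_right, stepForm_add_left,
      stepForm_add_right, stepForm_step, hv, hw, hv', hw', ne_eq, minus.injEq, plus.injEq,
      single.injEq, reduceCtorEq, not_false_eq_true, and_true, true_and, true_or, not_true_eq_false,
      and_false, iff_false] at h ⊢ <;>
    omega

/-- The spin product is ±1 between two singles and 0 otherwise. It corrects the type B form by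
exactly what distinguishes equal from opposite signs. -/
theorem stepForm_profile_rel_spin {M : ℕ} {v w : Vtx} (hv : v.Positive false)
    (hw : w.Positive false) (hv' : Bdd (M + 1) v) (hw' : Bdd (M + 1) w) :
    (0 ≤ stepForm M (profile v) (profile w) + spin v * spin w ∧
      0 ≤ stepForm M (profile w) (profile v) + spin w * spin v) ↔ Rel false v w := by
  rcases v with i | e | ⟨a, b⟩ | ⟨a, b⟩ | ⟨i, _ | _⟩ <;>
  rcases w with i' | e' | ⟨c, d⟩ | ⟨c, d⟩ | ⟨j, _ | _⟩ <;>
    simp only [Positive, Bdd, Order.lt_add_one_iff] at hv hw hv' hw' <;>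
    simp only [profile, Rel, Bad, stepForm_sub_left, stepForm_sub_right, stepForm_add_left,
      stepForm_add_right, stepForm_step, hv', hw', reduceCtorEq, not_false_eq_true, and_true,
      and_false, or_false, false_or, not_true_eq_false, spin, if_true, if_false, mul_zero,
      add_zero, mul_one, mul_neg, neg_neg, ne_eq, true_and, iff_true] <;>
    omega

/-- Evaluating the profiles at the parameters of both vertices recovers the jumps; in type D the
spin separates the two singles at one position. -/
theorem eq_of_profile_eq {t : Bool} {M : ℕ} {v w : Vtx} (hv : v.Positive t) (hw : w.Positive t)
    (hv' : Bdd (M + 1) v) (hw' : Bdd (M + 1) w) (h : ∀ i ≤ M, profile v i = profile w i)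
    (hs : t = false → spin v = spin w) : v = w := by
  rcases v with i | e | ⟨a, b⟩ | ⟨a, b⟩ | ⟨i, e⟩ <;>
  rcases w with i' | e' | ⟨c, d⟩ | ⟨c, d⟩ | ⟨j, e'⟩ <;>
    simp only [Positive, Bdd, Order.lt_add_one_iff] at hv hw hv' hw' <;>
    simp only [profile, step, Pi.sub_apply, Pi.add_apply] at h
  · have h₁ := h a hv'.1
    have h₂ := h b hv'.2
    have h₃ := h c hw'.1
    have h₄ := h d hw'.2
    rw [minus.injEq]
    omega
  · have h₂ := h b hv'.2
    have h₃ := h c hw'.1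
    have h₄ := h d hw'.2
    omega
  · have h₂ := h b hv'.2
    have h₃ := h j hw'
    omega
  · have h₁ := h a hv'.1
    have h₂ := h b hv'.2
    have h₄ := h d hw'.2
    omega
  · have h₁ := h a hv'.1
    have h₂ := h b hv'.2
    have h₃ := h c hw'.1
    have h₄ := h d hw'.2
    rw [plus.injEq]
    omega
  · have h₁ := h a hv'.1
    have h₂ := h b hv'.2
    have h₃ := h j hw'
    omega
  · have h₁ := h i hv'
    have h₄ := h d hw'.2
    omega
  · have h₁ := h i hv'
    have h₃ := h c hw'.1
    have h₄ := h d hw'.2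
    omega
  · have h₁ := h i hv'
    have h₃ := h j hw'
    have hij : i = j := by omega
    rw [single.injEq]
    refine ⟨hij, ?_⟩
    cases t
    · have := hs rfl
      revert this
      cases e <;> cases e' <;> simp [spin]
    · rw [hv rfl, hw rfl]

theorem profile_eq_zero_iff {t : Bool} {i : ℕ} {w : Vtx} (hw : (∃ j, w = neg j ∧ j ≠ i) ∨
    (∃ e, w = leg e) ∨ w.Positive t) : profile w i = 0 ↔ Rel t (neg i) w := by
  rcases w with j | e | ⟨a, b⟩ | ⟨a, b⟩ | ⟨j, e⟩ <;>
    simp [Positive, profile, Rel, Bad, step] at hw ⊢ <;> omega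

end Vtx

end GammaTriangle

namespace GammaTriangle

set_option linter.unusedSectionVars false

/-! ## Type `B` -/

/-! ### The Euler form of the linear word. -/

section FinRange

variable {n : ℕ} {A : Matrix (Fin n) (Fin n) ℤ} {d : Fin n → ℤ}

/-- The extension of a vector by zero. -/
def extend (v : Fin n → ℤ) (k : ℕ) : ℤ := if h : k < n then v ⟨k, h⟩ else 0

@[simp] theorem extend_val (v : Fin n → ℤ) (i : Fin n) : extend v i = v i := by simp [extend]

theorem extend_of_lt (v : Fin n → ℤ) {k : ℕ} (h : k < n) : extend v k = v ⟨k, h⟩ := dif_pos h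

theorem extend_of_le (v : Fin n → ℤ) {k : ℕ} (h : n ≤ k) : extend v k = 0 :=
  dif_neg (by omega)

theorem extend_neg (v : Fin n → ℤ) (k : ℕ) : extend (-v) k = -extend v k := by
  simp only [extend]
  split_ifs <;> simp

theorem euler_eq_sum (u v : Fin n → ℤ) : euler A d (List.finRange n) u v =
    ∑ i, u i * (d i * v i + ∑ j, if i < j then A i j * d j * v j else 0) := by
  have key : ∀ c : List (Fin n), c.Pairwise (· < ·) → euler A d c u v =
      (c.map fun i => u i * (d i * v i +
        (c.map fun j => if i < j then A i j * d j * v j else 0).sum)).sum := by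
    intro c hc
    induction c with
    | nil => rfl
    | cons s c ih =>
      rw [List.pairwise_cons] at hc
      have h₁ : (c.map fun j => if s < j then A s j * d j * v j else 0) =
          c.map fun j => A s j * d j * v j :=
        List.map_congr_left fun j hj => if_pos (hc.1 j hj)
      have h₂ : (c.map fun i => u i * (d i * v i +
          ((s :: c).map fun j => if i < j then A i j * d j * v j else 0).sum)) =
          c.map fun i => u i * (d i * v i +
          (c.map fun j => if i < j then A i j * d j * v j else 0).sum) :=
        List.map_congr_left fun i hi => by
          rw [List.map_cons, List.sum_cons, if_neg (hc.1 i hi).asymm, zero_add]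
      rw [List.map_cons, List.sum_cons, h₂, ← ih hc.2, List.map_cons, List.sum_cons,
        if_neg (lt_irrefl s), zero_add, h₁, euler]
      ring
  rw [key _ (List.pairwise_lt_finRange n), Fin.sum_univ_def]
  simp only [Fin.sum_univ_def]

theorem euler_finRange {a : ℕ → ℕ → ℤ} {e : ℕ → ℤ}
    (ha : ∀ i j : Fin n, i < j → A i j * d j = a i j) (he : ∀ i : Fin n, d i = e i)
    (u v : Fin n → ℤ) : euler A d (List.finRange n) u v =
      ∑ i ∈ Finset.range n, extend u i * (e i * extend v i +
        ∑ j ∈ Finset.range n, if i < j then a i j * extend v j else 0) := by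
  rw [euler_eq_sum, ← Fin.sum_univ_eq_sum_range]
  refine Finset.sum_congr rfl fun i _ => ?_
  rw [extend_val, extend_val, he, ← Fin.sum_univ_eq_sum_range]
  congr 2
  refine Finset.sum_congr rfl fun j _ => ?_
  simp only [Fin.lt_def, extend_val]
  split_ifs with h
  · rw [ha i j h]
  · rfl

/-- The Euler form keeps half the diagonal and one of the two equal contributions of each
off-diagonal pair. -/
theorem bilin_self (hA : ∀ i, A i i = 2) (hs : ∀ i j, A i j * d j = A j i * d i)
    (v : Fin n → ℤ) : bilin A d v v = 2 * euler A d (List.finRange n) v v := by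
  have h : ∀ i j : Fin n, v i * d i * (v j * A j i) =
      (if i = j then 2 * (v i * (d i * v i)) else 0) +
        (v i * (if i < j then A i j * d j * v j else 0) +
          v j * (if j < i then A j i * d i * v i else 0)) := by
    intro i j
    rcases lt_trichotomy i j with h | h | h
    · rw [if_neg h.ne, if_pos h, if_neg h.asymm, hs]; ring
    · subst h; simp [hA]; ring
    · rw [if_neg h.ne', if_pos h, if_neg h.asymm]; ring
  rw [euler_eq_sum]
  simp only [bilin, pairing, Finset.mul_sum, h, Finset.sum_add_distrib, mul_add]
  rw [Finset.sum_comm (f := fun i j => v j * (if j < i then A j i * d i * v i else 0))]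
  simp only [Finset.sum_ite_eq, Finset.mem_univ, if_true]
  simp only [← Finset.mul_sum]
  ring

end FinRange

namespace TypeB

/-- The symmetrizer of type `B`. -/
def symmetrizer (n : ℕ) (i : Fin n) : ℤ := if i.val + 1 = n then 1 else 2

variable {m : ℕ}

theorem euler_eq (u v : Fin (m + 1) → ℤ) :
    euler (CartanMatrix.B (m + 1)) (symmetrizer (m + 1)) (List.finRange (m + 1)) u v =
      stepForm m (extend u) (extend v) := by
  rw [euler_finRange (a := fun i j => if j = i + 1 then -2 else 0)
    (e := fun i => if i = m then 1 else 2)]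
  · have h : ∀ i, (∑ j ∈ Finset.range (m + 1),
        if i < j then (if j = i + 1 then -2 else 0) * extend v j else 0) =
          -2 * extend v (i + 1) := by
      intro i
      have : ∀ j, (if i < j then (if j = i + 1 then -2 else 0) * extend v j else 0) =
          if j = i + 1 then -2 * extend v (i + 1) else 0 := by
        intro j
        by_cases hj : j = i + 1
        · subst hj; simp
        · simp [hj]
      simp only [this]
      rw [Finset.sum_ite_eq']
      split_ifs with hi
      · rfl
      · rw [extend_of_le v (by simpa using hi), mul_zero]
    simp only [h]
    rw [Finset.sum_range_succ, if_pos rfl, extend_of_le v le_rfl, stepForm, Finset.mul_sum]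
    have : ∀ i ∈ Finset.range m, extend u i * ((if i = m then 1 else 2) * extend v i +
        -2 * extend v (i + 1)) = -(2 * (extend u i * (extend v (i + 1) - extend v i))) := by
      intro i hi
      rw [if_neg (Finset.mem_range.1 hi).ne]
      ring
    rw [Finset.sum_congr rfl this, Finset.sum_neg_distrib]
    ring
  · intro i j h
    have := i.2
    have := j.2
    rw [Fin.lt_def] at h
    simp only [CartanMatrix.B, Matrix.of_apply, symmetrizer, Fin.ext_iff]
    split_ifs <;> omega
  · intro i
    simp [symmetrizer]

theorem cartan_symm (n : ℕ) (i j : Fin n) :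
    CartanMatrix.B n i j * symmetrizer n j = CartanMatrix.B n j i * symmetrizer n i := by
  have := i.2
  have := j.2
  simp only [CartanMatrix.B, Matrix.of_apply, symmetrizer, Fin.ext_iff]
  split_ifs <;> omega

theorem bilin_eq (v : Fin (m + 1) → ℤ) :
    bilin (CartanMatrix.B (m + 1)) (symmetrizer (m + 1)) v v =
      2 * stepForm m (extend v) (extend v) := by
  rw [bilin_self (CartanMatrix.B_diag _) (cartan_symm _), euler_eq]

open Vtx

/-- The root of a vertex. -/
def root (m : ℕ) (v : Vtx) (i : Fin (m + 1)) : ℤ := profile v i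

theorem extend_root {v : Vtx} {i : ℕ} (h : i ≤ m) : extend (root m v) i = profile v i := by
  rw [extend_of_lt _ (by omega), root]

theorem ext_extend {u v : Fin (m + 1) → ℤ} (h : ∀ i ≤ m, extend u i = extend v i) : u = v := by
  funext i
  rw [← extend_val u, ← extend_val v, h i (by omega)]

/-- One jump gives ±e_k; two jumps give ±(e_k + e_l) or ±(e_k - e_l), according to their signs. -/
theorem exists_vertex {v : Fin (m + 1) → ℤ} (h : stepForm m (extend v) (extend v) = 1 ∨
    stepForm m (extend v) (extend v) = 2) :
    ∃ w : Vtx, w.Positive true ∧ Bdd (m + 1) w ∧ (v = root m w ∨ v = -root m w) := by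
  rcases h with h | h
  · obtain ⟨k, hk, e, he, hF⟩ := exists_of_stepForm_self_eq_one h
    refine ⟨single k true, fun _ => rfl, by simp only [Bdd]; omega, ?_⟩
    rcases he with rfl | rfl
    · refine Or.inl (ext_extend fun i hi => ?_)
      rw [hF i hi, extend_root hi]
      simp [profile]
    · refine Or.inr (ext_extend fun i hi => ?_)
      rw [hF i hi, extend_neg, extend_root hi]
      simp [profile]
  · obtain ⟨k, l, hkl, hl, e, e', he, he', hF⟩ := exists_of_stepForm_self_eq_two h
    rcases he with rfl | rfl <;> rcases he' with rfl | rfl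
    · refine ⟨plus k l, hkl, by simp only [Bdd]; omega, Or.inl (ext_extend fun i hi => ?_)⟩
      rw [hF i hi, extend_root hi]
      simp [profile]
    · refine ⟨minus k l, hkl, by simp only [Bdd]; omega, Or.inl (ext_extend fun i hi => ?_)⟩
      rw [hF i hi, extend_root hi]
      simp [profile]
      ring
    · refine ⟨minus k l, hkl, by simp only [Bdd]; omega, Or.inr (ext_extend fun i hi => ?_)⟩
      rw [hF i hi, extend_neg, extend_root hi]
      simp [profile]
      ring
    · refine ⟨plus k l, hkl, by simp only [Bdd]; omega, Or.inr (ext_extend fun i hi => ?_)⟩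
      rw [hF i hi, extend_neg, extend_root hi]
      simp [profile]
      ring

theorem root_nonneg {w : Vtx} (hw : w.Positive true) : 0 ≤ root m w := fun i =>
  profile_nonneg hw i

theorem stepForm_of_bilin {v : Fin (m + 1) → ℤ} (h : ∃ j,
    bilin (CartanMatrix.B (m + 1)) (symmetrizer (m + 1)) v v = 2 * symmetrizer (m + 1) j) :
    stepForm m (extend v) (extend v) = 1 ∨ stepForm m (extend v) (extend v) = 2 := by
  obtain ⟨j, hj⟩ := h
  rw [bilin_eq, symmetrizer] at hj
  split_ifs at hj <;> omega

theorem isFiniteType (n : ℕ) : IsFiniteType (CartanMatrix.B n) (symmetrizer n) := by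
  refine ⟨CartanMatrix.B_diag n, cartan_symm n, fun i => ?_, fun v hv => ?_, fun v hv => ?_, ?_⟩
  · simp only [symmetrizer]
    split_ifs <;> simp
  · rcases n with _ | m
    · exact Or.inl (Subsingleton.elim _ _).le
    · obtain ⟨w, hw, -, rfl | rfl⟩ := exists_vertex (stepForm_of_bilin hv)
      · exact Or.inl (root_nonneg hw)
      · exact Or.inr (neg_nonpos.2 (root_nonneg hw))
  · rcases n with _ | m
    · exact Subsingleton.elim _ _
    · rw [bilin_eq] at hv
      have := eq_zero_of_stepForm_self (M := m) (F := extend v) (by omega)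
      funext i
      rw [← extend_val v, this i (by omega), Pi.zero_apply]
  · rcases n with _ | m
    · exact Set.toFinite _
    · refine ((finite_bdd (m + 1)).image (root m)).subset ?_
      rintro v ⟨hv, hb⟩
      obtain ⟨w, hw, hw', rfl | rfl⟩ := exists_vertex (stepForm_of_bilin hb)
      · exact ⟨w, hw', rfl⟩
      · have h₀ : root m w = 0 := le_antisymm (neg_nonneg.1 hv) (root_nonneg hw)
        have h₁ := stepForm_of_bilin hb
        simp [h₀, extend, stepForm] at h₁

theorem mem_positiveRoots_iff {v : Fin (m + 1) → ℤ} :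
    v ∈ positiveRoots (CartanMatrix.B (m + 1)) ↔
      ∃ w : Vtx, w.Positive true ∧ Bdd (m + 1) w ∧ v = root m w := by
  rw [(isFiniteType (m + 1)).mem_positiveRoots_iff]
  constructor
  · rintro ⟨hv, hb⟩
    obtain ⟨w, hw, hw', h | rfl⟩ := exists_vertex (stepForm_of_bilin hb)
    · exact ⟨w, hw, hw', h⟩
    · have h₀ : root m w = 0 := le_antisymm (neg_nonneg.1 hv) (root_nonneg hw)
      have h₁ := stepForm_of_bilin hb
      simp [h₀, extend, stepForm] at h₁
  · rintro ⟨w, hw, hw', rfl⟩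
    refine ⟨root_nonneg hw, ?_⟩
    rw [bilin_eq, stepForm_congr (fun i hi => extend_root hi) (fun i hi => extend_root hi)]
    rcases w with i | e | ⟨a, b⟩ | ⟨a, b⟩ | ⟨i, e⟩ <;>
      simp only [Positive, Bdd, Order.lt_add_one_iff] at hw hw'
    · refine ⟨0, ?_⟩
      simp only [profile, stepForm_sub_left, stepForm_sub_right, stepForm_step, hw', symmetrizer,
        Fin.val_zero]
      omega
    · refine ⟨0, ?_⟩
      simp only [profile, stepForm_add_left, stepForm_add_right, stepForm_step, hw', symmetrizer,
        Fin.val_zero]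
      omega
    · exact ⟨Fin.last m, by simp [profile, stepForm_step, hw', symmetrizer]⟩

theorem root_neg {i : ℕ} (h : i < m + 1) : root m (neg i) = -simpleRoot ⟨i, h⟩ := by
  funext j
  simp only [root, profile, Pi.neg_apply, simpleRoot, Pi.single_apply, Fin.ext_iff]
  split_ifs <;> simp

theorem mem_vertices_iff {v : Vtx} : v ∈ vertices (m + 1) (fullB 0 0 (m + 1)) ↔
    (∃ i, i < m + 1 ∧ v = neg i) ∨ (v.Positive true ∧ Bdd (m + 1) v) := by
  rw [mem_vertices]
  rcases v with i | e | ⟨a, b⟩ | ⟨a, b⟩ | ⟨i, e⟩ <;>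
    simp [fullB, Region, Bdd, Positive] <;> first | omega | tauto

theorem injOn_root : Set.InjOn (root m) (vertices (m + 1) (fullB 0 0 (m + 1))) := by
  intro v hv w hw h
  rcases mem_vertices_iff.1 hv with ⟨i, hi, rfl⟩ | ⟨hv, hv'⟩ <;>
  rcases mem_vertices_iff.1 hw with ⟨j, hj, rfl⟩ | ⟨hw, hw'⟩
  · rw [root_neg hi, root_neg hj, neg_simpleRoot_inj, Fin.mk.injEq] at h
    rw [h]
  · rw [root_neg hi] at h
    exact absurd h.symm (ne_neg_simpleRoot (root_nonneg hw) _)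
  · rw [root_neg hj] at h
    exact absurd h (ne_neg_simpleRoot (root_nonneg hv) _)
  · refine eq_of_profile_eq hv hw hv' hw' (fun i hi => ?_) fun h => by simp at h
    rw [← extend_root hi, ← extend_root hi, h]

theorem compatible_neg_iff {i : ℕ} (hi : i < m + 1) {w : Vtx}
    (hw : w ∈ vertices (m + 1) (fullB 0 0 (m + 1))) (h : neg i ≠ w) :
    EulerCompatible (CartanMatrix.B (m + 1)) (symmetrizer (m + 1)) (List.finRange (m + 1))
      (root m (neg i)) (root m w) ↔ Rel true (neg i) w := by
  have hi' : neg i ∈ vertices (m + 1) (fullB 0 0 (m + 1)) :=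
    mem_vertices_iff.2 (Or.inl ⟨i, hi, rfl⟩)
  rw [root_neg hi, eulerCompatible_neg_iff, ← profile_eq_zero_iff, root]
  · rcases mem_vertices_iff.1 hw with ⟨j, hj, rfl⟩ | ⟨hw, -⟩
    · exact Or.inl ⟨j, rfl, fun e => h (by rw [e])⟩
    · exact Or.inr (Or.inr hw)
  · rw [← root_neg hi]
    exact fun e => h (injOn_root hi' hw e.symm)

theorem rootPoly_eq {R : Type*} [CommRing R] (x u : R) (n : ℕ) :
    (isFiniteType n).rootPoly (List.finRange n) x u Finset.univ = cl true x u n (fullB 0 0 n) := by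
  classical
  rcases n with _ | m
  · rw [cl_eq_one]
    · have : (isFiniteType 0).rootFinset Finset.univ = ∅ := by
        refine Finset.eq_empty_of_forall_notMem fun v hv => ?_
        rw [IsFiniteType.mem_rootFinset, IsFiniteType.parabolicRoots_univ] at hv
        rcases hv with hv | ⟨i, -⟩
        · rw [(isFiniteType 0).mem_positiveRoots_iff] at hv
          obtain ⟨-, j, -⟩ := hv
          exact j.elim0
        · exact i.elim0
      rw [IsFiniteType.rootPoly, this, cliquePoly_empty]
    · rintro (i | e | ⟨a, b⟩ | ⟨a, b⟩ | ⟨i, e⟩) <;> simp [fullB, Region]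
  · have himg : (vertices (m + 1) (fullB 0 0 (m + 1))).image (root m) =
        (isFiniteType (m + 1)).rootFinset Finset.univ := by
      ext v
      rw [IsFiniteType.mem_rootFinset, IsFiniteType.parabolicRoots_univ, almostPositiveRoots, Set.mem_union,
        mem_positiveRoots_iff, Finset.mem_image]
      constructor
      · rintro ⟨w, hw, rfl⟩
        rcases mem_vertices_iff.1 hw with ⟨i, hi, rfl⟩ | ⟨hw, hw'⟩
        · exact Or.inr ⟨_, root_neg hi⟩
        · exact Or.inl ⟨w, hw, hw', rfl⟩
      · rintro (⟨w, hw, hw', rfl⟩ | ⟨i, rfl⟩)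
        · exact ⟨w, mem_vertices_iff.2 (Or.inr ⟨hw, hw'⟩), rfl⟩
        · exact ⟨neg i, mem_vertices_iff.2 (Or.inl ⟨i, i.2, rfl⟩), root_neg i.2⟩
    rw [IsFiniteType.rootPoly, ← himg, cl]
    refine ((cliquePoly_image (r' := EulerCompatible (CartanMatrix.B (m + 1))
      (symmetrizer (m + 1)) (List.finRange (m + 1))) (w' := rootWeight x u) injOn_root
      (fun v hv w hw h => ?_) fun v hv => ?_).trans ?_).symm
    · rcases mem_vertices_iff.1 hv with ⟨i, hi, rfl⟩ | ⟨hv', hv''⟩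
      · rw [compatible_neg_iff hi hw h]
      rcases mem_vertices_iff.1 hw with ⟨i, hi, rfl⟩ | ⟨hw', hw''⟩
      · rw [eulerCompatible_comm, compatible_neg_iff hi hv h.symm]
        exact ⟨fun h => h.symm, fun h => h.symm⟩
      rw [eulerCompatible_iff (root_nonneg hv') (root_nonneg hw'), euler_eq, euler_eq,
        stepForm_congr (fun i hi => extend_root hi) (fun i hi => extend_root hi),
        stepForm_congr (fun i hi => extend_root hi) (fun i hi => extend_root hi),
        stepForm_profile_rel hv' hw' hv'' hw'' h]
    · rcases mem_vertices_iff.1 hv with ⟨i, hi, rfl⟩ | ⟨hv', hv''⟩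
      · rw [root_neg hi, IsFiniteType.rootWeight_neg, weight]
      · rw [rootWeight, if_pos (root_nonneg hv')]
        rcases v with i | e | ⟨a, b⟩ | ⟨a, b⟩ | ⟨i, e⟩ <;> simp [Positive, weight] at hv' ⊢
    · congr!

theorem move (n : ℕ) (c c' : List (Fin n)) (hc : c.Nodup) (hc' : c'.Nodup)
    (h : c.toFinset = c'.toFinset) : Relation.EqvGen (Move (CartanMatrix.B n)) c c' := by
  -- In the numbering of the diagram, each node is joined to at most one node of smaller index.
  refine eqvGen_move (fun i j => ?_) (fun i j k => ?_) c'.toFinset c c' hc hc' ?_ ?_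
  · simp only [CartanMatrix.B, Matrix.of_apply, Fin.ext_iff]
    intro h
    split_ifs at h ⊢ <;> omega
  · simp only [CartanMatrix.B, Matrix.of_apply, Fin.ext_iff, Fin.lt_def]
    intro h₁ h₂ h₃ h₄
    split_ifs at h₃ h₄ <;> omega
  · convert h
  · rfl

end TypeB

end GammaTriangle

namespace GammaTriangle

set_option linter.unusedSectionVars false

/-! ## Type `D` -/

namespace TypeD

open Vtx

variable {M : ℕ}

/-- The coordinates of a vector on the diagram in which the two legs are folded. -/
def fold (v : Fin (M + 2) → ℤ) (i : ℕ) : ℤ :=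
  if i < M then extend v i else extend v M + extend v (M + 1)

/-- The difference of the coordinates of the two legs. -/
def legDiff (v : Fin (M + 2) → ℤ) : ℤ := extend v (M + 1) - extend v M

theorem cartan_apply {i j : Fin (M + 2)} (h : i < j) : CartanMatrix.D (M + 2) i j * 1 =
    if j.val < M then (if j.val = i.val + 1 then -1 else 0)
    else if i.val + 1 = M then -1 else 0 := by
  have := i.2
  have := j.2
  rw [Fin.lt_def] at h
  simp only [CartanMatrix.D, Matrix.of_apply, Fin.ext_iff]
  split_ifs <;> omega

/-- Adding the two leg coordinates folds the diagram of D_{M+2} onto that of B_{M+1}; what the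
folding loses is the rank one form in the difference of the legs. -/
theorem euler_eq (u v : Fin (M + 2) → ℤ) :
    2 * euler (CartanMatrix.D (M + 2)) (fun _ => 1) (List.finRange (M + 2)) u v =
      stepForm M (fold u) (fold v) + legDiff u * legDiff v := by
  rw [euler_finRange (a := fun i j => if j < M then (if j = i + 1 then -1 else 0)
    else if i + 1 = M then -1 else 0) (e := fun _ => 1) (fun i j h => cartan_apply h)
    (fun _ => rfl)]
  have h : ∀ i ≤ M + 1, (∑ j ∈ Finset.range (M + 2), if i < j then (if j < M then
      (if j = i + 1 then -1 else 0) else if i + 1 = M then -1 else 0) * extend v j else 0) =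
        if i < M then -fold v (i + 1) else 0 := by
    intro i hi
    have h₁ : ∀ j ∈ Finset.range M, (if i < j then (if j < M then
        (if j = i + 1 then -1 else 0) else if i + 1 = M then -1 else 0) * extend v j else 0) =
          if j = i + 1 then -extend v (i + 1) else 0 := by
      intro j hj
      rw [if_pos (Finset.mem_range.1 hj)]
      by_cases hj : j = i + 1
      · subst hj; simp
      · simp [hj]
    rw [Finset.sum_range_succ, Finset.sum_range_succ, Finset.sum_congr rfl h₁,
      Finset.sum_ite_eq']
    simp only [Finset.mem_range, fold, lt_irrefl, if_false, show ¬M + 1 < M by omega]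
    split_ifs <;> omega
  have e : ∀ i ∈ Finset.range (M + 2), extend u i * (1 * extend v i +
      ∑ j ∈ Finset.range (M + 2), if i < j then (if j < M then
      (if j = i + 1 then -1 else 0) else if i + 1 = M then -1 else 0) * extend v j else 0) =
      extend u i * (extend v i + if i < M then -fold v (i + 1) else 0) := by
    intro i hi
    rw [h i (by simpa using Nat.le_of_lt_succ (Finset.mem_range.1 hi)), one_mul]
  rw [Finset.sum_congr rfl e, Finset.sum_range_succ, Finset.sum_range_succ, if_neg (lt_irrefl M),
    if_neg (by omega), stepForm]
  have e' : ∀ i ∈ Finset.range M, extend u i * (extend v i + if i < M then -fold v (i + 1) else 0) =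
      -(fold u i * (fold v (i + 1) - fold v i)) := by
    intro i hi
    rw [Finset.mem_range] at hi
    have hf : ∀ w : Fin (M + 2) → ℤ, fold w i = extend w i := fun w => if_pos hi
    rw [if_pos hi, hf, hf]
    ring
  rw [Finset.sum_congr rfl e', Finset.sum_neg_distrib]
  have hf : ∀ w : Fin (M + 2) → ℤ, fold w M = extend w M + extend w (M + 1) := fun w =>
    if_neg (lt_irrefl M)
  rw [hf, hf, legDiff, legDiff]
  ring

theorem cartan_symm (n : ℕ) (i j : Fin n) :
    CartanMatrix.D n i j * (fun _ => 1) j = CartanMatrix.D n j i * (fun _ => 1) i := by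
  have := i.2
  have := j.2
  simp only [CartanMatrix.D, Matrix.of_apply, Fin.ext_iff]
  split_ifs <;> omega

theorem bilin_eq (v : Fin (M + 2) → ℤ) :
    bilin (CartanMatrix.D (M + 2)) (fun _ => 1) v v =
      stepForm M (fold v) (fold v) + legDiff v * legDiff v := by
  rw [bilin_self (CartanMatrix.D_diag _) (cartan_symm _), euler_eq]

/-- The coordinates of a vertex at the two legs. -/
def legCoord (e : Bool) : Vtx → ℤ
  | plus _ _ => 1
  | single _ e' => if e' = e then 1 else 0
  | leg e' => if e' = e then -1 else 0
  | _ => 0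

/-- The root of a vertex. -/
def root (M : ℕ) (v : Vtx) (i : Fin (M + 2)) : ℤ :=
  if i.val < M then profile v i else if i.val = M then legCoord false v else legCoord true v

theorem ext_fold {u v : Fin (M + 2) → ℤ} (h : ∀ i ≤ M, fold u i = fold v i)
    (hl : legDiff u = legDiff v) : u = v := by
  have hM := h M le_rfl
  simp only [fold, lt_irrefl, if_false] at hM
  simp only [legDiff] at hl
  funext i
  rw [← extend_val u, ← extend_val v]
  rcases lt_trichotomy i.val M with hi | hi | hi
  · have := h i hi.le
    rwa [fold, if_pos hi, fold, if_pos hi] at this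
  · rw [hi]; omega
  · rw [show i.val = M + 1 by omega]; omega

theorem fold_neg (v : Fin (M + 2) → ℤ) (i : ℕ) : fold (-v) i = -fold v i := by
  simp only [fold, extend_neg]
  split_ifs <;> ring

theorem legDiff_neg (v : Fin (M + 2) → ℤ) : legDiff (-v) = -legDiff v := by
  simp only [legDiff, extend_neg]
  ring

theorem extend_root_of_lt {v : Vtx} {i : ℕ} (h : i < M) : extend (root M v) i = profile v i := by
  rw [extend_of_lt _ (by omega), root, if_pos h]

theorem extend_root_left (v : Vtx) : extend (root M v) M = legCoord false v := by
  rw [extend_of_lt _ (by omega), root, if_neg (lt_irrefl M), if_pos rfl]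

theorem extend_root_right (v : Vtx) : extend (root M v) (M + 1) = legCoord true v := by
  rw [extend_of_lt _ (by omega), root, if_neg (by simp), if_neg (by simp)]

theorem fold_root {v : Vtx} (hv : v.Positive false) (hv' : Bdd (M + 1) v) {i : ℕ} (h : i ≤ M) :
    fold (root M v) i = profile v i := by
  rcases h.eq_or_lt with rfl | h
  · rw [fold, if_neg (lt_irrefl i), extend_root_left, extend_root_right]
    rcases v with j | e | ⟨a, b⟩ | ⟨a, b⟩ | ⟨j, _ | _⟩ <;>
      simp only [Positive, Bdd, Order.lt_add_one_iff] at hv hv' <;>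
      simp [legCoord, profile, step, hv']
  · rw [fold, if_pos h, extend_root_of_lt h]

theorem legDiff_root {v : Vtx} (hv : v.Positive false) : legDiff (root M v) = spin v := by
  rw [legDiff, extend_root_left, extend_root_right]
  rcases v with j | e | ⟨a, b⟩ | ⟨a, b⟩ | ⟨j, _ | _⟩ <;>
    simp [Positive, legCoord, spin] at hv ⊢

/-- The norm 2 splits as 2 + 0 or 1 + 1: either two jumps and spin 0, giving `plus` or `minus`, or
one jump and spin ±1, giving a single. -/
theorem exists_vertex {v : Fin (M + 2) → ℤ}
    (h : stepForm M (fold v) (fold v) + legDiff v * legDiff v = 2) :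
    ∃ w : Vtx, w.Positive false ∧ Bdd (M + 1) w ∧ (v = root M w ∨ v = -root M w) := by
  have hpos : ∀ w : Vtx, w.Positive false → Bdd (M + 1) w → (∀ i ≤ M, fold v i = profile w i) →
      legDiff v = spin w → v = root M w := fun w hw hw' h₁ h₂ =>
    ext_fold (fun i hi => by rw [h₁ i hi, fold_root hw hw' hi]) (by rw [h₂, legDiff_root hw])
  have hneg : ∀ w : Vtx, w.Positive false → Bdd (M + 1) w → (∀ i ≤ M, fold v i = -profile w i) →
      legDiff v = -spin w → v = -root M w := fun w hw hw' h₁ h₂ =>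
    ext_fold (fun i hi => by rw [h₁ i hi, fold_neg, fold_root hw hw' hi])
      (by rw [h₂, legDiff_neg, legDiff_root hw])
  have h₀ := stepForm_self_nonneg M (fold v)
  rcases int_sq_le_two (w := legDiff v) (by nlinarith) with hl | hl
  · rw [hl, mul_zero, add_zero] at h
    obtain ⟨k, l, hkl, hl', e, e', he, he', hF⟩ := exists_of_stepForm_self_eq_two h
    have hb : k < M + 1 ∧ l < M + 1 := by omega
    rcases he with rfl | rfl <;> rcases he' with rfl | rfl
    · refine ⟨plus k l, hkl, hb, Or.inl (hpos _ hkl hb (fun i hi => ?_) (by simp [hl, spin]))⟩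
      rw [hF i hi]
      simp [profile]
    · refine ⟨minus k l, hkl, hb, Or.inl (hpos _ hkl hb (fun i hi => ?_) (by simp [hl, spin]))⟩
      rw [hF i hi]
      simp [profile]
      ring
    · refine ⟨minus k l, hkl, hb, Or.inr (hneg _ hkl hb (fun i hi => ?_) (by simp [hl, spin]))⟩
      rw [hF i hi]
      simp [profile]
      ring
    · refine ⟨plus k l, hkl, hb, Or.inr (hneg _ hkl hb (fun i hi => ?_) (by simp [hl, spin]))⟩
      rw [hF i hi]
      simp [profile]
      ring
  · have h₁ : stepForm M (fold v) (fold v) = 1 := by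
      rcases hl with hl | hl <;> rw [hl] at h <;> linarith
    obtain ⟨k, hk, e, he, hF⟩ := exists_of_stepForm_self_eq_one h₁
    have hb : k < M + 1 := by omega
    have hp : ∀ b, (single k b).Positive false := fun b h => by simp at h
    rcases he with rfl | rfl <;> rcases hl with hl | hl
    · refine ⟨single k true, hp _, hb, Or.inl (hpos _ (hp _) hb (fun i hi => ?_)
        (by simp [hl, spin]))⟩
      rw [hF i hi]
      simp [profile]
    · refine ⟨single k false, hp _, hb, Or.inl (hpos _ (hp _) hb (fun i hi => ?_)
        (by simp [hl, spin]))⟩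
      rw [hF i hi]
      simp [profile]
    · refine ⟨single k false, hp _, hb, Or.inr (hneg _ (hp _) hb (fun i hi => ?_)
        (by simp [hl, spin]))⟩
      rw [hF i hi]
      simp [profile]
    · refine ⟨single k true, hp _, hb, Or.inr (hneg _ (hp _) hb (fun i hi => ?_)
        (by simp [hl, spin]))⟩
      rw [hF i hi]
      simp [profile]

theorem root_nonneg {w : Vtx} (hw : w.Positive false) : 0 ≤ root M w := fun i => by
  have := profile_nonneg hw i
  rcases w with j | e | ⟨a, b⟩ | ⟨a, b⟩ | ⟨j, e⟩ <;> simp only [Positive] at hw <;>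
    simp only [root, legCoord, Pi.zero_apply] <;> split_ifs <;> omega

theorem stepForm_of_bilin {v : Fin (M + 2) → ℤ}
    (h : ∃ _ : Fin (M + 2), bilin (CartanMatrix.D (M + 2)) (fun _ => 1) v v = 2 * 1) :
    stepForm M (fold v) (fold v) + legDiff v * legDiff v = 2 := by
  obtain ⟨j, hj⟩ := h
  rwa [bilin_eq] at hj

theorem fold_zero (i : ℕ) : fold (0 : Fin (M + 2) → ℤ) i = 0 := by simp [fold, extend]

theorem eq_root_of_nonneg {v w : Fin (M + 2) → ℤ}
    (h : stepForm M (fold v) (fold v) + legDiff v * legDiff v = 2) (hv : 0 ≤ v) (hw : 0 ≤ w)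
    (hvw : v = w ∨ v = -w) : v = w := by
  rcases hvw with h' | rfl
  · exact h'
  · have h₀ : w = 0 := le_antisymm (neg_nonneg.1 hv) hw
    simp [h₀, fold, legDiff, extend, stepForm] at h

theorem isFiniteType (M : ℕ) : IsFiniteType (CartanMatrix.D (M + 2)) (fun _ => 1) := by
  refine ⟨CartanMatrix.D_diag _, cartan_symm _, fun i => Or.inl rfl, fun v hv => ?_,
    fun v hv => ?_, ?_⟩
  · obtain ⟨w, hw, -, rfl | rfl⟩ := exists_vertex (stepForm_of_bilin hv)
    · exact Or.inl (root_nonneg hw)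
    · exact Or.inr (neg_nonpos.2 (root_nonneg hw))
  · rw [bilin_eq] at hv
    have h₁ := stepForm_self_nonneg M (fold v)
    have h₂ := mul_self_nonneg (legDiff v)
    refine ext_fold (fun i hi => ?_) ?_
    · rw [fold_zero]
      exact eq_zero_of_stepForm_self (by omega) i hi
    · rw [mul_self_eq_zero.1 (show legDiff v * legDiff v = 0 by omega)]
      simp [legDiff, extend]
  · refine ((finite_bdd (M + 1)).image (root M)).subset ?_
    rintro v ⟨hv, hb⟩
    obtain ⟨w, hw, hw', h⟩ := exists_vertex (stepForm_of_bilin hb)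
    exact ⟨w, hw', (eq_root_of_nonneg (stepForm_of_bilin hb) hv (root_nonneg hw) h).symm⟩

theorem mem_positiveRoots_iff {v : Fin (M + 2) → ℤ} :
    v ∈ positiveRoots (CartanMatrix.D (M + 2)) ↔
      ∃ w : Vtx, w.Positive false ∧ Bdd (M + 1) w ∧ v = root M w := by
  rw [(isFiniteType M).mem_positiveRoots_iff]
  constructor
  · rintro ⟨hv, hb⟩
    obtain ⟨w, hw, hw', h⟩ := exists_vertex (stepForm_of_bilin hb)
    exact ⟨w, hw, hw', eq_root_of_nonneg (stepForm_of_bilin hb) hv (root_nonneg hw) h⟩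
  · rintro ⟨w, hw, hw', rfl⟩
    refine ⟨root_nonneg hw, 0, ?_⟩
    rw [bilin_eq, stepForm_congr (fun i hi => fold_root hw hw' hi)
      (fun i hi => fold_root hw hw' hi), legDiff_root hw]
    rcases w with i | e | ⟨a, b⟩ | ⟨a, b⟩ | ⟨i, _ | _⟩ <;>
      simp only [Positive, Bdd, Order.lt_add_one_iff] at hw hw' <;>
      simp only [profile, spin, stepForm_sub_left, stepForm_sub_right, stepForm_add_left,
        stepForm_add_right, stepForm_step, hw'] <;> simp <;> omega

theorem root_neg {i : ℕ} (h : i < M) : root M (neg i) = -simpleRoot ⟨i, by omega⟩ := by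
  funext j
  simp only [root, profile, legCoord, Pi.neg_apply, simpleRoot, Pi.single_apply, Fin.ext_iff]
  split_ifs <;> omega

/-- The simple root of a leg. -/
def legIndex (M : ℕ) (e : Bool) : Fin (M + 2) :=
  if e = true then ⟨M + 1, by omega⟩ else ⟨M, by omega⟩

theorem root_leg (e : Bool) : root M (leg e) = -simpleRoot (legIndex M e) := by
  funext j
  cases e <;>
    simp only [root, profile, legCoord, Pi.neg_apply, simpleRoot, Pi.single_apply, Fin.ext_iff,
      legIndex, Pi.zero_apply] <;> simp <;> split_ifs <;> omega

theorem root_legIndex (w : Vtx) (e : Bool) : root M w (legIndex M e) = legCoord e w := by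
  cases e <;> simp [root, legIndex]

theorem mem_vertices_iff {v : Vtx} : v ∈ vertices (M + 1) (fullD 0 0 (M + 1)) ↔
    (∃ i, i < M ∧ v = neg i) ∨ (∃ e, v = leg e) ∨ (v.Positive false ∧ Bdd (M + 1) v) := by
  rw [mem_vertices]
  rcases v with i | e | ⟨a, b⟩ | ⟨a, b⟩ | ⟨i, e⟩ <;>
    simp [fullD, Region, Bdd, Positive] <;> omega

theorem injOn_root : Set.InjOn (root M) (vertices (M + 1) (fullD 0 0 (M + 1))) := by
  intro v hv w hw h
  rcases mem_vertices_iff.1 hv with ⟨i, hi, rfl⟩ | ⟨e, rfl⟩ | ⟨hv, hv'⟩ <;>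
  rcases mem_vertices_iff.1 hw with ⟨j, hj, rfl⟩ | ⟨e', rfl⟩ | ⟨hw, hw'⟩
  · rw [root_neg hi, root_neg hj, neg_simpleRoot_inj, Fin.mk.injEq] at h
    rw [h]
  · rw [root_neg hi, root_leg, neg_simpleRoot_inj] at h
    cases e' <;> simp [legIndex] at h <;> omega
  · rw [root_neg hi] at h
    exact absurd h.symm (ne_neg_simpleRoot (root_nonneg hw) _)
  · rw [root_neg hj, root_leg, neg_simpleRoot_inj] at h
    cases e <;> simp [legIndex] at h <;> omega
  · rw [root_leg, root_leg, neg_simpleRoot_inj] at h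
    cases e <;> cases e' <;> simp [legIndex] at h ⊢
  · rw [root_leg] at h
    exact absurd h.symm (ne_neg_simpleRoot (root_nonneg hw) _)
  · rw [root_neg hj] at h
    exact absurd h (ne_neg_simpleRoot (root_nonneg hv) _)
  · rw [root_leg] at h
    exact absurd h (ne_neg_simpleRoot (root_nonneg hv) _)
  · refine eq_of_profile_eq hv hw hv' hw' (fun i hi => ?_) fun _ => ?_
    · rw [← fold_root hv hv' hi, ← fold_root hw hw' hi, h]
    · rw [← legDiff_root hv (M := M), ← legDiff_root hw (M := M), h]

theorem compatible_neg_iff {i : ℕ} (hi : i < M) {w : Vtx}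
    (hw : w ∈ vertices (M + 1) (fullD 0 0 (M + 1))) (h : neg i ≠ w) :
    EulerCompatible (CartanMatrix.D (M + 2)) (fun _ => 1) (List.finRange (M + 2))
      (root M (neg i)) (root M w) ↔ Rel false (neg i) w := by
  have hi' : neg i ∈ vertices (M + 1) (fullD 0 0 (M + 1)) :=
    mem_vertices_iff.2 (Or.inl ⟨i, hi, rfl⟩)
  rw [root_neg hi, eulerCompatible_neg_iff, ← profile_eq_zero_iff, root, if_pos hi]
  · rcases mem_vertices_iff.1 hw with ⟨j, hj, rfl⟩ | ⟨e, rfl⟩ | ⟨hw, -⟩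
    · exact Or.inl ⟨j, rfl, fun e => h (by rw [e])⟩
    · exact Or.inr (Or.inl ⟨e, rfl⟩)
    · exact Or.inr (Or.inr hw)
  · rw [← root_neg hi]
    exact fun e => h (injOn_root hi' hw e.symm)

theorem compatible_leg_iff {e : Bool} {w : Vtx}
    (hw : w ∈ vertices (M + 1) (fullD 0 0 (M + 1))) (h : leg e ≠ w) :
    EulerCompatible (CartanMatrix.D (M + 2)) (fun _ => 1) (List.finRange (M + 2))
      (root M (leg e)) (root M w) ↔ Rel false (leg e) w := by
  have hi' : leg e ∈ vertices (M + 1) (fullD 0 0 (M + 1)) :=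
    mem_vertices_iff.2 (Or.inr (Or.inl ⟨e, rfl⟩))
  rw [root_leg, eulerCompatible_neg_iff, root_legIndex]
  · rcases w with i | e' | ⟨a, b⟩ | ⟨a, b⟩ | ⟨i, e'⟩ <;> simp [legCoord, Vtx.Rel, Bad] at h ⊢
    · exact fun e => h e.symm
    · exact not_congr eq_comm
  · rw [← root_leg]
    exact fun e => h (injOn_root hi' hw e.symm)

theorem rootPoly_eq {R : Type*} [CommRing R] (x u : R) (M : ℕ) :
    (isFiniteType M).rootPoly (List.finRange (M + 2)) x u Finset.univ =
      cl false x u (M + 1) (fullD 0 0 (M + 1)) := by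
  classical
  have himg : (vertices (M + 1) (fullD 0 0 (M + 1))).image (root M) =
      (isFiniteType M).rootFinset Finset.univ := by
    ext v
    rw [IsFiniteType.mem_rootFinset, IsFiniteType.parabolicRoots_univ, almostPositiveRoots,
      Set.mem_union, mem_positiveRoots_iff, Finset.mem_image]
    constructor
    · rintro ⟨w, hw, rfl⟩
      rcases mem_vertices_iff.1 hw with ⟨i, hi, rfl⟩ | ⟨e, rfl⟩ | ⟨hw, hw'⟩
      · exact Or.inr ⟨_, root_neg hi⟩
      · exact Or.inr ⟨_, root_leg e⟩
      · exact Or.inl ⟨w, hw, hw', rfl⟩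
    · rintro (⟨w, hw, hw', rfl⟩ | ⟨i, rfl⟩)
      · exact ⟨w, mem_vertices_iff.2 (Or.inr (Or.inr ⟨hw, hw'⟩)), rfl⟩
      · by_cases hi : i.val < M
        · exact ⟨neg i, mem_vertices_iff.2 (Or.inl ⟨i, hi, rfl⟩), root_neg hi⟩
        · refine ⟨leg (decide (i.val = M + 1)), mem_vertices_iff.2 (Or.inr (Or.inl ⟨_, rfl⟩)), ?_⟩
          rw [root_leg, neg_simpleRoot_inj, legIndex]
          ext
          split_ifs with h <;> simp at h ⊢ <;> omega
  rw [IsFiniteType.rootPoly, ← himg, cl]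
  refine ((cliquePoly_image (r' := EulerCompatible (CartanMatrix.D (M + 2)) (fun _ => 1)
    (List.finRange (M + 2))) (w' := rootWeight x u) injOn_root
    (fun v hv w hw h => ?_) fun v hv => ?_).trans ?_).symm
  · rcases mem_vertices_iff.1 hv with ⟨i, hi, rfl⟩ | ⟨e, rfl⟩ | ⟨hv', hv''⟩
    · rw [compatible_neg_iff hi hw h]
    · rw [compatible_leg_iff hw h]
    rcases mem_vertices_iff.1 hw with ⟨i, hi, rfl⟩ | ⟨e, rfl⟩ | ⟨hw', hw''⟩
    · rw [eulerCompatible_comm, compatible_neg_iff hi hv h.symm]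
      exact ⟨fun h => h.symm, fun h => h.symm⟩
    · rw [eulerCompatible_comm, compatible_leg_iff hv h.symm]
      exact ⟨fun h => h.symm, fun h => h.symm⟩
    -- The folded form computes twice the Euler form, which does not affect signs.
    have e : ∀ a b : ℤ, 0 ≤ a ∧ 0 ≤ b ↔ 0 ≤ 2 * a ∧ 0 ≤ 2 * b := fun a b => by omega
    rw [eulerCompatible_iff (root_nonneg hv') (root_nonneg hw'), e, euler_eq, euler_eq,
      stepForm_congr (fun i hi => fold_root hv' hv'' hi) (fun i hi => fold_root hw' hw'' hi),
      stepForm_congr (fun i hi => fold_root hw' hw'' hi) (fun i hi => fold_root hv' hv'' hi),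
      legDiff_root hv', legDiff_root hw', stepForm_profile_rel_spin hv' hw' hv'' hw'']
  · rcases mem_vertices_iff.1 hv with ⟨i, hi, rfl⟩ | ⟨e, rfl⟩ | ⟨hv', hv''⟩
    · rw [root_neg hi, IsFiniteType.rootWeight_neg, weight]
    · rw [root_leg, IsFiniteType.rootWeight_neg, weight]
    · rw [rootWeight, if_pos (root_nonneg hv')]
      rcases v with i | e | ⟨a, b⟩ | ⟨a, b⟩ | ⟨i, e⟩ <;> simp [Positive, weight] at hv' ⊢
  · congr!

theorem move (n : ℕ) (c c' : List (Fin n)) (hc : c.Nodup) (hc' : c'.Nodup)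
    (h : c.toFinset = c'.toFinset) : Relation.EqvGen (Move (CartanMatrix.D n)) c c' := by
  refine eqvGen_move (fun i j => ?_) (fun i j k => ?_) c'.toFinset c c' hc hc' ?_ ?_
  · simp only [CartanMatrix.D, Matrix.of_apply, Fin.ext_iff]
    intro h
    split_ifs at h ⊢ <;> omega
  · simp only [CartanMatrix.D, Matrix.of_apply, Fin.ext_iff, Fin.lt_def]
    intro h₁ h₂ h₃ h₄
    split_ifs at h₃ h₄ <;> omega
  · convert h
  · rfl

end TypeD

end GammaTriangle

namespace GammaTriangle

set_option linter.unusedSectionVars false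

/-! ## `h`-polynomials and `H`-triangles of cluster complexes -/

/-- The size bound matters: `hPoly` would silently drop faces with more than n vertices. -/
theorem hPoly_eq_sum {V : Type*} {K : Set (Finset V)} {S : Finset (Finset V)}
    (hS : ∀ G, G ∈ K ↔ G ∈ S) {n : ℕ} (hn : ∀ G ∈ S, G.card ≤ n) :
    hPoly K n = ∑ G ∈ S, X ^ G.card * (1 - X) ^ (n - G.card) := by
  classical
  have h : ∀ k, (faceCount K k : ℤ[X]) * X ^ k * (1 - X) ^ (n - k) =
      ∑ G ∈ S, if G.card = k then X ^ k * (1 - X) ^ (n - k) else 0 := by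
    intro k
    have : {G | G ∈ K ∧ G.card = k} = (S.filter fun G => G.card = k : Set (Finset V)) := by
      ext G
      simp [hS]
    rw [faceCount, this, Set.ncard_coe_finset, ← Finset.sum_filter, Finset.sum_const,
      nsmul_eq_mul, mul_assoc]
  simp only [hPoly, h]
  rw [Finset.sum_comm]
  refine Finset.sum_congr rfl fun G hG => ?_
  rw [Finset.sum_ite_eq, if_pos (Finset.mem_range.2 (Nat.lt_succ_of_le (hn G hG)))]

/-! ### The cluster complex as a clique complex. -/

section Cluster

variable {ι : Type*} [Fintype ι] [DecidableEq ι] {A : Matrix ι ι ℤ} {d : ι → ℤ}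
variable {R : Type*} [CommRing R]

open Classical in
/-- The number of positive roots in `G`. -/
noncomputable def posCard (G : Finset (ι → ℤ)) : ℕ := (G.filter fun v => 0 ≤ v).card

open Classical in
/-- The number of negative simple roots in `G`. -/
noncomputable def negCard (G : Finset (ι → ℤ)) : ℕ := (G.filter fun v => ¬0 ≤ v).card

theorem posCard_add_negCard (G : Finset (ι → ℤ)) : posCard G + negCard G = G.card := by
  classical
  exact Finset.card_filter_add_card_filter_not _

namespace IsFiniteType

variable (F : IsFiniteType A d)

/-- The faces of the cluster complex. -/
noncomputable def faces (c : List ι) : Finset (Finset (ι → ℤ)) :=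
  cliques (EulerCompatible A d c) (F.rootFinset Finset.univ)

theorem coe_rootFinset_univ :
    (F.rootFinset Finset.univ : Set (ι → ℤ)) = almostPositiveRoots A := by
  rw [coe_rootFinset, parabolicRoots_univ]

theorem mem_clusterComplex {c : List ι} (hc : IsCoxeterWord c) {G : Finset (ι → ℤ)} :
    G ∈ clusterComplex A c ↔ G ∈ F.faces c := by
  rw [faces, mem_cliques, ← Finset.coe_subset, F.coe_rootFinset_univ]
  refine and_congr_right fun hG => ⟨fun h a ha b hb hab => ?_, fun h a ha b hb hab => ?_⟩
  · exact (F.compatible_iff hc (hG ha) (hG hb) hab).1 (h ha hb hab)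
  · exact (F.compatible_iff hc (hG ha) (hG hb) hab).2 (h ha hb hab)

theorem rootPoly_univ_eq_sum (c : List ι) (x u : R) :
    F.rootPoly c x u Finset.univ = ∑ G ∈ F.faces c, x ^ posCard G * u ^ negCard G := by
  classical
  refine Finset.sum_congr rfl fun G _ => ?_
  simp only [rootWeight]
  rw [Finset.prod_ite, Finset.prod_const, Finset.prod_const]
  simp only [posCard, negCard]

theorem mem_negSimpleRoots_iff {v : ι → ℤ} (hv : v ∈ almostPositiveRoots A) :
    v ∈ negSimpleRoots ι ↔ ¬0 ≤ v := by
  constructor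
  · rintro ⟨i, rfl⟩
    exact not_nonneg_neg_simpleRoot i
  · exact fun h => hv.resolve_left fun h' => h h'.2

/-- The homogeneous face polynomial of the cluster complex. -/
noncomputable def homPoly (c : List ι) (a b z : R) : R :=
  ∑ G ∈ F.faces c, a ^ posCard G * b ^ negCard G * z ^ (Fintype.card ι - G.card)

theorem map_homPoly {R' : Type*} [CommRing R'] (f : R →+* R') (c : List ι) (a b z : R) :
    f (F.homPoly c a b z) = F.homPoly c (f a) (f b) (f z) := by
  simp [homPoly]

theorem fTriangle_eq {c : List ι} (hc : IsCoxeterWord c) (i j : ℕ) :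
    fTriangle (clusterComplex A c) (negSimpleRoots ι) i j =
      ((F.faces c).filter fun G => posCard G = i ∧ negCard G = j).card := by
  classical
  rw [fTriangle, ← Set.ncard_coe_finset]
  congr 1
  ext G
  simp only [Set.mem_ofPred_eq, Finset.coe_filter, F.mem_clusterComplex hc]
  refine and_congr_right fun hG => ?_
  have hG' : ∀ v ∈ G, v ∈ almostPositiveRoots A := fun v hv => by
    rw [← F.coe_rootFinset_univ]
    exact (mem_cliques.1 hG).1 hv
  have h₁ : (G : Set (ι → ℤ)) \ negSimpleRoots ι = (G.filter fun v => 0 ≤ v : Finset (ι → ℤ)) := by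
    ext v
    simp only [Set.mem_sdiff, Finset.coe_filter, Finset.mem_coe, Set.mem_ofPred_eq]
    exact and_congr_right fun hv => by rw [mem_negSimpleRoots_iff (hG' v hv), not_not]
  have h₂ : (G : Set (ι → ℤ)) ∩ negSimpleRoots ι =
      (G.filter fun v => ¬0 ≤ v : Finset (ι → ℤ)) := by
    ext v
    simp only [Set.mem_inter_iff, Finset.coe_filter, Finset.mem_coe, Set.mem_ofPred_eq]
    exact and_congr_right fun hv => by rw [mem_negSimpleRoots_iff (hG' v hv)]
  rw [h₁, h₂, Set.ncard_coe_finset, Set.ncard_coe_finset]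
  simp only [posCard, negCard]

variable {c : List ι}

theorem hTriangle_eq (hc : IsCoxeterWord c) (hcard : ∀ G ∈ F.faces c, G.card ≤ Fintype.card ι) :
    hTriangle (clusterComplex A c) (negSimpleRoots ι) (Fintype.card ι) =
      F.homPoly c (C X : ℤ[X][Y]) (C X * Y) (1 - C X) := by
  classical
  have h : ∀ k j, (fTriangle (clusterComplex A c) (negSimpleRoots ι) (k - j) j : ℤ[X][Y]) *
      C X ^ k * Y ^ j * (1 - C X) ^ (Fintype.card ι - k) = ∑ G ∈ F.faces c,
        if posCard G = k - j ∧ negCard G = j then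
          C X ^ k * Y ^ j * (1 - C X) ^ (Fintype.card ι - k) else 0 := by
    intro k j
    rw [F.fTriangle_eq hc, ← Finset.sum_filter, Finset.sum_const, nsmul_eq_mul]
    ring
  simp only [hTriangle, h, homPoly]
  rw [Finset.sum_congr rfl fun k _ => Finset.sum_comm, Finset.sum_comm]
  refine Finset.sum_congr rfl fun G hG => ?_
  have hG' := posCard_add_negCard G
  have hG'' := hcard G hG
  rw [Finset.sum_eq_single G.card, Finset.sum_eq_single (negCard G), if_pos ⟨by omega, rfl⟩,
    mul_pow, ← mul_assoc, ← pow_add, hG']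
  · intro j _ hj
    exact if_neg fun h => hj h.2.symm
  · intro hj
    exact absurd (Finset.mem_range.2 (by omega)) hj
  · intro k _ hk
    refine Finset.sum_eq_zero fun j hj => if_neg fun h => hk ?_
    rw [Finset.mem_range] at hj
    omega
  · intro hj
    exact absurd (Finset.mem_range.2 (by omega)) hj

theorem homPoly_eq {K : Type*} [Field K] (hcard : ∀ G ∈ F.faces c, G.card ≤ Fintype.card ι)
    {a b z : K} (hz : z ≠ 0) : F.homPoly c a b z =
      z ^ Fintype.card ι * F.rootPoly c (a / z) (b / z) Finset.univ := by
  rw [rootPoly_univ_eq_sum, homPoly, Finset.mul_sum]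
  refine Finset.sum_congr rfl fun G hG => ?_
  obtain ⟨k, hk⟩ := Nat.exists_eq_add_of_le (hcard G hG)
  rw [hk, Nat.add_sub_cancel_left, pow_add, ← posCard_add_negCard, pow_add, div_pow, div_pow]
  field_simp

/-- Each face contributes the monomial of its size with coefficient 1, so nothing cancels and the
degree bounds the dimension. -/
theorem card_le_of_natDegree (h : (F.rootPoly c (X : ℤ[X]) X Finset.univ).natDegree ≤
    Fintype.card ι) : ∀ G ∈ F.faces c, G.card ≤ Fintype.card ι := by
  intro G hG
  by_contra! hlt
  have h₀ := coeff_eq_zero_of_natDegree_lt (h.trans_lt hlt)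
  rw [rootPoly_univ_eq_sum, finsetSum_coeff] at h₀
  simp only [← pow_add, posCard_add_negCard, coeff_X_pow] at h₀
  have := (Finset.sum_eq_zero_iff_of_nonneg fun G' _ => by split_ifs <;> simp).1 h₀ G hG
  simp at this

/-- Adding all -α_i with i outside J to a positive face supported in J gives a face of the whole
complex. -/
theorem card_le_of_mem_cliques (hcard : ∀ G ∈ F.faces c, G.card ≤ Fintype.card ι) {J : Finset ι}
    {G : Finset (ι → ℤ)} (hG : G ∈ cliques (EulerCompatible A d c) (F.posFinset J)) :
    G.card ≤ J.card := by
  classical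
  rw [mem_cliques] at hG
  set N : Finset (ι → ℤ) := (Finset.univ \ J).image fun i => -simpleRoot i with hN
  have hinj : Function.Injective fun i : ι => -simpleRoot i := fun i j h =>
    neg_simpleRoot_inj.1 h
  have hpos : ∀ v ∈ G, v ∈ positiveRoots A ∧ ∀ i, i ∉ J → v i = 0 := fun v hv =>
    F.mem_posFinset.1 (hG.1 hv)
  have hneg : ∀ v ∈ N, ∃ i, i ∉ J ∧ v = -simpleRoot i := fun v hv => by
    obtain ⟨i, hi, rfl⟩ := Finset.mem_image.1 hv
    exact ⟨i, by simpa using hi, rfl⟩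
  have hd : Disjoint G N := by
    rw [Finset.disjoint_left]
    intro v hv hv'
    obtain ⟨i, -, rfl⟩ := hneg v hv'
    exact not_nonneg_neg_simpleRoot i (hpos _ hv).1.2
  have hmix : ∀ v ∈ N, ∀ w ∈ G, EulerCompatible A d c v w := by
    intro v hv w hw
    obtain ⟨i, hi, rfl⟩ := hneg v hv
    rw [eulerCompatible_neg_iff (ne_neg_simpleRoot (hpos w hw).1.2 i)]
    exact (hpos w hw).2 i hi
  have hface : G ∪ N ∈ F.faces c := by
    rw [faces, mem_cliques]
    refine ⟨fun v hv => F.mem_rootFinset.2 ?_, fun v hv w hw hvw => ?_⟩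
    · rcases Finset.mem_union.1 hv with hv | hv
      · exact Or.inl ⟨(hpos v hv).1, by simp⟩
      · obtain ⟨i, -, rfl⟩ := hneg v hv
        exact Or.inr ⟨i, by simp, rfl⟩
    · rcases Finset.mem_union.1 hv with hv | hv <;> rcases Finset.mem_union.1 hw with hw | hw
      · exact hG.2 hv hw hvw
      · exact (hmix w hw v hv).symm
      · exact hmix v hv w hw
      · obtain ⟨i, -, rfl⟩ := hneg v hv
        obtain ⟨j, -, rfl⟩ := hneg w hw
        rw [eulerCompatible_neg_iff hvw.symm]
        have : i ≠ j := fun h => hvw (by rw [h])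
        simp [simpleRoot_of_ne this]
  have h := hcard _ hface
  rw [Finset.card_union_of_disjoint hd, hN, Finset.card_image_of_injective _ hinj,
    ← Finset.compl_eq_univ_sdiff, Finset.card_compl] at h
  have := Finset.card_le_univ J
  omega

theorem mem_restrict_positivePart (hc : IsCoxeterWord c) {J : Finset ι} {G : Finset (ι → ℤ)} :
    G ∈ restrict (positivePart A c) support J ↔
      G ∈ cliques (EulerCompatible A d c) (F.posFinset J) := by
  have hs : support G ⊆ J ↔ ∀ v ∈ G, ∀ i, i ∉ J → v i = 0 := by
    simp only [support, Finset.subset_iff, Finset.mem_filter, Finset.mem_univ, true_and]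
    constructor
    · intro h v hv i hi
      by_contra h₀
      exact hi (h ⟨v, hv, h₀⟩)
    · rintro h i ⟨v, hv, h₀⟩
      by_contra hi
      exact h₀ (h v hv i hi)
  have : G ∈ restrict (positivePart A c) support J ↔
      (G ∈ clusterComplex A c ∧ (G : Set (ι → ℤ)) ⊆ positiveRoots A) ∧ support G ⊆ J := Iff.rfl
  rw [this, F.mem_clusterComplex hc, hs, faces, mem_cliques, mem_cliques]
  constructor
  · rintro ⟨⟨⟨-, h₁⟩, h₂⟩, h₃⟩
    exact ⟨fun v hv => F.mem_posFinset.2 ⟨h₂ hv, h₃ v hv⟩, h₁⟩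
  · rintro ⟨h₁, h₂⟩
    refine ⟨⟨⟨fun v hv => ?_, h₂⟩, fun v hv => (F.mem_posFinset.1 (h₁ hv)).1⟩,
      fun v hv => (F.mem_posFinset.1 (h₁ hv)).2⟩
    exact F.mem_rootFinset.2 (Or.inl ⟨(F.mem_posFinset.1 (h₁ hv)).1, by simp⟩)

/-- The local `h`-polynomial is the specialization `y = -1 / x` of the `H`-triangle. -/
theorem localHPoly_eq (hc : IsCoxeterWord c) (hcard : ∀ G ∈ F.faces c, G.card ≤ Fintype.card ι)
    {K : Type*} [Field K] {f : ℤ[X] →+* K} (hf : 1 - f X ≠ 0) :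
    f (localHPoly (positivePart A c) support) = F.homPoly c (f X) (-1) (1 - f X) := by
  classical
  rw [F.homPoly_eq hcard hf, F.rootPoly_eq_sum, localHPoly, map_sum, Finset.mul_sum,
    Finset.powerset_univ]
  -- The complement of J is the set of negative simple roots of a face; their weight -1 produces the
  -- alternating sign of the local h-polynomial.
  refine Finset.sum_nbij' (fun J => Jᶜ) (fun J => Jᶜ) (by simp) (by simp) (by simp) (by simp) ?_
  intro J _
  rw [hPoly_eq_sum (fun G => F.mem_restrict_positivePart hc)
    (fun G hG => F.card_le_of_mem_cliques hcard hG), ← Finset.compl_eq_univ_sdiff, compl_compl,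
    posPoly, cliquePoly, Finset.card_compl]
  obtain ⟨k, hk⟩ := Nat.exists_eq_add_of_le (Finset.card_le_univ J)
  simp only [Finset.prod_const, map_mul, map_pow, map_neg, map_one, map_sum, map_sub,
    Finset.mul_sum]
  refine Finset.sum_congr rfl fun G hG => ?_
  obtain ⟨l, hl⟩ := Nat.exists_eq_add_of_le (F.card_le_of_mem_cliques hcard hG)
  rw [hk, Nat.add_sub_cancel_left, hl, Nat.add_sub_cancel_left, pow_add, pow_add, div_pow,
    div_pow]
  field_simp

theorem rootPoly_eq_of_move
    (hmove : ∀ c c' : List ι, c.Nodup → c'.Nodup → c.toFinset = c'.toFinset →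
      Relation.EqvGen (Move A) c c') {c' : List ι} (hc : IsCoxeterWord c)
    (hc' : IsCoxeterWord c') (x u : R) (J : Finset ι) :
    F.rootPoly c x u J = F.rootPoly c' x u J := by
  rw [rootPoly_eq_sum, rootPoly_eq_sum]
  exact Finset.sum_congr rfl fun T _ => by rw [F.posPoly_eq hmove hc hc']

end IsFiniteType

end Cluster

end GammaTriangle

namespace GammaTriangle

/-! ## Existence and uniqueness of `γ`-polynomials and `Γ`-triangles -/

section GradedPieces

variable {R S : Type*} [CommRing R] [CommRing S]

theorem mul_pow_mem_gradedPiece {q s m r : R} {n : ℕ} (z : R) (h : r ∈ gradedPiece q s m n) :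
    z ^ n * r ∈ gradedPiece (z ^ 2 * q) (z * s) (z * m) n := by
  induction h using AddSubgroup.closure_induction with
  | zero => simp
  | add x y _ _ hx hy => rw [mul_add]; exact add_mem hx hy
  | neg x _ hx => rw [mul_neg]; exact neg_mem hx
  | mem x hx =>
    obtain ⟨i, j, k, rfl, rfl⟩ := hx
    exact AddSubgroup.subset_closure ⟨i, j, k, rfl, by ring⟩

/-- Brings an identity between rational functions back to polynomials once the three generators have
become polynomials. -/
theorem exists_of_mem_gradedPiece_map (f : R →+* S) {q s m : R} {r : S} {n : ℕ}
    (h : r ∈ gradedPiece (f q) (f s) (f m) n) : ∃ r' ∈ gradedPiece q s m n, f r' = r := by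
  induction h using AddSubgroup.closure_induction with
  | zero => exact ⟨0, zero_mem _, map_zero f⟩
  | add x y _ _ hx hy =>
    obtain ⟨x', hx, rfl⟩ := hx
    obtain ⟨y', hy, rfl⟩ := hy
    exact ⟨x' + y', add_mem hx hy, map_add f _ _⟩
  | neg x _ hx =>
    obtain ⟨x', hx, rfl⟩ := hx
    exact ⟨-x', neg_mem hx, map_neg f _⟩
  | mem x hx =>
    obtain ⟨i, j, k, rfl, rfl⟩ := hx
    exact ⟨q ^ i * s ^ j * m ^ k, pow_mem_gradedPiece i j k, by simp⟩

theorem natDegree_le_of_mem_gradedPiece {q s m r : ℤ[X]} {n : ℕ} (hq : q.natDegree ≤ 2)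
    (hs : s.natDegree ≤ 1) (hm : m.natDegree ≤ 1) (h : r ∈ gradedPiece q s m n) :
    r.natDegree ≤ n := by
  induction h using AddSubgroup.closure_induction with
  | zero => simp
  | add x y _ _ hx hy => exact natDegree_add_le_of_degree_le hx hy
  | neg x _ hx => rwa [natDegree_neg]
  | mem x hx =>
    obtain ⟨i, j, k, rfl, rfl⟩ := hx
    have h₁ := natDegree_pow_le_of_le i hq
    have h₂ := natDegree_pow_le_of_le j hs
    have h₃ := natDegree_pow_le_of_le k hm
    refine (natDegree_mul_le_of_le (natDegree_mul_le_of_le h₁ h₂) h₃).trans ?_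
    omega

end GradedPieces

/-! ### One variable -/

/-- The polynomial `∑ γ_i x ^ i (1 + x) ^ (n - 2 i)`. -/
noncomputable def gammaSum (n : ℕ) (g : ℤ[X]) : ℤ[X] :=
  ∑ i ∈ Finset.range (n / 2 + 1), C (g.coeff i) * X ^ i * (1 + X) ^ (n - 2 * i)

theorem gammaSum_add (n : ℕ) (g g' : ℤ[X]) :
    gammaSum n (g + g') = gammaSum n g + gammaSum n g' := by
  simp only [gammaSum, coeff_add, C_add, add_mul, Finset.sum_add_distrib]

theorem gammaSum_neg (n : ℕ) (g : ℤ[X]) : gammaSum n (-g) = -gammaSum n g := by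
  simp only [gammaSum, coeff_neg, C_neg, neg_mul, Finset.sum_neg_distrib]

/-- The i-th summand starts with γ_i X^i, so the system is triangular. -/
theorem coeff_eq_zero_of_sum_eq_zero {n : ℕ} {γ : ℕ → ℤ} {S : Finset ℕ}
    (h : ∑ i ∈ S, C (γ i) * X ^ i * (1 + X : ℤ[X]) ^ (n - 2 * i) = 0) : ∀ i ∈ S, γ i = 0 := by
  intro i
  induction i using Nat.strong_induction_on with
  | _ i ih =>
    intro hi
    have h₁ : (∑ k ∈ S, C (γ k) * X ^ k * (1 + X : ℤ[X]) ^ (n - 2 * k)).coeff i = γ i := by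
      rw [finsetSum_coeff, Finset.sum_eq_single i]
      · rw [mul_assoc, coeff_C_mul, mul_comm (X ^ i), coeff_mul_X_pow', if_pos le_rfl, Nat.sub_self,
          coeff_zero_eq_eval_zero]
        simp
      · intro k hk hki
        rcases lt_or_gt_of_ne hki with hlt | hlt
        · rw [ih k hlt hk]
          simp
        · rw [mul_assoc, coeff_C_mul, mul_comm (X ^ k), coeff_mul_X_pow', if_neg (by omega),
            mul_zero]
      · exact fun h => absurd hi h
    rw [← h₁, h, coeff_zero]

theorem IsGammaPoly.unique {n : ℕ} {h g g' : ℤ[X]} (hg : IsGammaPoly n h g)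
    (hg' : IsGammaPoly n h g') : g = g' := by
  rw [← sub_eq_zero]
  have h₀ : gammaSum n (g - g') = 0 := by
    rw [sub_eq_add_neg, gammaSum_add, gammaSum_neg, gammaSum, gammaSum, ← hg.2, ← hg'.2]
    ring
  ext i
  rw [coeff_zero]
  by_cases hi : n < 2 * i
  · rw [coeff_sub, hg.1 i hi, hg'.1 i hi, sub_zero]
  · exact coeff_eq_zero_of_sum_eq_zero h₀ i (Finset.mem_range.2 (by omega))

theorem exists_isGammaPoly {n : ℕ} {h : ℤ[X]} (hh : h ∈ gradedPiece X 0 (1 + X) n) :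
    ∃ g, IsGammaPoly n h g := by
  induction hh using AddSubgroup.closure_induction with
  | zero => exact ⟨0, by simp [IsGammaPoly]⟩
  | add x y _ _ hx hy =>
    obtain ⟨g, hg, rfl⟩ := hx
    obtain ⟨g', hg', rfl⟩ := hy
    exact ⟨g + g', fun i hi => by rw [coeff_add, hg i hi, hg' i hi, add_zero],
      (gammaSum_add n g g').symm⟩
  | neg x _ hx =>
    obtain ⟨g, hg, rfl⟩ := hx
    exact ⟨-g, fun i hi => by rw [coeff_neg, hg i hi, neg_zero], (gammaSum_neg n g).symm⟩
  | mem x hx =>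
    obtain ⟨i, j, k, rfl, rfl⟩ := hx
    rcases j with _ | j
    · refine ⟨X ^ i, fun l hl => ?_, ?_⟩
      · rw [coeff_X_pow, if_neg (by omega)]
      · rw [Finset.sum_eq_single i]
        · rw [coeff_X_pow, if_pos rfl, show 2 * i + 0 + k - 2 * i = k by omega]
          simp
        · intro l _ hl
          rw [coeff_X_pow, if_neg hl]
          simp
        · intro hi
          exact absurd (Finset.mem_range.2 (by omega)) hi
    · exact ⟨0, by simp [IsGammaPoly]⟩

/-! ### Two variables -/

/-- The polynomial `∑ γ_{i,j} x ^ i (1 + x y) ^ j (1 + x) ^ (n - 2 i - j)`. -/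
noncomputable def gammaTriangleSum (n : ℕ) (Γ : ℤ[X][Y]) : ℤ[X][Y] :=
  ∑ i ∈ Finset.range (n / 2 + 1), ∑ j ∈ Finset.range (n - 2 * i + 1),
    C (C ((Γ.coeff j).coeff i)) * C X ^ i * (1 + C X * Y) ^ j * (1 + C X) ^ (n - 2 * i - j)

theorem gammaTriangleSum_add (n : ℕ) (Γ Γ' : ℤ[X][Y]) :
    gammaTriangleSum n (Γ + Γ') = gammaTriangleSum n Γ + gammaTriangleSum n Γ' := by
  simp only [gammaTriangleSum, coeff_add, C_add, add_mul, Finset.sum_add_distrib]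

theorem gammaTriangleSum_neg (n : ℕ) (Γ : ℤ[X][Y]) :
    gammaTriangleSum n (-Γ) = -gammaTriangleSum n Γ := by
  refine eq_neg_of_add_eq_zero_left ?_
  rw [← gammaTriangleSum_add, neg_add_cancel]
  simp [gammaTriangleSum]

/-- Over the fraction field, y is replaced so that 1+xy becomes (1+x)Y. The coefficient of each Y^j
is then a sum in one variable. -/
theorem coeff_eq_zero_of_gammaTriangleSum {n : ℕ} {Γ : ℤ[X][Y]} (h : gammaTriangleSum n Γ = 0)
    {i j : ℕ} (hij : 2 * i + j ≤ n) : (Γ.coeff j).coeff i = 0 := by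
  set K := FractionRing ℤ[X]
  set ι : ℤ[X] →+* K := algebraMap ℤ[X] K with hι
  have hinj : Function.Injective ι := IsFractionRing.injective ℤ[X] K
  have hX : ι X ≠ 0 := fun h => X_ne_zero (hinj (h.trans (map_zero ι).symm))
  let f : ℤ[X][Y] →+* K[X] := eval₂RingHom (C.comp ι) (C (1 / ι X) * (C (ι (1 + X)) * X - 1))
  have hfX : f (1 + C X * Y) = C (ι (1 + X)) * X := by
    simp only [f, map_add, map_mul, map_one, coe_eval₂RingHom, eval₂_C, eval₂_X,
      RingHom.comp_apply]
    rw [← mul_assoc, ← C_mul, mul_one_div_cancel hX, C_1]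
    ring
  have hfC : ∀ p, f (C p) = C (ι p) := fun p => by simp [f]
  have h₁ := congrArg f h
  simp only [gammaTriangleSum, map_sum, map_mul, map_pow, hfX, hfC, map_zero] at h₁
  have h₂ : ∀ i ∈ Finset.range (n / 2 + 1), ∀ j ∈ Finset.range (n - 2 * i + 1),
      C (ι (C ((Γ.coeff j).coeff i))) * C (ι X) ^ i * (C (ι (1 + X)) * X) ^ j *
        f (1 + C X) ^ (n - 2 * i - j) =
      C (ι (C ((Γ.coeff j).coeff i) * X ^ i * (1 + X) ^ (n - 2 * i))) * X ^ j := by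
    intro i _ j hj
    have e : f (1 + C X) = C (ι (1 + X)) := by
      rw [← hfC, map_add C, C_1]
    obtain ⟨k, hk⟩ := Nat.exists_eq_add_of_le (Nat.le_of_lt_succ (Finset.mem_range.1 hj))
    rw [e, hk, Nat.add_sub_cancel_left]
    simp only [map_mul, map_pow]
    ring
  rw [Finset.sum_congr rfl fun i hi => Finset.sum_congr rfl (h₂ i hi)] at h₁
  have h₃ := congrArg (fun p => p.coeff j) h₁
  simp only [finsetSum_coeff, coeff_C_mul_X_pow, coeff_zero, Finset.sum_ite_eq] at h₃
  rw [← Finset.sum_filter, ← map_sum, ← map_zero ι] at h₃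
  refine coeff_eq_zero_of_sum_eq_zero (γ := fun i => (Γ.coeff j).coeff i) (hinj h₃) i ?_
  simp only [Finset.mem_filter, Finset.mem_range]
  omega

theorem IsGammaTriangle.unique {n : ℕ} {H Γ Γ' : ℤ[X][Y]} (hΓ : IsGammaTriangle n H Γ)
    (hΓ' : IsGammaTriangle n H Γ') : Γ = Γ' := by
  rw [← sub_eq_zero]
  have h₀ : gammaTriangleSum n (Γ - Γ') = 0 := by
    rw [sub_eq_add_neg, gammaTriangleSum_add, gammaTriangleSum_neg, gammaTriangleSum,
      gammaTriangleSum, ← hΓ.2, ← hΓ'.2]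
    ring
  ext j i
  rw [coeff_zero, coeff_zero]
  by_cases hij : n < 2 * i + j
  · rw [coeff_sub, coeff_sub, hΓ.1 i j hij, hΓ'.1 i j hij, sub_zero]
  · exact coeff_eq_zero_of_gammaTriangleSum h₀ (by omega)

theorem exists_isGammaTriangle {n : ℕ} {H : ℤ[X][Y]}
    (hH : H ∈ gradedPiece (C X : ℤ[X][Y]) (1 + C X * Y) (1 + C X) n) : ∃ Γ, IsGammaTriangle n H Γ := by
  induction hH using AddSubgroup.closure_induction with
  | zero => exact ⟨0, by simp [IsGammaTriangle]⟩
  | add x y _ _ hx hy =>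
    obtain ⟨g, hg, rfl⟩ := hx
    obtain ⟨g', hg', rfl⟩ := hy
    exact ⟨g + g', fun i j hi => by rw [coeff_add, coeff_add, hg i j hi, hg' i j hi, add_zero],
      (gammaTriangleSum_add n g g').symm⟩
  | neg x _ hx =>
    obtain ⟨g, hg, rfl⟩ := hx
    exact ⟨-g, fun i j hi => by rw [coeff_neg, coeff_neg, hg i j hi, neg_zero],
      (gammaTriangleSum_neg n g).symm⟩
  | mem x hx =>
    obtain ⟨i, j, k, rfl, rfl⟩ := hx
    have hc : ∀ i' j', ((C (X ^ i) * X ^ j : ℤ[X][Y]).coeff j').coeff i' =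
        if j' = j ∧ i' = i then 1 else 0 := by
      intro i' j'
      rw [coeff_C_mul_X_pow]
      by_cases hj : j' = j
      · simp [hj, coeff_X_pow]
      · simp [hj]
    refine ⟨C (X ^ i) * Y ^ j, fun i' j' hl => ?_, ?_⟩
    · rw [hc, if_neg (by omega)]
    · simp only [hc]
      rw [Finset.sum_eq_single i, Finset.sum_eq_single j]
      · rw [if_pos ⟨rfl, rfl⟩, show 2 * i + j + k - 2 * i - j = k by omega]
        simp
      · intro l _ hl
        rw [if_neg fun h => hl h.1]
        simp
      · intro hi
        exact absurd (Finset.mem_range.2 (by omega)) hi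
      · intro l _ hl
        refine Finset.sum_eq_zero fun l' _ => ?_
        rw [if_neg fun h => hl h.2]
        simp
      · intro hi
        exact absurd (Finset.mem_range.2 (by omega)) hi

theorem sum_range_succ_mul_pow {R : Type*} [CommRing R] (a : ℕ → R) (p s m : R) (k : ℕ) :
    ∑ j ∈ Finset.range (k + 1), a j * p * s ^ j * m ^ (k - j) =
      s * (∑ j ∈ Finset.range k, a (j + 1) * p * s ^ j * m ^ (k - 1 - j)) + a 0 * p * m ^ k := by
  rw [Finset.sum_range_succ', Finset.mul_sum, pow_zero, mul_one, Nat.sub_zero]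
  congr 1
  refine Finset.sum_congr rfl fun j hj => ?_
  rw [show k - (j + 1) = k - 1 - j by omega]
  ring

/-- Multiplying H by 1+xy shifts the rows of Γ by one, which leaves the row y^0 free for g. -/
theorem IsGammaTriangle.add_bottom {n : ℕ} {H Γ : ℤ[X][Y]} {h g : ℤ[X]}
    (hΓ : IsGammaTriangle n H Γ) (hg : IsGammaPoly (n + 1) h g) :
    IsGammaTriangle (n + 1) ((1 + C X * Y) * H + C h) (Y * Γ + C g) := by
  have hs : ∀ j, (Y * Γ + C g : ℤ[X][Y]).coeff (j + 1) = Γ.coeff j := fun j => by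
    rw [coeff_add, coeff_X_mul, coeff_C_succ, add_zero]
  have hz : (Y * Γ + C g : ℤ[X][Y]).coeff 0 = g := by simp
  refine ⟨fun i j hij => ?_, ?_⟩
  · rcases j with _ | j
    · rw [hz]
      exact hg.1 i (by omega)
    · rw [hs]
      exact hΓ.1 i j (by omega)
  · have hsplit : ∀ i, (∑ j ∈ Finset.range (n + 1 - 2 * i + 1),
        C (C (((Y * Γ + C g : ℤ[X][Y]).coeff j).coeff i)) * C X ^ i * (1 + C X * Y) ^ j *
          (1 + C X) ^ (n + 1 - 2 * i - j)) =
        (1 + C X * Y) * (∑ j ∈ Finset.range (n + 1 - 2 * i),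
          C (C ((Γ.coeff j).coeff i)) * C X ^ i * (1 + C X * Y) ^ j *
            (1 + C X) ^ (n - 2 * i - j)) +
        C (C (g.coeff i) * X ^ i * (1 + X) ^ (n + 1 - 2 * i)) := by
      intro i
      rw [sum_range_succ_mul_pow (fun j => C (C (((Y * Γ + C g : ℤ[X][Y]).coeff j).coeff i)))]
      simp only [hs, hz, show n + 1 - 2 * i - 1 = n - 2 * i by omega, C_mul, C_pow, C_add, C_1]
    rw [Finset.sum_congr rfl fun i _ => hsplit i, Finset.sum_add_distrib, ← map_sum, ← hg.2,
      ← Finset.mul_sum]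
    congr 2
    rw [hΓ.2]
    have hsub : Finset.range (n / 2 + 1) ⊆ Finset.range ((n + 1) / 2 + 1) :=
      Finset.range_subset_range.2 (by omega)
    rw [← Finset.sum_subset hsub]
    · refine Finset.sum_congr rfl fun i hi => ?_
      rw [Finset.mem_range] at hi
      rw [show n - 2 * i + 1 = n + 1 - 2 * i by omega]
    -- For odd n the outer range has one more index i, with n + 1 - 2i = 0, and its inner sum over Γ
    -- is empty.
    · intro i _ hi
      rw [Finset.mem_range] at hi
      rw [show n + 1 - 2 * i = 0 by omega, Finset.sum_range_zero]

end GammaTriangle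

namespace GammaTriangle

/-! ## Comparison of the types `B` and `D` -/

section Final

open Vtx

/-- The field of rational functions in `x` and `y`. -/
abbrev RatXY : Type := FractionRing ℤ[X][Y]

/-- The embedding of polynomials in rational functions. -/
noncomputable abbrev toRat : ℤ[X][Y] →+* RatXY := algebraMap ℤ[X][Y] RatXY

theorem toRat_injective : Function.Injective toRat := IsFractionRing.injective ℤ[X][Y] RatXY

/-- The rational function `1 - x`. -/
noncomputable def zRat : RatXY := toRat (1 - C X)

theorem one_sub_X_ne_zero : (1 - X : ℤ[X]) ≠ 0 := fun h => by
  simpa using congrArg (fun p => p.coeff 0) h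

theorem zRat_ne_zero : zRat ≠ 0 := by
  rw [zRat, Ne, map_eq_zero_iff _ toRat_injective, ← C_1, ← C_sub, C_eq_zero]
  exact one_sub_X_ne_zero

/-- The rational function `x / (1 - x)`. -/
noncomputable def xRat : RatXY := toRat (C X) / zRat

/-- The rational function `x y / (1 - x)`. -/
noncomputable def uRat : RatXY := toRat (C X * Y) / zRat

theorem zRat_sq_mul : zRat ^ 2 * (xRat * (1 + xRat)) = toRat (C X) := by
  have h := zRat_ne_zero
  have e : toRat (C X) = 1 - zRat := by simp [zRat]
  rw [xRat, e]
  field_simp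
  ring

theorem zRat_mul_s : zRat * (1 + xRat + uRat) = toRat (1 + C X * Y) := by
  have h := zRat_ne_zero
  have e : toRat (C X) = 1 - zRat := by simp [zRat]
  rw [xRat, uRat, map_add, map_one, e]
  field_simp
  ring

theorem zRat_mul_m : zRat * (1 + 2 * xRat) = toRat (1 + C X) := by
  have h := zRat_ne_zero
  have e : toRat (C X) = 1 - zRat := by simp [zRat]
  rw [xRat, map_add, map_one, e]
  field_simp
  ring

/-- Since q, s, m have degrees 2, 1, 1 at u = x, the grading also bounds the size of the faces; no
separate proof of the dimension is needed. -/
theorem natDegree_cl_true (n : ℕ) : (cl true (X : ℤ[X]) X n (fullB 0 0 n)).natDegree ≤ n := by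
  refine natDegree_le_of_mem_gradedPiece ?_ ?_ ?_ (graded_comparison (X : ℤ[X]) X n).1 <;>
    compute_degree

theorem natDegree_cl_false (n : ℕ) :
    (cl false (X : ℤ[X]) X (n + 1) (fullD 0 0 (n + 1))).natDegree ≤ n + 2 := by
  have h₁ := graded_comparison (X : ℤ[X]) X (n + 1)
  have h₂ : (cl false (X : ℤ[X]) X (n + 1) (fullD 0 0 (n + 1)) -
      (1 + X + X) * cl true X X (n + 1) (fullB 0 0 (n + 1))).natDegree ≤ n + 2 := by
    refine natDegree_le_of_mem_gradedPiece ?_ (by simp) ?_ (h₁.2 (by omega)) <;> compute_degree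
  have h₃ : ((1 + X + X : ℤ[X]) * cl true X X (n + 1) (fullB 0 0 (n + 1))).natDegree ≤ n + 2 := by
    refine (natDegree_mul_le_of_le (m := 1) (n := n + 1) (by compute_degree)
      (natDegree_cl_true (n + 1))).trans (by omega)
  rw [← sub_add_cancel (cl false (X : ℤ[X]) X (n + 1) (fullD 0 0 (n + 1)))
    ((1 + X + X) * cl true X X (n + 1) (fullB 0 0 (n + 1)))]
  exact natDegree_add_le_of_degree_le h₂ h₃

theorem isCoxeterWord_finRange (n : ℕ) : IsCoxeterWord (List.finRange n) :=
  ⟨List.nodup_finRange n, List.mem_finRange⟩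

/-- The `H`-triangle of type `B`. -/
theorem exists_hTriangle_B (n : ℕ) : ∃ H Γ : ℤ[X][Y], IsGammaTriangle n H Γ ∧
    toRat H = zRat ^ n * cl true xRat uRat n (fullB 0 0 n) ∧
    ∀ c : List (Fin n), IsCoxeterWord c →
      hTriangle (clusterComplex (CartanMatrix.B n) c) (negSimpleRoots (Fin n)) n = H := by
  have h := mul_pow_mem_gradedPiece zRat (graded_comparison xRat uRat n).1
  rw [zRat_sq_mul, zRat_mul_s, zRat_mul_m] at h
  obtain ⟨H, hH, e⟩ := exists_of_mem_gradedPiece_map toRat h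
  obtain ⟨Γ, hΓ⟩ := exists_isGammaTriangle hH
  refine ⟨H, Γ, hΓ, e, fun c hc => toRat_injective ?_⟩
  have F := TypeB.isFiniteType n
  have hpoly : ∀ {R : Type} [CommRing R] (x u : R), F.rootPoly c x u Finset.univ =
      cl true x u n (fullB 0 0 n) := fun x u => by
    rw [F.rootPoly_eq_of_move (TypeB.move n) hc (isCoxeterWord_finRange n), TypeB.rootPoly_eq]
  have hcard := F.card_le_of_natDegree (c := c) (by
    rw [hpoly, Fintype.card_fin]
    exact natDegree_cl_true n)
  have h₁ := F.hTriangle_eq hc hcard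
  rw [Fintype.card_fin] at h₁
  rw [h₁, F.map_homPoly, ← zRat, F.homPoly_eq hcard zRat_ne_zero, Fintype.card_fin, e]
  congr 1
  exact hpoly _ _

/-- The polynomial h involves x alone because the comparison with s F_B leaves only generators
without s. -/
theorem hTriangle_D_aux {M : ℕ} {HB : ℤ[X][Y]}
    (hB : toRat HB = zRat ^ (M + 1) * cl true xRat uRat (M + 1) (fullB 0 0 (M + 1))) :
    ∃ h g : ℤ[X], IsGammaPoly (M + 2) h g ∧
      toRat ((1 + C X * Y) * HB + C h) =
        zRat ^ (M + 2) * cl false xRat uRat (M + 1) (fullD 0 0 (M + 1)) := by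
  have h := mul_pow_mem_gradedPiece zRat
    ((graded_comparison xRat uRat (M + 1)).2 (Nat.succ_le_succ (Nat.zero_le M)))
  rw [zRat_sq_mul, mul_zero, zRat_mul_m] at h
  have h' : zRat ^ (M + 2) * (cl false xRat uRat (M + 1) (fullD 0 0 (M + 1)) -
      (1 + xRat + uRat) * cl true xRat uRat (M + 1) (fullB 0 0 (M + 1))) ∈
      gradedPiece ((toRat.comp C) X) ((toRat.comp C) 0) ((toRat.comp C) (1 + X)) (M + 2) := by
    simpa using h
  obtain ⟨h, hh, e⟩ := exists_of_mem_gradedPiece_map (toRat.comp C) h'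
  obtain ⟨g, hg⟩ := exists_isGammaPoly hh
  refine ⟨h, g, hg, ?_⟩
  rw [RingHom.comp_apply] at e
  rw [map_add, map_mul, e, hB, ← zRat_mul_s]
  ring

/-- The `H`-triangle and the local `h`-polynomial of type `D`. -/
theorem exists_hTriangle_D (M : ℕ) {HB : ℤ[X][Y]}
    (hB : toRat HB = zRat ^ (M + 1) * cl true xRat uRat (M + 1) (fullB 0 0 (M + 1))) :
    ∃ h g : ℤ[X], IsGammaPoly (M + 2) h g ∧
    ∀ c : List (Fin (M + 2)), IsCoxeterWord c →
      hTriangle (clusterComplex (CartanMatrix.D (M + 2)) c) (negSimpleRoots (Fin (M + 2)))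
        (M + 2) = (1 + C X * Y) * HB + C h ∧
      localHPoly (positivePart (CartanMatrix.D (M + 2)) c) support = h := by
  obtain ⟨h, g, hg, e⟩ := hTriangle_D_aux hB
  refine ⟨h, g, hg, fun c hc => ?_⟩
  have F := TypeD.isFiniteType M
  have hpoly : ∀ {R : Type} [CommRing R] (x u : R), F.rootPoly c x u Finset.univ =
      cl false x u (M + 1) (fullD 0 0 (M + 1)) := fun x u => by
    rw [F.rootPoly_eq_of_move (TypeD.move _) hc (isCoxeterWord_finRange _), TypeD.rootPoly_eq]
  have hcard := F.card_le_of_natDegree (c := c) (by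
    rw [hpoly, Fintype.card_fin]
    exact natDegree_cl_false M)
  have h₁ := F.hTriangle_eq hc hcard
  rw [Fintype.card_fin] at h₁
  have h₂ : F.homPoly c (C X : ℤ[X][Y]) (C X * Y) (1 - C X) = (1 + C X * Y) * HB + C h := by
    refine toRat_injective ?_
    rw [F.map_homPoly, ← zRat, F.homPoly_eq hcard zRat_ne_zero, Fintype.card_fin, e]
    congr 1
    exact hpoly _ _
  refine ⟨h₁.trans h₂, ?_⟩
  have hinj : Function.Injective (algebraMap ℤ[X] (FractionRing ℤ[X])) :=
    IsFractionRing.injective _ _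
  refine hinj ?_
  set f := algebraMap ℤ[X] (FractionRing ℤ[X])
  have hX : f X ≠ 0 := fun h => X_ne_zero (hinj (h.trans (map_zero f).symm))
  have hz : 1 - f X ≠ 0 := fun h => one_sub_X_ne_zero (hinj (by simpa using h))
  rw [F.localHPoly_eq hc hcard hz]
  -- At y = -1/x the factor 1+xy vanishes, so the type B term disappears and only h is left.
  have h₃ := congrArg (eval₂RingHom f (-1 / f X)) h₂
  have h₄ : f X * (-1 / f X) = -1 := mul_div_cancel₀ _ hX
  rw [F.map_homPoly] at h₃
  simpa [h₄] using h₃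

theorem isGammaTriangle_iff {n : ℕ} {H Γ₀ Γ : ℤ[X][Y]} (h : IsGammaTriangle n H Γ₀) :
    IsGammaTriangle n H Γ ↔ Γ = Γ₀ := ⟨fun h' => h'.unique h, fun e => e ▸ h⟩

theorem isGammaPoly_iff {n : ℕ} {h g₀ g : ℤ[X]} (hg : IsGammaPoly n h g₀) :
    IsGammaPoly n h g ↔ g = g₀ := ⟨fun h' => h'.unique hg, fun e => e ▸ hg⟩

theorem isGammaTriangle_zero_one : IsGammaTriangle 0 1 1 := by
  refine ⟨fun i j hij => ?_, by simp⟩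
  rw [coeff_one]
  split_ifs with hj
  · rw [coeff_one, if_neg (by omega)]
  · rw [coeff_zero]

end Final

end GammaTriangle

theorem mainTheorem4 :
    ∃ (ΓB ΓD : ℕ → ℤ[X][Y]) (γD : ℕ → ℤ[X]),
      -- `ΓB n` is the `Γ`-triangle of type `B_n`, for `n ≥ 0`
      (∀ (n : ℕ) (c : List (Fin n)), GammaTriangle.IsCoxeterWord c → ∀ Γ : ℤ[X][Y],
        GammaTriangle.IsClusterGammaTriangle (CartanMatrix.B n) c Γ ↔ Γ = ΓB n) ∧
      -- `ΓD n` is the `Γ`-triangle of type `D_n`, for `n ≥ 2`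
      (∀ n : ℕ, 2 ≤ n → ∀ c : List (Fin n), GammaTriangle.IsCoxeterWord c → ∀ Γ : ℤ[X][Y],
        GammaTriangle.IsClusterGammaTriangle (CartanMatrix.D n) c Γ ↔ Γ = ΓD n) ∧
      -- `γD n` is given by the local `γ`-vector of type `D_n`, for `n ≥ 2`
      (∀ n : ℕ, 2 ≤ n → ∀ c : List (Fin n), GammaTriangle.IsCoxeterWord c → ∀ g : ℤ[X],
        GammaTriangle.IsClusterLocalGamma (CartanMatrix.D n) c g ↔ g = γD n) ∧
      -- the comparison of types `D_n` and `B_{n-1}`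
      (∀ n : ℕ, 3 ≤ n → ΓD n = Y * ΓB (n - 1) + C (γD n)) ∧
      -- the same comparison for the generating series in `t`
      PowerSeries.mk (fun n => if 2 ≤ n then ΓD n else 0) =
        PowerSeries.C (Y : ℤ[X][Y]) * PowerSeries.X * (PowerSeries.mk ΓB - 1) +
          PowerSeries.mk (fun n => if 2 ≤ n then C (γD n) else 0) := by
  choose HB ΓB hΓB hHB hB using GammaTriangle.exists_hTriangle_B
  choose h g hg hD using fun M => GammaTriangle.exists_hTriangle_D M (hHB (M + 1))
  -- Needed for the coefficient of t in the generating series, where y(Γ_{B_0} - 1) must vanish.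
  have h₀ : ΓB 0 = 1 := by
    refine (hΓB 0).unique ?_
    have e : HB 0 = 1 := GammaTriangle.toRat_injective (by
      rw [hHB 0, pow_zero, one_mul, map_one]
      refine GammaTriangle.Vtx.cl_eq_one ?_
      rintro (i | e | ⟨a, b⟩ | ⟨a, b⟩ | ⟨i, e⟩) <;>
        simp [GammaTriangle.Vtx.fullB, GammaTriangle.Vtx.Region])
    rw [e]
    exact GammaTriangle.isGammaTriangle_zero_one
  -- Type D is indexed by M = n - 2, so truncated subtraction gives irrelevant values for n < 2. The
  -- formula defining the second witness is also correct for n = 2.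
  refine ⟨ΓB, fun n => Y * ΓB (n - 1) + C (g (n - 2)), fun n => g (n - 2), ?_, ?_, ?_,
    fun _ _ => rfl, ?_⟩
  · intro n c hc Γ
    rw [GammaTriangle.IsClusterGammaTriangle, Fintype.card_fin, hB n c hc]
    exact GammaTriangle.isGammaTriangle_iff (hΓB n)
  · intro n hn c hc Γ
    obtain ⟨M, rfl⟩ := Nat.exists_eq_add_of_le' hn
    rw [GammaTriangle.IsClusterGammaTriangle, Fintype.card_fin, (hD M c hc).1]
    exact GammaTriangle.isGammaTriangle_iff ((hΓB (M + 1)).add_bottom (hg M))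
  · intro n hn c hc γ
    obtain ⟨M, rfl⟩ := Nat.exists_eq_add_of_le' hn
    rw [GammaTriangle.IsClusterLocalGamma, Fintype.card_fin, (hD M c hc).2]
    exact GammaTriangle.isGammaPoly_iff (hg M)
  · ext1 n
    rw [map_add, mul_assoc, PowerSeries.coeff_C_mul, PowerSeries.coeff_mk, PowerSeries.coeff_mk]
    rcases n with _ | _ | n
    · simp
    · rw [PowerSeries.coeff_succ_X_mul, map_sub, PowerSeries.coeff_mk, PowerSeries.coeff_one]
      simp [h₀]
    · rw [PowerSeries.coeff_succ_X_mul, map_sub, PowerSeries.coeff_mk, PowerSeries.coeff_one,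
        if_pos (Nat.le_add_left 2 n), if_pos (Nat.le_add_left 2 n),
        if_neg (Nat.succ_ne_zero n), sub_zero]
      rfl
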